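/- **Setting.** Let $N\ge 1$ and let $\mathcal D$ be a distribution of hyperplanes in $\mathbb R^N$ with a global frame $X_i=\sum_{j=1}^N A_i^j(x)\,\partial_{x^j}$, $i=1,\dots,N$, such that $X_1,\dots,X_{N-1}$ span $\mathcal D_x$ at every $x$, the $A_i^j$ are $C^\infty$ with $\|\partial_x^I A_i^j\|_{L^\infty}<\infty$ for all multiindices $I$, and $|\det (A_i^j(x))|\ge c>0$ for all $x$. Let $(B_j^k)$ be the inverse matrix, $\sum_j A_i^jB_j^k=\delta_i^k$. Put $$\rho_x(\xi)=\Big(\sum_{i=1}^{N-1}\Big|\sum_{j=1}^N A_i^j(x)\xi_j\Big|^2\Big)^{1/2},\qquad d(x,y)=|x-y|+\Big|\sum_{j=1}^N B_j^N(x)(x^j-y^j)\Big|^{1/2},$$ $$D_\xi=\sum_j B_j^N(x)\partial_{\xi_j},\qquad D_i=\partial_{x^i}+\sum_{k,p,l}\frac{\partial B_k^p}{\partial x^i}(x)A_p^l(x)\,\xi_l\,\partial_{\xi_k},$$ $$D_{x,y,i}=\partial_{x^i}+\partial_{y^i}+\sum_{k,p,l}\frac{\partial B_k^p}{\partial x^i}(x)A_p^l(x)(x^k-y^k)\,\partial_{y^l},$$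 and $D^I=D_{i_1}\cdots D_{i_r}$, $D_{x,y}^I=D_{x,y,i_1}\cdots D_{x,y,i_r}$ for $I=(i_1,\dots,i_r)$. For real $m,n$, the class $S^{m,n}$ consists of all $a\in C^\infty(\mathbb R^N\times\mathbb R^N;\mathbb C)$ such that for all $\alpha,\beta,I$ there is a constant $C$ with $$|\partial_\xi^\alpha D_\xi^\beta D^I a(x,\xi)|\le C(1+|\xi|)^{m-|\beta|}\big(1+\rho_x(\xi)+|\xi|^{1/2}\big)^{n-|\alpha|}\quad\text{for all }x,\xi .$$ For $a\in S^{m,n}$ and $f\in\mathcal S(\mathbb R^N)$ let $$T_af(x)=\int_{\mathbb R^N}a(x,\xi)\,\widehat f(\xi)\,e^{2\pi i x\cdot\xi}\,d\xi,\qquad \widehat f(\xi)=\int_{\mathbb R^N} f(x)\,e^{-2\pi i x\cdot\xi}\,dx.$$ **Theorem.** Let $-1<m<0$ and $-(N-1)<n<0$. Let $K$ be a complex-valued distribution on $\mathbb R^N\times\mathbb R^N$ that is given by integration against a locally integrable function (so $K$ has no part concentrated on the diagonal). Suppose that $K$ is smooth away from the diagonal $\{x=y\}$ and that for all words $I$,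 $\gamma$, $\lambda$ of derivatives and all $M\ge 0$ there is a constant $C$ with $$\big|D_{x,y}^I(X'_{x,y})^\gamma\partial_{x,y}^\lambda K(x,y)\big|\le\frac{C}{|x-y|^{(N-1)+n+|\gamma|+M}\;d(x,y)^{2(1+m+|\lambda|)}}\qquad\text{for all } x\ne y,$$ where $(X'_{x,y})^\gamma$ is any composition of $|\gamma|$ of the vector fields $X_1,\dots,X_{N-1}$, each acting in $x$ or in $y$, and $\partial_{x,y}^\lambda$ is any composition of $|\lambda|$ of the derivatives $\partial_{x^j},\partial_{y^j}$. Then there exists $a\in S^{m,n}$ such that $T_af(x)=\int K(x,y)f(y)\,dy$ for all $f\in\mathcal S(\mathbb R^N)$, in the sense that $K$ extends to a tempered distribution and $$\int_{\mathbb R^N}T_af(x)\,g(x)\,dx=\langle K(x,y),\,f(y)g(x)\rangle\qquad\text{for all }f,g\in\mathcal S(\mathbb R^N).$$ -/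

import Mathlib

open MeasureTheory TopologicalSpace
open scoped ContDiff SchwartzMap Distributions FourierTransform Matrix

namespace MixedSymbol

/-- The space `ℝ^N` with `N = d + 1`.  The index `Fin.last d` is the `N`-th one, and
`Fin.castSucc i`, for `i : Fin d`, runs through the first `N - 1` ones. -/
abbrev RN (d : ℕ) := EuclideanSpace ℝ (Fin (d + 1))

/-- The standard basis vector `e_j`. -/
noncomputable def e {d : ℕ} (j : Fin (d + 1)) : RN d := EuclideanSpace.single j 1

/-- A global frame `X_i = ∑_j A_i^j(x) ∂/∂x^j`, `i = 1, …, N` (with `A x i j = A_i^j(x)`), whose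
first `N - 1` vectors span the hyperplane `H x` at every `x`, whose coefficients have bounded
derivatives of every order, and whose determinant is bounded away from zero. -/
structure AdaptedFrame {d : ℕ} (H : RN d → Submodule ℝ (RN d)) where
  A : RN d → Matrix (Fin (d + 1)) (Fin (d + 1)) ℝ
  smooth : ∀ i j, ContDiff ℝ ∞ (fun x => A x i j)
  bounded : ∀ i j (k : ℕ), ∃ C : ℝ, ∀ x, ‖iteratedFDeriv ℝ k (fun x => A x i j) x‖ ≤ C
  det_bound : ∃ c : ℝ, 0 < c ∧ ∀ x, c ≤ |(A x).det|
  span_eq : ∀ x, H x =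
    Submodule.span ℝ (Set.range fun i : Fin d => (WithLp.toLp 2 (A x i.castSucc) : RN d))

/-- The derivative `V F` of a function on `ℝ^N × ℝ^N` along the vector field `V`. -/
noncomputable def along {d : ℕ} (V : RN d × RN d → RN d × RN d) (F : RN d × RN d → ℂ) :
    RN d × RN d → ℂ :=
  fun p => fderiv ℝ F p (V p)

/-- Composition of the derivatives along the vector fields of a list: `V₁ V₂ ⋯ V_k F`. -/
noncomputable def alongList {d : ℕ} (Vs : List (RN d × RN d → RN d × RN d))
    (F : RN d × RN d → ℂ) : RN d × RN d → ℂ :=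
  Vs.foldr along F

/-- The coordinate vector fields `∂/∂x^j` on pairs `(x, y)`. -/
noncomputable def partialFst {d : ℕ} (j : Fin (d + 1)) : RN d × RN d → RN d × RN d :=
  fun _ => (e j, 0)

/-- The coordinate vector fields `∂/∂y^j` on pairs `(x, y)`, or `∂/∂ξ_j` on pairs `(x, ξ)`. -/
noncomputable def partialSnd {d : ℕ} (j : Fin (d + 1)) : RN d × RN d → RN d × RN d :=
  fun _ => (0, e j)

namespace AdaptedFrame

variable {d : ℕ} {H : RN d → Submodule ℝ (RN d)} (X : AdaptedFrame H)

/-- The inverse matrix, `B x j k = B_j^k(x)`, so that `∑_j A_i^j B_j^k = δ_i^k`. -/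
noncomputable def B (x : RN d) : Matrix (Fin (d + 1)) (Fin (d + 1)) ℝ := (X.A x)⁻¹

/-- `∂B_k^p/∂x^i (x)`. -/
noncomputable def dB (i k p : Fin (d + 1)) (x : RN d) : ℝ :=
  fderiv ℝ (fun z => X.B z k p) x (e i)

/-- The frame vector `X_i` at the point `x`. -/
noncomputable def vec (i : Fin (d + 1)) (x : RN d) : RN d := WithLp.toLp 2 (X.A x i)

/-- `(M_x ξ)_i = ∑_j A_i^j(x) ξ_j`. -/
noncomputable def M (x ξ : RN d) (i : Fin (d + 1)) : ℝ := ∑ j, X.A x i j * ξ j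

/-- The seminorm `ρ_x(ξ)`. -/
noncomputable def rho (x ξ : RN d) : ℝ := √(∑ i : Fin d, (X.M x ξ i.castSucc) ^ 2)

/-- `Θ₀(x,y)_i = ∑_j B_j^i(x) (x^j - y^j)`. -/
noncomputable def Theta (x y : RN d) (i : Fin (d + 1)) : ℝ := ∑ j, X.B x j i * (x j - y j)

/-- The quasi-distance `d(x,y) = |x - y| + |Θ₀(x,y)_N|^{1/2}`. -/
noncomputable def qdist (x y : RN d) : ℝ := ‖x - y‖ + √|X.Theta x y (Fin.last d)|

/-- `D_ξ = ∑_j B_j^N(x) ∂/∂ξ_j`. -/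
noncomputable def DXi : RN d × RN d → RN d × RN d :=
  fun p => (0, ∑ j, X.B p.1 j (Fin.last d) • e j)

/-- `D_i = ∂/∂x^i + ∑_{k,p,l} ∂B_k^p/∂x^i(x) A_p^l(x) ξ_l ∂/∂ξ_k`. -/
noncomputable def DSym (i : Fin (d + 1)) : RN d × RN d → RN d × RN d :=
  fun q => (e i, ∑ k, ∑ p, ∑ l, (X.dB i k p q.1 * X.A q.1 p l * q.2 l) • e k)

/-- `a ∈ S^{m,n}`. -/
def IsSymbol (m n : ℝ) (a : RN d × RN d → ℂ) : Prop :=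
  ContDiff ℝ ∞ a ∧
  ∀ (α : List (Fin (d + 1))) (β : ℕ) (I : List (Fin (d + 1))), ∃ C : ℝ, ∀ x ξ : RN d,
    ‖alongList (α.map partialSnd ++ List.replicate β X.DXi ++ I.map X.DSym) a (x, ξ)‖ ≤
      C * (1 + ‖ξ‖) ^ (m - β) * (1 + X.rho x ξ + √‖ξ‖) ^ (n - α.length)

/-- `(X_i)_x` (for `Sum.inl i`) and `(X_i)_y` (for `Sum.inr i`), `i = 1, …, N - 1`. -/
noncomputable def goodX : Fin d ⊕ Fin d → RN d × RN d → RN d × RN d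
  | Sum.inl i => fun p => (X.vec i.castSucc p.1, 0)
  | Sum.inr i => fun p => (0, X.vec i.castSucc p.2)

/-- `D_{x,y,i} = ∂/∂x^i + ∂/∂y^i + ∑_{k,p,l} ∂B_k^p/∂x^i(x) A_p^l(x) (x^k - y^k) ∂/∂y^l`. -/
noncomputable def DKer (i : Fin (d + 1)) : RN d × RN d → RN d × RN d :=
  fun q => (e i, e i +
    ∑ k, ∑ p, ∑ l, (X.dB i k p q.1 * X.A q.1 p l * (q.1 k - q.2 k)) • e l)

end AdaptedFrame

/-- `∂/∂x^j` (for `Sum.inl j`) and `∂/∂y^j` (for `Sum.inr j`). -/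
noncomputable def anyPartial {d : ℕ} :
    Fin (d + 1) ⊕ Fin (d + 1) → RN d × RN d → RN d × RN d
  | Sum.inl j => partialFst j
  | Sum.inr j => partialSnd j

/-- The complement of the diagonal. -/
def offDiag (d : ℕ) : Set (RN d × RN d) := {p | p.1 ≠ p.2}

/-- The distribution `K` on `ℝ^N × ℝ^N` is smooth away from the diagonal and satisfies there
`|D_{x,y}^I (X'_{x,y})^γ ∂_{x,y}^λ K(x,y)| ≲ |x-y|^{-((N-1)+n+|γ|+M)} d(x,y)^{-2(1+m+|λ|)}`
for all words `I`, `γ`, `λ` of derivatives and all `M ≥ 0`, the constant depending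
on `I`, `γ`, `λ`, `M`. -/
def KernelEstimates {d : ℕ} {H : RN d → Submodule ℝ (RN d)} (X : AdaptedFrame H) (m n : ℝ)
    (K : 𝓓'((⊤ : Opens (RN d × RN d)), ℂ)) : Prop :=
  ∃ k : RN d × RN d → ℂ,
    ContDiffOn ℝ ∞ k (offDiag d) ∧
    (∀ φ : 𝓓((⊤ : Opens (RN d × RN d)), ℝ), tsupport φ ⊆ offDiag d →
      K φ = ∫ p, φ p • k p) ∧
    ∀ (I : List (Fin (d + 1))) (γ : List (Fin d ⊕ Fin d))
      (l : List (Fin (d + 1) ⊕ Fin (d + 1))) (M : ℝ), 0 ≤ M →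
      ∃ C : ℝ, ∀ x y : RN d, x ≠ y →
        ‖alongList (I.map X.DKer ++ γ.map X.goodX ++ l.map anyPartial) k (x, y)‖ ≤
          C / (‖x - y‖ ^ ((d : ℝ) + n + γ.length + M) *
            X.qdist x y ^ (2 * (1 + m + l.length)))

/-- The distribution `K` is given by integration against a locally integrable function
(so it has no part concentrated on the diagonal). -/
def IsLocallyIntegrableDistribution {d : ℕ} (K : 𝓓'((⊤ : Opens (RN d × RN d)), ℂ)) : Prop :=
  ∃ h : RN d × RN d → ℂ, LocallyIntegrable h volume ∧
    ∀ φ : 𝓓((⊤ : Opens (RN d × RN d)), ℝ), K φ = ∫ p, φ p • h p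

/-- `T_a f(x) = ∫ a(x,ξ) f̂(ξ) e^{2πi x·ξ} dξ`, where `f̂(ξ) = ∫ f(x) e^{-2πi x·ξ} dx`. -/
noncomputable def pseudo {d : ℕ} (a : RN d × RN d → ℂ) (f : 𝓢(RN d, ℂ)) (x : RN d) : ℂ :=
  ∫ ξ : RN d, a (x, ξ) * 𝓕 (f : RN d → ℂ) ξ *
    Complex.exp (2 * Real.pi * Complex.I * (inner ℝ x ξ : ℝ))

theorem tensor_decay {d : ℕ} (f g : 𝓢(RN d, ℂ)) (k n : ℕ) : ∃ C : ℝ, ∀ p : RN d × RN d,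
    ‖p‖ ^ k * ‖iteratedFDeriv ℝ n (fun p : RN d × RN d => f p.2 * g p.1) p‖ ≤ C := by
  choose Cf hfp hf using fun k n => f.decay k n
  choose Cg hgp hg using fun k n => g.decay k n
  refine ⟨∑ i ∈ Finset.range (n + 1), (n.choose i : ℝ) *
    (Cf 0 i * Cg k (n - i) + Cf k i * Cg 0 (n - i)), fun p => ?_⟩
  have hF : ContDiff ℝ ∞ (fun p : RN d × RN d => f p.2) := (f.smooth ⊤).comp contDiff_snd
  have hG : ContDiff ℝ ∞ (fun p : RN d × RN d => g p.1) := (g.smooth ⊤).comp contDiff_fst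
  have h1 := norm_iteratedFDeriv_mul_le (𝕜 := ℝ) hF hG p (n := n) (mod_cast le_top)
  have hf1 : ∀ i, ‖iteratedFDeriv ℝ i (fun p : RN d × RN d => f p.2) p‖ ≤
      ‖iteratedFDeriv ℝ i f p.2‖ := by
    intro i
    have h2 := (ContinuousLinearMap.snd ℝ (RN d) (RN d)).iteratedFDeriv_comp_right
      (f.smooth ⊤) p (i := i) (mod_cast le_top)
    have h3 : (fun p : RN d × RN d => f p.2) = f ∘ (ContinuousLinearMap.snd ℝ (RN d) (RN d)) := rfl
    rw [h3, h2]
    refine (ContinuousMultilinearMap.norm_compContinuousLinearMap_le _ _).trans ?_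
    refine mul_le_of_le_one_right (norm_nonneg _) ?_
    exact Finset.prod_le_one (fun _ _ => norm_nonneg _)
      (fun _ _ => ContinuousLinearMap.norm_snd_le ℝ (RN d) (RN d))
  have hg1 : ∀ i, ‖iteratedFDeriv ℝ i (fun p : RN d × RN d => g p.1) p‖ ≤
      ‖iteratedFDeriv ℝ i g p.1‖ := by
    intro i
    have h2 := (ContinuousLinearMap.fst ℝ (RN d) (RN d)).iteratedFDeriv_comp_right
      (g.smooth ⊤) p (i := i) (mod_cast le_top)
    have h3 : (fun p : RN d × RN d => g p.1) = g ∘ (ContinuousLinearMap.fst ℝ (RN d) (RN d)) := rfl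
    rw [h3, h2]
    refine (ContinuousMultilinearMap.norm_compContinuousLinearMap_le _ _).trans ?_
    refine mul_le_of_le_one_right (norm_nonneg _) ?_
    exact Finset.prod_le_one (fun _ _ => norm_nonneg _)
      (fun _ _ => ContinuousLinearMap.norm_fst_le ℝ (RN d) (RN d))
  have hp : ‖p‖ ^ k ≤ ‖p.1‖ ^ k + ‖p.2‖ ^ k := by
    rcases max_choice ‖p.1‖ ‖p.2‖ with h | h <;> rw [Prod.norm_def, h]
    · exact le_add_of_nonneg_right (by positivity)
    · exact le_add_of_nonneg_left (by positivity)
  refine (mul_le_mul hp h1 (norm_nonneg _) (by positivity)).trans ?_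
  rw [Finset.mul_sum]
  refine Finset.sum_le_sum fun i _ => ?_
  set a := ‖iteratedFDeriv ℝ i f p.2‖
  set b := ‖iteratedFDeriv ℝ (n - i) g p.1‖
  have ha : 0 ≤ a := norm_nonneg _
  have hb : 0 ≤ b := norm_nonneg _
  have q1 : a ≤ Cf 0 i := (by simpa only [pow_zero, one_mul] using hf 0 i p.2)
  have q2 : ‖p.2‖ ^ k * a ≤ Cf k i := hf k i p.2
  have q3 : b ≤ Cg 0 (n - i) := (by simpa only [pow_zero, one_mul] using hg 0 (n - i) p.1)
  have q4 : ‖p.1‖ ^ k * b ≤ Cg k (n - i) := hg k (n - i) p.1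
  have r1 : a * (‖p.1‖ ^ k * b) ≤ Cf 0 i * Cg k (n - i) :=
    mul_le_mul q1 q4 (by positivity) (ha.trans q1)
  have r2 : (‖p.2‖ ^ k * a) * b ≤ Cf k i * Cg 0 (n - i) :=
    mul_le_mul q2 q3 hb ((by positivity : (0 : ℝ) ≤ ‖p.2‖ ^ k * a).trans q2)
  calc (‖p.1‖ ^ k + ‖p.2‖ ^ k) * ((n.choose i : ℝ) *
        ‖iteratedFDeriv ℝ i (fun p : RN d × RN d => f p.2) p‖ *
        ‖iteratedFDeriv ℝ (n - i) (fun p : RN d × RN d => g p.1) p‖)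
      ≤ (‖p.1‖ ^ k + ‖p.2‖ ^ k) * ((n.choose i : ℝ) * a * b) := by
        gcongr
        · exact hf1 i
        · exact hg1 (n - i)
    _ = (n.choose i : ℝ) * (a * (‖p.1‖ ^ k * b) + (‖p.2‖ ^ k * a) * b) := by ring
    _ ≤ _ := by gcongr

/-- The Schwartz function `(x, y) ↦ f(y) g(x)`. -/
noncomputable def tensor {d : ℕ} (f g : 𝓢(RN d, ℂ)) : 𝓢(RN d × RN d, ℂ) where
  toFun p := f p.2 * g p.1
  smooth' := ((f.smooth ⊤).comp contDiff_snd).mul ((g.smooth ⊤).comp contDiff_fst)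
  decay' := tensor_decay f g

/-- A real test function, as a complex-valued Schwartz function. -/
noncomputable def testToSchwartz {d : ℕ} (φ : 𝓓((⊤ : Opens (RN d × RN d)), ℝ)) :
    𝓢(RN d × RN d, ℂ) :=
  HasCompactSupport.toSchwartzMap (f := fun p => ((φ p : ℝ) : ℂ))
    (φ.hasCompactSupport.comp_left (g := fun t : ℝ => (t : ℂ)) Complex.ofReal_zero)
    (Complex.ofRealCLM.contDiff.comp φ.contDiff)

/-- `T_a f(x) = ∫ K(x,y) f(y) dy` for all Schwartz `f`, in the sense that the distribution `K`
is tempered (extends continuously to Schwartz functions; the extension is unique by density) and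
`⟨T_a f, g⟩ = ⟨K(x,y), f(y) g(x)⟩` for all Schwartz `f`, `g`. -/
def IsKernelOf {d : ℕ} (K : 𝓓'((⊤ : Opens (RN d × RN d)), ℂ)) (a : RN d × RN d → ℂ) : Prop :=
  ∃ T : 𝓢'(RN d × RN d, ℂ),
    (∀ φ : 𝓓((⊤ : Opens (RN d × RN d)), ℝ), T (testToSchwartz φ) = K φ) ∧
    ∀ f g : 𝓢(RN d, ℂ), ∫ x, pseudo a f x * g x = T (tensor f g)

end MixedSymbol

/-! Let k be the smooth density of K off the diagonal. The symbol has to be a(x,ξ) = ∫ k(x,y)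
e^{2πi(y-x)·ξ} dy, and m, n < 0 make k(x,·) integrable, uniformly in x. Everything is read in the
coordinates y = x - Σ t^q X_q(x) (`chart`). There t = Θ₀(x,y), so |x-y| is comparable to |t| and
d(x,y)² to |t^N| + |t|². The vector fields of the theorem are made for these coordinates: D_{x,y,i}
is ∂/∂x^i at fixed t, and dually D_i is ∂/∂x^i at fixed η = M_x ξ.

Kernel side (`cl_kernel`). The derivative -∂/∂t^j is Σ_l A_j^l(x) ∂/∂y^l, that is, X_j with
coefficients frozen at x. For j < N it differs from X_j at y by derivatives with coefficients
O(|t|), and since |t|/(|t^N|+|t|²) ≤ 1/|t| this error costs no more than a good derivative. Hence,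
up to powers of 1+|t|, each ∂/∂t^j with j < N costs |t|⁻¹, ∂/∂t^N costs (|t^N|+|t|²)⁻¹, and ∂/∂x^i
costs nothing. The freedom in M gives rapid decay at infinity, which absorbs those powers.

Fourier side (`ft_bound`). With G = |det A| · (k in the chart), a(x,ξ) is the Fourier transform of
G(x,·) at M_x ξ. Write η' for the first N-1 coordinates of η and t' for those of t. Integration by
parts (`Rap.improve`) multiplies the weight of G by inverse powers of 1+4π²|η|²((t^N)²+|t|⁴) and of
1+4π²|η'|²|t|². The origin contributes no boundary term: N ≥ 2, so almost every line in a given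
direction misses it (`integral_deriv_eq_zero`). The result is dominated by a function of t^N at
scale (1+|η|)⁻¹ times a function of t' at scale (1+|η'|+|η|^{1/2})⁻¹ (`wt_le_dom`), and rescaling
the two integrals gives exactly (1+|η|)^m (1+|η'|+|η|^{1/2})^n.

Derivatives of a (`exists_alongList_symb`). On G, D_i acts as ∂/∂x^i, D_ξ as multiplication by a
multiple of t^N, and ∂/∂ξ_j as multiplication by a combination of the t^i. The last two lower the
order of the singularity by one, so the bound for G also covers all derivatives of a.

Finally, Fubini and Fourier inversion give T_a f = ∫ k(·,y) f(y) dy, and K is integration against k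
because K is locally integrable and the diagonal is null. -/

namespace MixedSymbol

/-! ### Calculus of weighted derivative estimates. -/

/-- A letter stands for `∂/∂x^j` (`Sum.inl j`) or `∂/∂t^j` (`Sum.inr j`). -/
abbrev Letter (d : ℕ) := Fin (d + 1) ⊕ Fin (d + 1)

/-- The pairs `(x, t)` with `t ≠ 0`. -/
def punctured (d : ℕ) : Set (RN d × RN d) := {p | p.2 ≠ 0}

theorem isOpen_punctured (d : ℕ) : IsOpen (punctured d) :=
  isOpen_ne.preimage continuous_snd

/-- The anisotropic gauge `|t^N| + |t|²`. -/
noncomputable def aniso {d : ℕ} (t : RN d) : ℝ := |t (Fin.last d)| + ‖t‖ ^ 2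

theorem aniso_pos {d : ℕ} {t : RN d} (ht : t ≠ 0) : 0 < aniso t := by
  have : 0 < ‖t‖ := norm_pos_iff.2 ht
  unfold aniso; positivity

theorem abs_coord_le_norm {d : ℕ} (t : RN d) (j : Fin (d + 1)) : |t j| ≤ ‖t‖ := by
  simpa using PiLp.norm_apply_le t j

theorem aniso_le {d : ℕ} (t : RN d) : aniso t ≤ ‖t‖ * (1 + ‖t‖) := by
  have := abs_coord_le_norm t (Fin.last d)
  unfold aniso; nlinarith

/-- The price of a derivative in the estimates below. -/
noncomputable def cost {d : ℕ} : Letter d → RN d → ℝ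
  | Sum.inl _, t => (1 + ‖t‖) ^ 2
  | Sum.inr j, t => (1 + ‖t‖) ^ 2 / (if j = Fin.last d then aniso t else ‖t‖)

theorem cost_pos {d : ℕ} (v : Letter d) {t : RN d} (ht : t ≠ 0) : 0 < cost v t := by
  have h : 0 < ‖t‖ := norm_pos_iff.2 ht
  have := aniso_pos ht
  rcases v with j | j
  · simp only [cost]; positivity
  · simp only [cost]; split_ifs <;> positivity

variable {d : ℕ} {ι : Type*}

/-- The derivative of a family of functions along a letter. -/
noncomputable def der (v : Letter d) (F : ι → RN d × RN d → ℂ) : ι → RN d × RN d → ℂ :=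
  fun i => along (anyPartial v) (F i)

/-- `|∂_w F(x,t)| ≤ C ρ(t) ∏_{v ∈ w} cost_v(t)` for `t ≠ 0`, uniformly in the family; the head
of the word acts first. -/
def Est : List (Letter d) → (ι → RN d → ℝ) → (ι → RN d × RN d → ℂ) → Prop
  | [], ρ, F => ∃ C : ℝ, 0 ≤ C ∧ ∀ i x t, t ≠ 0 → ‖F i (x, t)‖ ≤ C * ρ i t
  | v :: w, ρ, F => Est w (fun i t => ρ i t * cost v t) (der v F)

/-- All members of the family are smooth for `t ≠ 0`. -/
def Sm (F : ι → RN d × RN d → ℂ) : Prop := ∀ i, ContDiffOn ℝ ∞ (F i) (punctured d)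

/-- Estimates for all words. -/
def Cl (ρ : ι → RN d → ℝ) (F : ι → RN d × RN d → ℂ) : Prop := Sm F ∧ ∀ w, Est w ρ F

/-- The two families agree for `t ≠ 0`. -/
def Agree (F G : ι → RN d × RN d → ℂ) : Prop := ∀ i, Set.EqOn (F i) (G i) (punctured d)

theorem along_eqOn {U : Set (RN d × RN d)} (hU : IsOpen U) (V : RN d × RN d → RN d × RN d)
    {F G : RN d × RN d → ℂ} (h : Set.EqOn F G U) : Set.EqOn (along V F) (along V G) U := by
  intro p hp
  have : F =ᶠ[nhds p] G := h.eventuallyEq_of_mem (hU.mem_nhds hp)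
  simp only [along, this.fderiv_eq]

theorem along_contDiffOn {U : Set (RN d × RN d)} (hU : IsOpen U)
    {V : RN d × RN d → RN d × RN d} (hV : ContDiff ℝ ∞ V)
    {F : RN d × RN d → ℂ} (hF : ContDiffOn ℝ ∞ F U) : ContDiffOn ℝ ∞ (along V F) U :=
  (hF.fderiv_of_isOpen hU (by simp)).clm_apply hV.contDiffOn

theorem along_add {F G : RN d × RN d → ℂ} {p : RN d × RN d} (V : RN d × RN d → RN d × RN d)
    (hF : DifferentiableAt ℝ F p) (hG : DifferentiableAt ℝ G p) :
    along V (F + G) p = along V F p + along V G p := by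
  simp [along, fderiv_add hF hG]

theorem along_mul {F G : RN d × RN d → ℂ} {p : RN d × RN d} (V : RN d × RN d → RN d × RN d)
    (hF : DifferentiableAt ℝ F p) (hG : DifferentiableAt ℝ G p) :
    along V (F * G) p = along V F p * G p + F p * along V G p := by
  simp [along, fderiv_mul hF hG]; ring

theorem contDiff_anyPartial (v : Letter d) : ContDiff ℝ ∞ (anyPartial (d := d) v) := by
  rcases v with j | j <;> exact contDiff_const

theorem ContDiffOn.diffAt {U : Set (RN d × RN d)} (hU : IsOpen U) {F : RN d × RN d → ℂ}
    (hF : ContDiffOn ℝ ∞ F U) {p : RN d × RN d} (hp : p ∈ U) : DifferentiableAt ℝ F p :=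
  (hF.differentiableOn (by simp)).differentiableAt (hU.mem_nhds hp)

theorem Sm.diffAt {F : ι → RN d × RN d → ℂ} (hF : Sm F) (i : ι) {p : RN d × RN d}
    (hp : p ∈ punctured d) : DifferentiableAt ℝ (F i) p :=
  ContDiffOn.diffAt (isOpen_punctured d) (hF i) hp

protected theorem Sm.der {F : ι → RN d × RN d → ℂ} (hF : Sm F) (v : Letter d) : Sm (der v F) :=
  fun i => along_contDiffOn (isOpen_punctured d) (contDiff_anyPartial v) (hF i)

protected theorem Sm.add {F G : ι → RN d × RN d → ℂ} (hF : Sm F) (hG : Sm G) : Sm (F + G) :=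
  fun i => (hF i).add (hG i)

protected theorem Sm.mul {F G : ι → RN d × RN d → ℂ} (hF : Sm F) (hG : Sm G) : Sm (F * G) :=
  fun i => (hF i).mul (hG i)

theorem Sm.congr {F G : ι → RN d × RN d → ℂ} (hF : Sm F) (h : Agree F G) : Sm G :=
  fun i => (hF i).congr (fun _ hp => (h i hp).symm)

protected theorem Agree.der {F G : ι → RN d × RN d → ℂ} (h : Agree F G) (v : Letter d) :
    Agree (der v F) (der v G) :=
  fun i => along_eqOn (isOpen_punctured d) _ (h i)

theorem Agree.symm {F G : ι → RN d × RN d → ℂ} (h : Agree F G) : Agree G F :=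
  fun i => (h i).symm

theorem agree_der_add {F G : ι → RN d × RN d → ℂ} (hF : Sm F) (hG : Sm G) (v : Letter d) :
    Agree (der v F + der v G) (der v (F + G)) :=
  fun i _ hp => (along_add _ (hF.diffAt i hp) (hG.diffAt i hp)).symm

theorem agree_der_mul {F G : ι → RN d × RN d → ℂ} (hF : Sm F) (hG : Sm G) (v : Letter d) :
    Agree (der v F * G + F * der v G) (der v (F * G)) :=
  fun i _ hp => (along_mul _ (hF.diffAt i hp) (hG.diffAt i hp)).symm

theorem agree_der_comm {F : ι → RN d × RN d → ℂ} (hF : Sm F) (u v : Letter d) :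
    Agree (der u (der v F)) (der v (der u F)) := by
  intro i p hp
  have h2 : ContDiffAt ℝ 2 (F i) p :=
    ((hF i).contDiffAt ((isOpen_punctured d).mem_nhds hp)).of_le (by norm_cast)
  have hs : IsSymmSndFDerivAt ℝ (F i) p := h2.isSymmSndFDerivAt (by simp)
  have hd : DifferentiableAt ℝ (fderiv ℝ (F i)) p :=
    (h2.fderiv_right (m := 1) (by norm_num)).differentiableAt (by simp)
  have key : ∀ u v : Letter d, der u (der v F) i p =
      fderiv ℝ (fderiv ℝ (F i)) p (anyPartial u p) (anyPartial v p) := by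
    intro u v
    have hc : ∀ v : Letter d, ∃ c : RN d × RN d, anyPartial v = fun _ => c := by
      intro v; rcases v with j | j
      · exact ⟨_, rfl⟩
      · exact ⟨_, rfl⟩
    obtain ⟨c, hc⟩ := hc v
    show fderiv ℝ (fun y => fderiv ℝ (F i) y (anyPartial v y)) p (anyPartial u p) = _
    simp only [hc]
    rw [fderiv_clm_apply hd (differentiableAt_const c)]
    simp
  rw [key, key, hs.eq]

theorem Est.congr {w : List (Letter d)} {ρ : ι → RN d → ℝ} {F G : ι → RN d × RN d → ℂ}
    (h : Est w ρ F) (hFG : Agree F G) : Est w ρ G := by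
  induction w generalizing ρ F G with
  | nil =>
    obtain ⟨C, h0, hC⟩ := h
    exact ⟨C, h0, fun i x t ht => by rw [← hFG i (show (x, t) ∈ punctured d from ht)]; exact hC i x t ht⟩
  | cons v w ih => exact ih (show Est w _ (der v F) from h) (hFG.der v)

theorem Est.mono {w : List (Letter d)} {ρ ρ' : ι → RN d → ℝ} {F : ι → RN d × RN d → ℂ}
    (h : Est w ρ F) {c : ℝ} (hc : 0 ≤ c) (hρ : ∀ i t, t ≠ 0 → ρ i t ≤ c * ρ' i t) :
    Est w ρ' F := by
  induction w generalizing ρ ρ' F with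
  | nil =>
    obtain ⟨C, h0, hC⟩ := h
    refine ⟨C * c, by positivity, fun i x t ht => (hC i x t ht).trans ?_⟩
    rw [mul_assoc]; exact mul_le_mul_of_nonneg_left (hρ i t ht) h0
  | cons v w ih =>
    refine ih (show Est w _ (der v F) from h) fun i t ht => ?_
    rw [← mul_assoc]
    exact mul_le_mul_of_nonneg_right (hρ i t ht) (cost_pos v ht).le

theorem Est.add {w : List (Letter d)} {ρ : ι → RN d → ℝ} {F G : ι → RN d × RN d → ℂ}
    (sF : Sm F) (sG : Sm G) (hF : Est w ρ F) (hG : Est w ρ G) : Est w ρ (F + G) := by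
  induction w generalizing ρ F G with
  | nil =>
    obtain ⟨C, h0, hC⟩ := hF
    obtain ⟨C', h0', hC'⟩ := hG
    refine ⟨C + C', by positivity, fun i x t ht => (norm_add_le _ _).trans ?_⟩
    rw [add_mul]; exact add_le_add (hC i x t ht) (hC' i x t ht)
  | cons v w ih =>
    exact (ih (sF.der v) (sG.der v) hF hG).congr (agree_der_add sF sG v)

/-- Leibniz rule: each derivative of the word falls on one of the two factors, so only sublists of
the word meet each factor. The costs are shared out accordingly and their product is unchanged. -/
theorem Est.mul {w : List (Letter d)} {ρ ρ' : ι → RN d → ℝ} {F G : ι → RN d × RN d → ℂ}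
    (sF : Sm F) (sG : Sm G) (hF : ∀ u, u.Sublist w → Est u ρ F)
    (hG : ∀ u, u.Sublist w → Est u ρ' G) : Est w (fun i t => ρ i t * ρ' i t) (F * G) := by
  induction w generalizing ρ ρ' F G with
  | nil =>
    obtain ⟨C, h0, hC⟩ := hF [] (List.Sublist.refl _)
    obtain ⟨C', h0', hC'⟩ := hG [] (List.Sublist.refl _)
    refine ⟨C * C', by positivity, fun i x t ht => ?_⟩
    have : ‖(F * G) i (x, t)‖ = ‖F i (x, t)‖ * ‖G i (x, t)‖ := norm_mul _ _
    rw [this]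
    calc _ ≤ (C * ρ i t) * (C' * ρ' i t) :=
          mul_le_mul (hC i x t ht) (hC' i x t ht) (norm_nonneg _)
            ((norm_nonneg _).trans (hC i x t ht))
      _ = _ := by ring
  | cons v w ih =>
    have h1 := ih (sF.der v) sG (fun u hu => hF (v :: u) (hu.cons_cons v))
      (fun u hu => hG u (hu.cons v))
    have h2 := ih sF (sG.der v) (fun u hu => hF u (hu.cons v))
      (fun u hu => hG (v :: u) (hu.cons_cons v))
    show Est w _ (der v (F * G))
    refine Est.congr (Est.add ((sF.der v).mul sG) (sF.mul (sG.der v)) ?_ ?_)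
      (agree_der_mul sF sG v)
    · exact h1.mono zero_le_one (fun i t _ => by rw [one_mul]; exact le_of_eq (by ring))
    · exact h2.mono zero_le_one (fun i t _ => by rw [one_mul]; exact le_of_eq (by ring))

/-- Coordinate derivatives commute and the product of costs is symmetric. This allows a chosen
t-derivative to act before all the others. -/
theorem Est.perm {w w' : List (Letter d)} (h : w.Perm w') {ρ : ι → RN d → ℝ}
    {F : ι → RN d × RN d → ℂ} (sF : Sm F) (hF : Est w ρ F) : Est w' ρ F := by
  induction h generalizing ρ F with
  | nil => exact hF
  | cons v _ ih => exact ih (sF.der v) hF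
  | swap u v w =>
    have h1 : Est w (fun i t => ρ i t * cost v t * cost u t) (der u (der v F)) := hF
    exact (h1.congr (agree_der_comm sF u v)).mono zero_le_one
      (fun i t _ => by rw [one_mul]; exact le_of_eq (by ring))
  | trans _ _ ih1 ih2 => exact ih2 sF (ih1 sF hF)

theorem Cl.congr {ρ : ι → RN d → ℝ} {F G : ι → RN d × RN d → ℂ} (h : Cl ρ F)
    (hFG : Agree F G) : Cl ρ G :=
  ⟨h.1.congr hFG, fun w => (h.2 w).congr hFG⟩

theorem Cl.mono {ρ ρ' : ι → RN d → ℝ} {F : ι → RN d × RN d → ℂ} (h : Cl ρ F) {c : ℝ}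
    (hc : 0 ≤ c) (hρ : ∀ i t, t ≠ 0 → ρ i t ≤ c * ρ' i t) : Cl ρ' F :=
  ⟨h.1, fun w => (h.2 w).mono hc hρ⟩

protected theorem Cl.add {ρ : ι → RN d → ℝ} {F G : ι → RN d × RN d → ℂ} (hF : Cl ρ F) (hG : Cl ρ G) :
    Cl ρ (F + G) :=
  ⟨hF.1.add hG.1, fun w => (hF.2 w).add hF.1 hG.1 (hG.2 w)⟩

protected theorem Cl.mul {ρ ρ' : ι → RN d → ℝ} {F G : ι → RN d × RN d → ℂ} (hF : Cl ρ F) (hG : Cl ρ' G) :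
    Cl (fun i t => ρ i t * ρ' i t) (F * G) :=
  ⟨hF.1.mul hG.1, fun _ => Est.mul hF.1 hG.1 (fun u _ => hF.2 u) (fun u _ => hG.2 u)⟩

protected theorem Cl.der {ρ : ι → RN d → ℝ} {F : ι → RN d × RN d → ℂ} (hF : Cl ρ F) (v : Letter d) :
    Cl (fun i t => ρ i t * cost v t) (der v F) :=
  ⟨hF.1.der v, fun w => hF.2 (v :: w)⟩

theorem sm_const (c : ι → ℂ) : Sm (d := d) (fun i _ => c i) := fun _ => contDiffOn_const

theorem der_const (c : ι → ℂ) (v : Letter d) : der (d := d) v (fun i _ => c i) = fun _ _ => 0 := by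
  funext i p; simp [der, along]

theorem est_zero (w : List (Letter d)) (ρ : ι → RN d → ℝ) :
    Est w ρ (fun _ _ => (0 : ℂ)) := by
  induction w generalizing ρ with
  | nil => exact ⟨0, le_rfl, fun i x t _ => by simp⟩
  | cons v w ih =>
    simp only [Est]
    rw [der_const (fun _ => 0)]; exact ih _

theorem cl_zero (ρ : ι → RN d → ℝ) : Cl (d := d) ρ (fun _ _ => (0 : ℂ)) :=
  ⟨sm_const _, fun _ => est_zero _ ρ⟩

theorem cl_const (c : ι → ℂ) : Cl (d := d) (fun i _ => ‖c i‖) (fun i _ => c i) := by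
  refine ⟨sm_const _, fun w => ?_⟩
  cases w with
  | nil => exact ⟨1, zero_le_one, fun i x t _ => by simp⟩
  | cons v w =>
    simp only [Est]; rw [der_const]; exact est_zero w _

theorem Cl.const_mul {ρ : ι → RN d → ℝ} {F : ι → RN d × RN d → ℂ} (hF : Cl ρ F) (c : ℂ) :
    Cl ρ (fun i p => c * F i p) :=
  ((cl_const (fun _ => c)).mul hF).mono (norm_nonneg c) (fun _ _ _ => le_rfl)

theorem Cl.neg {ρ : ι → RN d → ℝ} {F : ι → RN d × RN d → ℂ} (hF : Cl ρ F) :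
    Cl ρ (-F) :=
  (hF.const_mul (-1)).congr (fun i p _ => by simp)

theorem Cl.sum {κ : Type*} (s : Finset κ) {ρ : ι → RN d → ℝ} {F : κ → ι → RN d × RN d → ℂ}
    (h : ∀ k ∈ s, Cl ρ (F k)) : Cl ρ (∑ k ∈ s, F k) := by
  classical
  induction s using Finset.induction_on with
  | empty => exact (cl_zero ρ).congr (fun i p _ => by simp)
  | insert a s ha ih =>
    rw [Finset.sum_insert ha]
    exact (h a (by simp)).add (ih fun k hk => h k (by simp [hk]))

/-- To bound words, differentiate once and use the estimates for shorter words. -/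
theorem Est.of_der {ρ : ι → RN d → ℝ} {F : ι → RN d × RN d → ℂ} {w : List (Letter d)}
    (h0 : w = [] → Est [] ρ F)
    (h : ∀ v u, w = v :: u → Est u (fun i t => ρ i t * cost v t) (der v F)) : Est w ρ F := by
  cases w with
  | nil => exact h0 rfl
  | cons v u => exact h v u rfl

theorem Cl.of_der {ρ : ι → RN d → ℝ} {F : ι → RN d × RN d → ℂ} (sF : Sm F) (h0 : Est [] ρ F)
    (h : ∀ v, Cl (fun i t => ρ i t * cost v t) (der v F)) : Cl ρ F :=
  ⟨sF, fun _ => Est.of_der (fun _ => h0) (fun v u _ => (h v).2 u)⟩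

/-- If `P` is elliptic of weight `p` then `1/P` has weight `1/p`. -/
theorem Cl.inv {p : ι → RN d → ℝ} {P : ι → RN d × RN d → ℂ} (hP : Cl p P)
    (hp : ∀ i t, t ≠ 0 → 0 < p i t) (hpP : ∀ i x t, t ≠ 0 → p i t ≤ ‖P i (x, t)‖) :
    Cl (fun i t => (p i t)⁻¹) (fun i q => (P i q)⁻¹) := by
  have hne : ∀ i, ∀ q ∈ punctured d, P i q ≠ 0 := by
    rintro i ⟨x, t⟩ ht h0
    have := hpP i x t ht
    rw [h0, norm_zero] at this
    exact absurd (hp i t ht) (not_lt.2 this)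
  have sI : Sm (fun i q => (P i q)⁻¹) := fun i => (hP.1 i).inv (hne i)
  refine ⟨sI, ?_⟩
  -- Since ∂(1/P) = -∂P · P⁻¹ · P⁻¹, a word of length n+1 on 1/P reduces by the Leibniz rule to
  -- words of length at most n on 1/P.
  suffices ∀ n : ℕ, ∀ w : List (Letter d), w.length ≤ n →
      Est w (fun i t => (p i t)⁻¹) (fun i q => (P i q)⁻¹) from fun w => this _ w le_rfl
  intro n
  induction n with
  | zero =>
    intro w hw
    have : w = [] := List.length_eq_zero_iff.1 (by omega)
    subst this
    refine ⟨1, zero_le_one, fun i x t ht => ?_⟩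
    rw [one_mul, norm_inv]
    exact inv_anti₀ (hp i t ht) (hpP i x t ht)
  | succ n ih =>
    intro w hw
    cases w with
    | nil => exact ih [] (by simp)
    | cons v u =>
      have hu : u.length ≤ n := by simpa using hw
      have ih' : ∀ u', u'.Sublist u → Est u' (fun i t => (p i t)⁻¹) (fun i q => (P i q)⁻¹) :=
        fun u' hu' => ih u' (hu'.length_le.trans hu)
      have h1 := Est.mul sI sI ih' ih'
      have h1' : ∀ u', u'.Sublist u → Est u' (fun i t => (p i t)⁻¹ * (p i t)⁻¹)
          ((fun i q => (P i q)⁻¹) * (fun i q => (P i q)⁻¹)) :=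
        fun u' hu' => Est.mul sI sI (fun u'' hu'' => ih' u'' (hu''.trans hu'))
          (fun u'' hu'' => ih' u'' (hu''.trans hu'))
      have h2 := Est.mul (hP.der v).neg.1 (sI.mul sI) (fun u' _ => (hP.der v).neg.2 u') h1'
      show Est u _ (der v _)
      refine Est.mono (h2.congr ?_) zero_le_one ?_
      · intro i q hq
        have hd := hP.1.diffAt i hq
        have := ((hasFDerivAt_inv' (𝕜 := ℝ) (hne i q hq)).comp q hd.hasFDerivAt).fderiv
        have h' : fderiv ℝ (fun q => (P i q)⁻¹) q = _ := this
        simp only [der, along]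
        rw [h']
        simp [der, along]
        ring
      · intro i t ht
        have := hp i t ht
        have := cost_pos v ht
        rw [one_mul]
        apply le_of_eq
        field_simp

/-! ### Bounded smooth functions, the frame and its inverse. -/

/-- Smooth functions on `ℝ^N` with bounded derivatives of every order. -/
def Cb (b : RN d → ℂ) : Prop :=
  ContDiff ℝ ∞ b ∧ ∀ k : ℕ, ∃ C : ℝ, ∀ x, ‖iteratedFDeriv ℝ k b x‖ ≤ C

theorem Cb.bound {b : RN d → ℂ} (hb : Cb b) : ∃ C : ℝ, 0 ≤ C ∧ ∀ x, ‖b x‖ ≤ C := by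
  obtain ⟨C, hC⟩ := hb.2 0
  simp only [norm_iteratedFDeriv_zero] at hC
  exact ⟨C, (norm_nonneg _).trans (hC 0), hC⟩

theorem cb_const (c : ℂ) : Cb (fun _ : RN d => c) := by
  refine ⟨contDiff_const, fun k => ?_⟩
  rcases k with _ | k
  · exact ⟨‖c‖, fun x => by simp⟩
  · exact ⟨0, fun x => by rw [iteratedFDeriv_const_of_ne (by simp)]; simp⟩

theorem Cb.add {b c : RN d → ℂ} (hb : Cb b) (hc : Cb c) : Cb (fun x => b x + c x) := by
  refine ⟨hb.1.add hc.1, fun k => ?_⟩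
  obtain ⟨C, hC⟩ := hb.2 k
  obtain ⟨C', hC'⟩ := hc.2 k
  refine ⟨C + C', fun x => ?_⟩
  have : (fun x => b x + c x) = b + c := rfl
  rw [this, iteratedFDeriv_add_apply ((hb.1.of_le (by exact_mod_cast le_top)).contDiffAt)
    ((hc.1.of_le (by exact_mod_cast le_top)).contDiffAt)]
  exact (norm_add_le _ _).trans (add_le_add (hC x) (hC' x))

theorem Cb.mul {b c : RN d → ℂ} (hb : Cb b) (hc : Cb c) : Cb (fun x => b x * c x) := by
  refine ⟨hb.1.mul hc.1, fun k => ?_⟩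
  choose C hC using hb.2
  choose C' hC' using hc.2
  refine ⟨∑ i ∈ Finset.range (k + 1), (k.choose i : ℝ) * C i * C' (k - i), fun x => ?_⟩
  refine (norm_iteratedFDeriv_mul_le hb.1 hc.1 x (n := k) (by exact_mod_cast le_top)).trans ?_
  refine Finset.sum_le_sum fun i _ => ?_
  have := (norm_nonneg _).trans (hC i x)
  gcongr
  · exact hC i x
  · exact hC' _ x

theorem Cb.sum {κ : Type*} (s : Finset κ) {b : κ → RN d → ℂ} (h : ∀ k ∈ s, Cb (b k)) :
    Cb (fun x => ∑ k ∈ s, b k x) := by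
  classical
  induction s using Finset.induction_on with
  | empty => simpa using cb_const (d := d) 0
  | insert a s ha ih =>
    simp only [Finset.sum_insert ha]
    exact (h a (by simp)).add (ih fun k hk => h k (by simp [hk]))

theorem Cb.prod {κ : Type*} (s : Finset κ) {b : κ → RN d → ℂ} (h : ∀ k ∈ s, Cb (b k)) :
    Cb (fun x => ∏ k ∈ s, b k x) := by
  classical
  induction s using Finset.induction_on with
  | empty => simpa using cb_const (d := d) 1
  | insert a s ha ih =>
    simp only [Finset.prod_insert ha]
    exact (h a (by simp)).mul (ih fun k hk => h k (by simp [hk]))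

theorem Cb.partial {b : RN d → ℂ} (hb : Cb b) (v : RN d) : Cb (fun x => fderiv ℝ b x v) := by
  have h1 : ContDiff ℝ ∞ (fderiv ℝ b) := hb.1.fderiv_right (by simp)
  refine ⟨h1.clm_apply contDiff_const, fun k => ?_⟩
  obtain ⟨C, hC⟩ := hb.2 (k + 1)
  refine ⟨‖v‖ * C, fun x => ?_⟩
  have := norm_iteratedFDeriv_clm_apply_const (f := fderiv ℝ b) (c := v) (x := x) (N := ∞) (n := k)
    h1.contDiffAt (by exact_mod_cast le_top)
  refine this.trans ?_
  rw [norm_iteratedFDeriv_fderiv]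
  exact mul_le_mul_of_nonneg_left (hC x) (norm_nonneg _)

theorem contDiff_det {n : Type*} [Fintype n] [DecidableEq n] {E : Type*} [NormedAddCommGroup E]
    [NormedSpace ℝ E] {M : E → Matrix n n ℝ} (h : ∀ i j, ContDiff ℝ ∞ fun x => M x i j) :
    ContDiff ℝ ∞ fun x => (M x).det := by
  simp only [Matrix.det_apply']
  refine ContDiff.sum fun σ _ => ?_
  refine contDiff_const.mul (contDiff_prod fun i _ => h _ _)

namespace AdaptedFrame

variable {H : RN d → Submodule ℝ (RN d)} (X : AdaptedFrame H)

theorem det_ne_zero (x : RN d) : (X.A x).det ≠ 0 := by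
  obtain ⟨c, hc, h⟩ := X.det_bound
  exact abs_pos.1 (hc.trans_le (h x))

theorem A_mul_B (x : RN d) : X.A x * X.B x = 1 :=
  Matrix.mul_nonsing_inv _ (isUnit_iff_ne_zero.2 (X.det_ne_zero x))

theorem B_mul_A (x : RN d) : X.B x * X.A x = 1 :=
  Matrix.nonsing_inv_mul _ (isUnit_iff_ne_zero.2 (X.det_ne_zero x))

theorem cb_A (i j : Fin (d + 1)) : Cb (fun x => ((X.A x i j : ℝ) : ℂ)) := by
  refine ⟨Complex.ofRealCLM.contDiff.comp (X.smooth i j), fun k => ?_⟩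
  obtain ⟨C, hC⟩ := X.bounded i j k
  refine ⟨C, fun x => ?_⟩
  have := Complex.ofRealLI.norm_iteratedFDeriv_comp_left (x := x) (i := k)
    ((X.smooth i j).contDiffAt) (by exact_mod_cast le_top)
  exact le_of_eq_of_le this (hC x)

theorem A_bound : ∃ C : ℝ, 0 ≤ C ∧ ∀ x i j, |X.A x i j| ≤ C := by
  choose C h0 hC using fun i j => (X.cb_A i j).bound
  refine ⟨∑ i, ∑ j, C i j, Finset.sum_nonneg fun i _ => Finset.sum_nonneg fun j _ => h0 i j,
    fun x i j => ?_⟩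
  have h1 := hC i j x
  rw [Complex.norm_real, Real.norm_eq_abs] at h1
  refine h1.trans ?_
  refine (Finset.single_le_sum (f := fun j => C i j) (fun j _ => h0 i j) (Finset.mem_univ j)).trans ?_
  exact Finset.single_le_sum (f := fun i => ∑ j, C i j)
    (fun i _ => Finset.sum_nonneg fun j _ => h0 i j) (Finset.mem_univ i)

theorem contDiff_B (i j : Fin (d + 1)) : ContDiff ℝ ∞ (fun x => X.B x i j) := by
  have : (fun x => X.B x i j) = fun x => (X.A x).det⁻¹ * ((X.A x).updateRow j (Pi.single i 1)).det := by
    funext x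
    rw [B, Matrix.inv_def, Matrix.smul_apply, Matrix.adjugate_apply, Ring.inverse_eq_inv', smul_eq_mul]
  rw [this]
  refine ((contDiff_det X.smooth).inv X.det_ne_zero).mul (contDiff_det fun k l => ?_)
  by_cases hk : k = j
  · subst hk; simp only [Matrix.updateRow_self]; exact contDiff_const
  · simp only [Matrix.updateRow_ne hk]; exact X.smooth k l

/-- Cramer's rule: an entry of the inverse is a determinant of bounded entries over a determinant
bounded away from zero. The row replaced by a unit vector has entries of size at most 1, whence C +
1. -/
theorem B_bound : ∃ C : ℝ, 0 ≤ C ∧ ∀ x i j, |X.B x i j| ≤ C := by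
  obtain ⟨C, h0, hC⟩ := X.A_bound
  obtain ⟨c, hc, hdet⟩ := X.det_bound
  refine ⟨c⁻¹ * ((Fintype.card (Fin (d + 1))).factorial •
    (C + 1) ^ (Fintype.card (Fin (d + 1)))), by positivity, fun x i j => ?_⟩
  rw [B, Matrix.inv_def, Matrix.smul_apply, Matrix.adjugate_apply, Ring.inverse_eq_inv',
    smul_eq_mul, abs_mul, abs_inv]
  refine mul_le_mul (inv_anti₀ hc (hdet x)) ?_ (abs_nonneg _) (by positivity)
  refine Matrix.det_le (abv := AbsoluteValue.abs) (fun k l => ?_)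
  by_cases hk : k = j
  · subst hk
    rw [Matrix.updateRow_self]
    by_cases hl : l = i
    · subst hl; simp [h0]
    · simp [hl]; positivity
  · rw [Matrix.updateRow_ne hk]
    exact (hC x k l).trans (by linarith)

/-! ### The chart adapted to the frame. -/

/-- The vector `∑_i t_i X_i(x)`. -/
noncomputable def comb (x t : RN d) : RN d := ∑ q, ∑ l, (t q * X.A x q l) • e l

theorem comb_apply (x t : RN d) (l : Fin (d + 1)) : X.comb x t l = ∑ q, t q * X.A x q l := by
  simp [comb, e, Finset.sum_apply, Pi.single_apply]

/-- `Θ₀(x, y)` as a vector. -/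
noncomputable def theta (x y : RN d) : RN d := WithLp.toLp 2 (X.Theta x y)

/-- With `comb_theta`, this shows that for fixed x the chart is a bijection in t with inverse y ↦
Θ₀(x,y). In particular t^N is the quantity that enters d(x,y). -/
theorem theta_comb (x t : RN d) : X.theta x (x - X.comb x t) = t := by
  ext i
  have h : ∀ q, ∑ j, X.A x q j * X.B x j i = if q = i then 1 else 0 := by
    intro q
    rw [← Matrix.mul_apply, X.A_mul_B, Matrix.one_apply]
  simp only [theta, Theta, PiLp.sub_apply, sub_sub_cancel, comb_apply, Finset.mul_sum]
  rw [Finset.sum_comm]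
  calc _ = ∑ q, t q * ∑ j, X.A x q j * X.B x j i := by
        refine Finset.sum_congr rfl fun q _ => ?_
        rw [Finset.mul_sum]; exact Finset.sum_congr rfl fun j _ => by ring
    _ = t i := by simp [h]

theorem comb_theta (x y : RN d) : X.comb x (X.theta x y) = x - y := by
  ext l
  have h : ∀ j, ∑ q, X.B x j q * X.A x q l = if j = l then 1 else 0 := by
    intro q
    rw [← Matrix.mul_apply, X.B_mul_A, Matrix.one_apply]
  rw [comb_apply]
  simp only [theta, Theta, Finset.sum_mul]
  rw [Finset.sum_comm]
  calc _ = ∑ j, (x j - y j) * ∑ q, X.B x j q * X.A x q l := by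
        refine Finset.sum_congr rfl fun q _ => ?_
        rw [Finset.mul_sum]; exact Finset.sum_congr rfl fun j _ => by ring
    _ = _ := by simp [h]

theorem norm_le_sum_coord (t : RN d) : ‖t‖ ≤ ∑ j, |t j| := by
  have : t = ∑ j, t j • (e j : RN d) := by
    ext l; simp [e, Finset.sum_apply, Pi.single_apply]
  calc ‖t‖ = ‖∑ j, t j • (e j : RN d)‖ := by rw [← this]
    _ ≤ ∑ j, ‖t j • (e j : RN d)‖ := norm_sum_le _ _
    _ = _ := by simp [norm_smul, e]

theorem norm_comb_le : ∃ C : ℝ, 0 < C ∧ ∀ x t, ‖X.comb x t‖ ≤ C * ‖t‖ := by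
  obtain ⟨C, h0, hC⟩ := X.A_bound
  refine ⟨(d + 1) * ((d + 1) * C) + 1, by positivity, fun x t => ?_⟩
  have h1 : ∀ l, |X.comb x t l| ≤ (d + 1) * C * ‖t‖ := by
    intro l
    rw [comb_apply]
    refine (Finset.abs_sum_le_sum_abs _ _).trans ?_
    refine (Finset.sum_le_card_nsmul _ _ (‖t‖ * C) fun q _ => ?_).trans (le_of_eq ?_)
    · rw [abs_mul]
      exact mul_le_mul (abs_coord_le_norm t q) (hC x q l) (abs_nonneg _) (norm_nonneg _)
    · simp; ring
  refine (norm_le_sum_coord _).trans ?_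
  refine (Finset.sum_le_card_nsmul _ _ _ fun q _ => h1 q).trans ?_
  have := norm_nonneg t
  simp; nlinarith

theorem norm_theta_le : ∃ C : ℝ, 0 < C ∧ ∀ x y, ‖X.theta x y‖ ≤ C * ‖x - y‖ := by
  obtain ⟨C, h0, hC⟩ := X.B_bound
  refine ⟨(d + 1) * ((d + 1) * C) + 1, by positivity, fun x y => ?_⟩
  have h1 : ∀ l, |X.theta x y l| ≤ (d + 1) * C * ‖x - y‖ := by
    intro l
    simp only [theta, Theta]
    refine (Finset.abs_sum_le_sum_abs _ _).trans ?_
    refine (Finset.sum_le_card_nsmul _ _ (C * ‖x - y‖) fun q _ => ?_).trans (le_of_eq ?_)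
    · rw [abs_mul]
      exact mul_le_mul (hC x q l) (abs_coord_le_norm (x - y) q) (abs_nonneg _) h0
    · simp; ring
  refine (norm_le_sum_coord _).trans ?_
  refine (Finset.sum_le_card_nsmul _ _ _ fun q _ => h1 q).trans ?_
  have := norm_nonneg (x - y)
  simp; nlinarith

/-- The coordinates `(x, t) ↦ (x, x - ∑_i t_i X_i(x))` on pairs of points. -/
noncomputable def chart (p : RN d × RN d) : RN d × RN d := (p.1, p.1 - X.comb p.1 p.2)

theorem contDiff_chart : ContDiff ℝ ∞ X.chart := by
  refine contDiff_fst.prodMk (contDiff_fst.sub ?_)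
  unfold comb
  refine ContDiff.sum fun q _ => ContDiff.sum fun l _ => ContDiff.fun_smul (ContDiff.mul ?_ ?_) contDiff_const
  · exact (EuclideanSpace.proj (𝕜 := ℝ) q).contDiff.comp contDiff_snd
  · exact (X.smooth q l).comp contDiff_fst

theorem chart_mem {p : RN d × RN d} (hp : p ∈ punctured d) : X.chart p ∈ offDiag d := by
  intro h
  apply hp
  have h1 : p.1 = p.1 - X.comb p.1 p.2 := h
  have h2 := X.theta_comb p.1 p.2
  rw [← h1] at h2
  rw [← h2]
  ext i; simp [theta, Theta]

theorem fderiv_chart (p v : RN d × RN d) : fderiv ℝ X.chart p v =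
    (v.1, v.1 - ∑ q, ∑ l, (v.2 q * X.A p.1 q l +
      p.2 q * fderiv ℝ (fun z => X.A z q l) p.1 v.1) • e l) := by
  have hc : ∀ q, HasFDerivAt (fun p : RN d × RN d => p.2 q)
      ((EuclideanSpace.proj (𝕜 := ℝ) q).comp (ContinuousLinearMap.snd ℝ (RN d) (RN d))) p :=
    fun q => ((EuclideanSpace.proj (𝕜 := ℝ) q).comp
      (ContinuousLinearMap.snd ℝ (RN d) (RN d))).hasFDerivAt
  have hA : ∀ q l, HasFDerivAt (fun p : RN d × RN d => X.A p.1 q l)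
      ((fderiv ℝ (fun z => X.A z q l) p.1).comp (ContinuousLinearMap.fst ℝ (RN d) (RN d))) p :=
    fun q l => (((X.smooth q l).differentiable (by simp)) p.1).hasFDerivAt.comp p hasFDerivAt_fst
  have h2 := HasFDerivAt.fun_sum (u := Finset.univ) fun q (_ : q ∈ Finset.univ) =>
    HasFDerivAt.fun_sum (u := Finset.univ) fun l (_ : l ∈ Finset.univ) =>
      ((hc q).mul (hA q l)).smul_const (e l : RN d)
  have h3 := (hasFDerivAt_fst (𝕜 := ℝ) (p := p)).prodMk (hasFDerivAt_fst.sub h2)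
  have h4 : fderiv ℝ X.chart p = _ := h3.fderiv
  rw [h4]
  simp only [ContinuousLinearMap.prod_apply, sub_apply, sum_apply, ContinuousLinearMap.coe_fst']
  congr 2
  refine Finset.sum_congr rfl fun q _ => Finset.sum_congr rfl fun l _ => ?_
  simp [mul_comm, add_comm]

theorem along_comp_chart {F : RN d × RN d → ℂ} (v : RN d × RN d → RN d × RN d) {p : RN d × RN d}
    (hF : DifferentiableAt ℝ F (X.chart p)) :
    along v (F ∘ X.chart) p = fderiv ℝ F (X.chart p) (fderiv ℝ X.chart p (v p)) := by
  have hc : DifferentiableAt ℝ X.chart p := X.contDiff_chart.differentiable (by simp) p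
  rw [along, fderiv_comp p hF hc]; rfl

/-- Differentiating AB = 1 gives A ∂B = -∂A B, and then BA = 1 is used. It is behind both
`fderiv_chart_inl` and `along_DSym_symb`. -/
theorem A_mul_dB_mul_A (i : Fin (d + 1)) (x : RN d) (q l : Fin (d + 1)) :
    ∑ k, ∑ p, X.A x q k * X.dB i k p x * X.A x p l =
      - fderiv ℝ (fun z => X.A z q l) x (e i) := by
  have hB : ∀ k p, DifferentiableAt ℝ (fun z => X.B z k p) x :=
    fun k p => (X.contDiff_B k p).differentiable (by simp) x
  have hA : ∀ k p, DifferentiableAt ℝ (fun z => X.A z k p) x :=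
    fun k p => (X.smooth k p).differentiable (by simp) x
  have h1 : ∀ q p, ∑ k, X.A x q k * X.dB i k p x =
      - ∑ k, fderiv ℝ (fun z => X.A z q k) x (e i) * X.B x k p := by
    intro q p
    have h0 : (fun z => ∑ k, X.A z q k * X.B z k p) = fun _ => (1 : Matrix _ _ ℝ) q p := by
      funext z; rw [← Matrix.mul_apply, X.A_mul_B]
    have hs := HasFDerivAt.fun_sum (u := Finset.univ) fun k (_ : k ∈ Finset.univ) =>
      (hA q k).hasFDerivAt.mul (hB k p).hasFDerivAt
    have h2 := congrArg (fun f => f (e i)) ((hasFDerivAt_const (𝕜 := ℝ)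
      ((1 : Matrix (Fin (d + 1)) (Fin (d + 1)) ℝ) q p) x).unique (hs.congr_of_eventuallyEq
        (Filter.Eventually.of_forall fun z => (congrFun h0 z).symm)))
    simp only [zero_apply, sum_apply, add_apply, smul_apply, smul_eq_mul,
      Finset.sum_add_distrib] at h2
    rw [eq_neg_iff_add_eq_zero, h2]
    congr 1
    exact Finset.sum_congr rfl fun k _ => mul_comm _ _
  rw [Finset.sum_comm]
  have h3 : ∀ k, ∑ p, X.B x k p * X.A x p l = if k = l then 1 else 0 := by
    intro q
    rw [← Matrix.mul_apply, X.B_mul_A, Matrix.one_apply]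
  calc _ = ∑ p, (∑ k, X.A x q k * X.dB i k p x) * X.A x p l := by
        simp only [Finset.sum_mul]
    _ = - ∑ p, ∑ k, fderiv ℝ (fun z => X.A z q k) x (e i) * X.B x k p * X.A x p l := by
        simp only [h1, neg_mul, Finset.sum_neg_distrib, Finset.sum_mul]
    _ = - ∑ k, fderiv ℝ (fun z => X.A z q k) x (e i) * ∑ p, X.B x k p * X.A x p l := by
        rw [Finset.sum_comm]
        simp only [Finset.mul_sum, mul_assoc]
    _ = _ := by simp [h3]

/-- The coefficients of D_{x,y,i} are those for which Θ₀(x,y) is constant along it, so it is the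
x-derivative at fixed t. With y - x = -Σ t^q X_q(x), the required term -Σ t^q ∂_i A_q^l is the
correction Σ t^q (A ∂B A)_q^l. -/
theorem fderiv_chart_inl (i : Fin (d + 1)) (p : RN d × RN d) :
    fderiv ℝ X.chart p (anyPartial (Sum.inl i) p) = X.DKer i (X.chart p) := by
  rw [fderiv_chart]
  simp only [anyPartial, partialFst, DKer, chart, PiLp.zero_apply, zero_mul, zero_add, sub_sub_cancel,
    PiLp.sub_apply, comb_apply]
  rw [sub_eq_add_neg]
  congr 2
  ext m
  have h := X.A_mul_dB_mul_A i p.1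
  simp only [PiLp.neg_apply, WithLp.ofLp_sum, Finset.sum_apply, PiLp.smul_apply, smul_eq_mul, e,
    PiLp.single_apply, mul_ite, mul_one, mul_zero, Finset.sum_ite_eq,
    Finset.mem_univ, if_true]
  rw [← Finset.sum_neg_distrib]
  calc _ = ∑ q, p.2 q * (∑ k, ∑ r, X.A p.1 q k * X.dB i k r p.1 * X.A p.1 r m) := by
        refine Finset.sum_congr rfl fun q _ => ?_
        rw [h]; simp [e]
    _ = _ := by
        simp only [Finset.mul_sum]
        rw [Finset.sum_comm]
        refine Finset.sum_congr rfl fun k _ => ?_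
        rw [Finset.sum_comm]
        refine Finset.sum_congr rfl fun r _ => Finset.sum_congr rfl fun q _ => ?_
        ring

theorem fderiv_chart_inr (j : Fin (d + 1)) (p : RN d × RN d) :
    fderiv ℝ X.chart p (anyPartial (Sum.inr j) p) = (0, - ∑ l, X.A p.1 j l • e l) := by
  rw [fderiv_chart]
  simp [anyPartial, partialSnd, e, ite_smul]

end AdaptedFrame

/-! ### Coordinates and coefficient functions in the chart. -/

/-- Estimates for the words in a given set. -/
def ClOn (P : Set (List (Letter d))) (ρ : ι → RN d → ℝ) (F : ι → RN d × RN d → ℂ) : Prop :=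
  Sm F ∧ ∀ w ∈ P, Est w ρ F

theorem Cl.clOn {P : Set (List (Letter d))} {ρ : ι → RN d → ℝ} {F : ι → RN d × RN d → ℂ}
    (h : Cl ρ F) : ClOn P ρ F := ⟨h.1, fun w _ => h.2 w⟩

theorem ClOn.congr {P : Set (List (Letter d))} {ρ : ι → RN d → ℝ} {F G : ι → RN d × RN d → ℂ}
    (h : ClOn P ρ F) (hFG : Agree F G) : ClOn P ρ G :=
  ⟨h.1.congr hFG, fun w hw => (h.2 w hw).congr hFG⟩

theorem ClOn.mono {P : Set (List (Letter d))} {ρ ρ' : ι → RN d → ℝ} {F : ι → RN d × RN d → ℂ}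
    (h : ClOn P ρ F) {c : ℝ} (hc : 0 ≤ c) (hρ : ∀ i t, t ≠ 0 → ρ i t ≤ c * ρ' i t) :
    ClOn P ρ' F :=
  ⟨h.1, fun w hw => (h.2 w hw).mono hc hρ⟩

protected theorem ClOn.add {P : Set (List (Letter d))} {ρ : ι → RN d → ℝ}
    {F G : ι → RN d × RN d → ℂ} (hF : ClOn P ρ F) (hG : ClOn P ρ G) : ClOn P ρ (F + G) :=
  ⟨hF.1.add hG.1, fun w hw => (hF.2 w hw).add hF.1 hG.1 (hG.2 w hw)⟩

protected theorem ClOn.mul {P : Set (List (Letter d))}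
    (hP : ∀ w ∈ P, ∀ u : List (Letter d), u.Sublist w → u ∈ P)
    {ρ ρ' : ι → RN d → ℝ} {F G : ι → RN d × RN d → ℂ} (hF : ClOn P ρ F) (hG : ClOn P ρ' G) :
    ClOn P (fun i t => ρ i t * ρ' i t) (F * G) :=
  ⟨hF.1.mul hG.1, fun w hw => Est.mul hF.1 hG.1 (fun u hu => hF.2 u (hP w hw u hu))
    (fun u hu => hG.2 u (hP w hw u hu))⟩

theorem ClOn.sum {P : Set (List (Letter d))} {κ : Type*} (s : Finset κ) {ρ : ι → RN d → ℝ}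
    {F : κ → ι → RN d × RN d → ℂ} (h : ∀ k ∈ s, ClOn P ρ (F k)) : ClOn P ρ (∑ k ∈ s, F k) := by
  classical
  induction s using Finset.induction_on with
  | empty => exact (cl_zero ρ).clOn.congr (fun i p _ => by simp)
  | insert a s ha ih =>
    rw [Finset.sum_insert ha]
    exact (h a (by simp)).add (ih fun k hk => h k (by simp [hk]))

theorem sublist_length_le (n : ℕ) : ∀ w ∈ {w : List (Letter d) | w.length ≤ n},
    ∀ u : List (Letter d), u.Sublist w → u ∈ {w : List (Letter d) | w.length ≤ n} :=
  fun _ hw _ hu => hu.length_le.trans hw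

/-- The factor (1+|t|)² in the cost serves this bound: lower-order terms and polynomial growth in t
can always be charged to the derivative that produced them. The kernel decays rapidly, so the factor
does no harm. -/
theorem one_le_cost (v : Letter d) {t : RN d} (ht : t ≠ 0) : 1 ≤ cost v t := by
  have h0 : 0 < ‖t‖ := norm_pos_iff.2 ht
  have h1 := aniso_le t
  have h2 := aniso_pos ht
  rcases v with j | j
  · simp only [cost]; nlinarith
  · simp only [cost]; split_ifs
    · rw [le_div_iff₀ h2]; nlinarith
    · rw [le_div_iff₀ h0]; nlinarith

theorem one_le_norm_mul_cost (j : Fin (d + 1)) {t : RN d} (ht : t ≠ 0) :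
    1 ≤ ‖t‖ * cost (Sum.inr j) t := by
  have h0 : 0 < ‖t‖ := norm_pos_iff.2 ht
  have h1 := aniso_le t
  have h2 := aniso_pos ht
  simp only [cost]; rw [← mul_div_assoc]; split_ifs
  · rw [le_div_iff₀ h2]; nlinarith
  · rw [le_div_iff₀ h0]; nlinarith

theorem one_le_aniso_mul_cost {t : RN d} (ht : t ≠ 0) :
    1 ≤ aniso t * cost (Sum.inr (Fin.last d)) t := by
  have h0 : 0 < ‖t‖ := norm_pos_iff.2 ht
  have h2 := aniso_pos ht
  simp only [cost, if_true]
  rw [mul_div_cancel₀ _ h2.ne']; nlinarith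

theorem contDiff_coord (j : Fin (d + 1)) :
    ContDiff ℝ ∞ (fun p : RN d × RN d => ((p.2 j : ℝ) : ℂ)) :=
  Complex.ofRealCLM.contDiff.comp ((EuclideanSpace.proj (𝕜 := ℝ) j).contDiff.comp contDiff_snd)

theorem der_coord (j : Fin (d + 1)) (v : Letter d) :
    der v (fun (_ : ι) p => ((p.2 j : ℝ) : ℂ)) =
      fun _ _ => if v = Sum.inr j then 1 else 0 := by
  funext i p
  have h := (Complex.ofRealCLM.comp ((EuclideanSpace.proj (𝕜 := ℝ) j).comp
      (ContinuousLinearMap.snd ℝ (RN d) (RN d)))).hasFDerivAt (x := p)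
  have h' : fderiv ℝ (fun p : RN d × RN d => ((p.2 j : ℝ) : ℂ)) p = _ := h.fderiv
  simp only [der, along, h']
  rcases v with k | k
  · simp [anyPartial, partialFst]
  · by_cases hk : k = j
    · subst hk; simp [anyPartial, partialSnd, e]
    · simp [anyPartial, partialSnd, e, hk, Ne.symm hk]

theorem cl_coord (j : Fin (d + 1)) :
    Cl (fun _ t => ‖t‖) (fun (_ : ι) p => ((p.2 j : ℝ) : ℂ)) := by
  refine Cl.of_der (fun i => (contDiff_coord j).contDiffOn) ?_ fun v => ?_
  · exact ⟨1, zero_le_one, fun i x t _ => by simpa using abs_coord_le_norm t j⟩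
  · rw [der_coord]
    refine (cl_const (fun _ => if v = Sum.inr j then (1 : ℂ) else 0)).mono zero_le_one
      fun i t ht => ?_
    split_ifs with h
    · subst h; simpa using one_le_norm_mul_cost j ht
    · have := cost_pos v ht
      simp; positivity

theorem cl_coord_last :
    Cl (fun _ t => aniso t) (fun (_ : ι) p => ((p.2 (Fin.last d) : ℝ) : ℂ)) := by
  refine Cl.of_der (fun i => (contDiff_coord _).contDiffOn) ?_ fun v => ?_
  · refine ⟨1, zero_le_one, fun i x t _ => ?_⟩
    simp [aniso]
  · rw [der_coord]
    refine (cl_const (fun _ => if v = Sum.inr (Fin.last d) then (1 : ℂ) else 0)).mono zero_le_one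
      fun i t ht => ?_
    split_ifs with h
    · subst h; simpa using one_le_aniso_mul_cost ht
    · have := cost_pos v ht
      have := aniso_pos ht
      simp; positivity

theorem cl_fst {b : RN d → ℂ} (hb : Cb b) : Cl (fun _ _ => 1) (fun (_ : ι) p => b p.1) := by
  refine ⟨fun i => (hb.1.comp contDiff_fst).contDiffOn, fun w => ?_⟩
  induction w generalizing b with
  | nil =>
    obtain ⟨C, h0, hC⟩ := hb.bound
    exact ⟨C, h0, fun i x t _ => by simpa using hC x⟩
  | cons v w ih =>
    simp only [Est]
    have hd : ∀ p : RN d × RN d, ∀ u, fderiv ℝ (fun p : RN d × RN d => b p.1) p u =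
        fderiv ℝ b p.1 u.1 := by
      intro p u
      have h := ((hb.1.differentiable (by simp) p.1).hasFDerivAt).comp p hasFDerivAt_fst
      have h' : fderiv ℝ (fun p : RN d × RN d => b p.1) p = _ := h.fderiv
      rw [h']; rfl
    rcases v with j | j
    · have : der (Sum.inl j) (fun (_ : ι) p => b p.1) = fun _ p => fderiv ℝ b p.1 (e j) := by
        funext i p; simp [der, along, hd, anyPartial, partialFst]
      rw [this]
      exact (ih (hb.partial (e j))).mono zero_le_one
        (fun i t ht => by simpa using one_le_cost _ ht)
    · have : der (Sum.inr j) (fun (_ : ι) p => b p.1) = fun _ p => 0 := by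
        funext i p; simp [der, along, hd, anyPartial, partialSnd]
      rw [this]; exact est_zero _ _

namespace AdaptedFrame

variable {H : RN d → Submodule ℝ (RN d)} (X : AdaptedFrame H)

theorem along_inr_comp_chart {F : RN d × RN d → ℂ} {p : RN d × RN d} (j : Fin (d + 1))
    (hF : DifferentiableAt ℝ F (X.chart p)) :
    along (anyPartial (Sum.inr j)) (F ∘ X.chart) p =
      - ∑ l, (X.A p.1 j l : ℂ) * along (anyPartial (Sum.inr l)) F (X.chart p) := by
  rw [X.along_comp_chart _ hF, X.fderiv_chart_inr]
  have : ((0, -∑ l, X.A p.1 j l • e l) : RN d × RN d) =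
      -∑ l, X.A p.1 j l • ((0, e l) : RN d × RN d) := by
    ext i <;> simp [Prod.fst_sum, Prod.snd_sum]
  rw [this, map_neg, map_sum]
  simp only [map_smul, Complex.real_smul]
  rfl

theorem along_inl_comp_chart {F : RN d × RN d → ℂ} {p : RN d × RN d} (i : Fin (d + 1))
    (hF : DifferentiableAt ℝ F (X.chart p)) :
    along (anyPartial (Sum.inl i)) (F ∘ X.chart) p = along (X.DKer i) F (X.chart p) := by
  rw [X.along_comp_chart _ hF, X.fderiv_chart_inl]; rfl

theorem fderiv_ofReal_A (q l : Fin (d + 1)) (x v : RN d) :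
    fderiv ℝ (fun z => (X.A z q l : ℂ)) x v = (fderiv ℝ (fun z => X.A z q l) x v : ℝ) := by
  have h := Complex.ofRealCLM.hasFDerivAt.comp x
    ((X.smooth q l).differentiable (by simp) x).hasFDerivAt
  have h' : fderiv ℝ (fun z => (X.A z q l : ℂ)) x = _ := h.fderiv
  rw [h']; rfl

theorem fderiv_snd_chart {b : RN d → ℂ} (hb : Cb b) (p v : RN d × RN d) :
    fderiv ℝ (fun p => b (X.chart p).2) p v = fderiv ℝ b (X.chart p).2 (fderiv ℝ X.chart p v).2 := by
  have hc : DifferentiableAt ℝ X.chart p := X.contDiff_chart.differentiable (by simp) p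
  have h := ((hb.1.differentiable (by simp) (X.chart p).2).hasFDerivAt).comp p
    (hasFDerivAt_snd.comp p hc.hasFDerivAt)
  have h' : fderiv ℝ (fun p => b (X.chart p).2) p = _ := h.fderiv
  rw [h']; rfl

theorem der_snd_chart_inr {b : RN d → ℂ} (hb : Cb b) (j : Fin (d + 1)) :
    der (Sum.inr j) (fun (_ : ι) p => b (X.chart p).2) =
      -∑ l, (fun _ p => (X.A p.1 j l : ℂ)) * (fun _ p => fderiv ℝ b (X.chart p).2 (e l)) := by
  funext i p
  simp only [der, along]
  rw [X.fderiv_snd_chart hb, X.fderiv_chart_inr]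
  simp

theorem der_snd_chart_inl {b : RN d → ℂ} (hb : Cb b) (i : Fin (d + 1)) :
    der (Sum.inl i) (fun (_ : ι) p => b (X.chart p).2) =
      (fun _ p => fderiv ℝ b (X.chart p).2 (e i)) +
      -∑ q, ∑ l, (fun _ p => ((p.2 q : ℝ) : ℂ)) *
        ((fun _ p => fderiv ℝ (fun z => (X.A z q l : ℂ)) p.1 (e i)) *
          (fun _ p => fderiv ℝ b (X.chart p).2 (e l))) := by
  funext i' p
  simp only [der, along]
  rw [X.fderiv_snd_chart hb, X.fderiv_chart]
  simp [anyPartial, partialFst, fderiv_ofReal_A, sub_eq_add_neg, mul_assoc]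

/-- Differentiating b(y) in x produces first derivatives of b at y, with coefficients 1 and t^q ∂A.
The growth in t is paid by the cost of the x-derivative, so induction on the word length closes for
all bounded b at once. -/
theorem cl_snd_chart {b : RN d → ℂ} (hb : Cb b) :
    Cl (fun _ _ => 1) (fun (_ : ι) p => b (X.chart p).2) := by
  have sm : ∀ {b : RN d → ℂ}, Cb b → Sm (fun (_ : ι) p => b (X.chart p).2) := fun hb i =>
    (hb.1.comp (contDiff_snd.comp X.contDiff_chart)).contDiffOn
  suffices ∀ n : ℕ, ∀ b : RN d → ℂ, Cb b → ClOn {w | w.length ≤ n} (fun _ _ => 1)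
      (fun (_ : ι) p => b (X.chart p).2) from
    ⟨sm hb, fun w => (this w.length b hb).2 w (le_refl w.length)⟩
  intro n
  have bd : ∀ {b : RN d → ℂ}, Cb b → Est [] (fun _ _ => 1) (fun (_ : ι) p => b (X.chart p).2) := by
    intro b hb
    obtain ⟨C, h0, hC⟩ := hb.bound
    exact ⟨C, h0, fun i x t _ => by simpa using hC _⟩
  induction n with
  | zero =>
    intro b hb
    refine ⟨sm hb, fun w hw => ?_⟩
    have : w = [] := List.length_eq_zero_iff.1 (Nat.le_zero.1 hw)
    subst this; exact bd hb
  | succ n ih =>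
    intro b hb
    refine ⟨sm hb, fun w hw => Est.of_der (fun _ => bd hb) fun v u hvu => ?_⟩
    subst hvu
    have hu : u ∈ {w : List (Letter d) | w.length ≤ n} := by simpa using hw
    suffices h : ClOn {w | w.length ≤ n} _ _ from h.2 u hu
    rcases v with i | j
    · rw [X.der_snd_chart_inl hb]
      refine ClOn.add ((ih _ (hb.partial (e i))).mono zero_le_one
        fun _ t ht => by simpa using one_le_cost _ ht) ?_
      rw [← Finset.sum_neg_distrib]
      refine ClOn.sum _ fun q _ => ?_
      rw [← Finset.sum_neg_distrib]
      refine ClOn.sum _ fun l _ => ?_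
      rw [← neg_mul]
      refine (ClOn.mul (sublist_length_le n) (cl_coord q).neg.clOn
        (ClOn.mul (sublist_length_le n) (cl_fst ((X.cb_A q l).partial (e i))).clOn
          (ih _ (hb.partial (e l))))).mono zero_le_one fun _ t ht => ?_
      have := norm_nonneg t
      simp only [cost]; nlinarith
    · rw [X.der_snd_chart_inr hb, ← Finset.sum_neg_distrib]
      refine ClOn.sum _ fun l _ => ?_
      rw [← neg_mul]
      refine (ClOn.mul (sublist_length_le n) (cl_fst (X.cb_A j l)).neg.clOn
          (ih _ (hb.partial (e l)))).mono zero_le_one fun _ t ht => ?_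
      simpa using one_le_cost _ ht

/-- By the mean value theorem b(x) - b(y) = O(|x-y|) = O(|t|). An x-derivative gives a difference of
the same kind plus terms with an explicit factor t^q. A t-derivative destroys the cancellation, but
1 ≤ |t| · cost. -/
theorem cl_sub_chart {b : RN d → ℂ} (hb : Cb b) :
    Cl (fun _ t => ‖t‖) ((fun (_ : ι) p => b p.1) + -(fun (_ : ι) p => b (X.chart p).2)) := by
  refine ⟨((cl_fst hb).add (X.cl_snd_chart hb).neg).1, fun w => ?_⟩
  induction w generalizing b with
  | nil =>
    obtain ⟨C, hC⟩ := hb.2 1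
    obtain ⟨C', h0', hC'⟩ := X.norm_comb_le
    have hC0 : 0 ≤ C := (norm_nonneg _).trans (hC 0)
    refine ⟨C * C', by positivity, fun i x t _ => ?_⟩
    have h1 := Convex.norm_image_sub_le_of_norm_fderiv_le (𝕜 := ℝ) (f := b) (C := C)
      (s := Set.univ) (x := (X.chart (x, t)).2) (y := x)
      (fun y _ => hb.1.differentiable (by simp) y)
      (fun y _ => by rw [← norm_iteratedFDeriv_one (𝕜 := ℝ)]; exact hC y)
      convex_univ trivial trivial
    have h2 : x - (X.chart (x, t)).2 = X.comb x t := by simp [chart]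
    rw [h2] at h1
    have h3 : ‖((fun (_ : ι) (p : RN d × RN d) => b p.1) +
        -(fun (_ : ι) p => b (X.chart p).2)) i (x, t)‖ = ‖b x - b (X.chart (x, t)).2‖ := by
      simp [sub_eq_add_neg]
    rw [h3, mul_assoc]
    exact h1.trans (mul_le_mul_of_nonneg_left (hC' x t) hC0)
  | cons v w ih =>
    have s1 := (cl_fst (ι := ι) hb).1
    have s2 := (X.cl_snd_chart (ι := ι) hb).1
    have hn : der v (-(fun (_ : ι) p => b (X.chart p).2)) = -der v (fun (_ : ι) p => b (X.chart p).2) := by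
      funext i p; simp [der, along, fderiv_neg]
    have key := agree_der_add s1 (X.cl_snd_chart (ι := ι) hb).neg.1 v
    rw [hn] at key
    simp only [Est]
    rcases v with i | j
    · refine Est.congr ?_ key
      rw [X.der_snd_chart_inl hb]
      have h0 : der (Sum.inl i) (fun (_ : ι) p => b p.1) = fun _ p => fderiv ℝ b p.1 (e i) := by
        funext i' p
        have h := ((hb.1.differentiable (by simp) p.1).hasFDerivAt).comp p hasFDerivAt_fst
        have h' : fderiv ℝ (fun p : RN d × RN d => b p.1) p = _ := h.fderiv
        simp only [der, along]
        rw [h']; rfl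
      rw [h0, neg_add, neg_neg, ← add_assoc]
      have c0 := (cl_fst (ι := ι) (hb.partial (e i))).add (X.cl_snd_chart (hb.partial (e i))).neg
      have c1 : Cl (fun _ t => ‖t‖ * cost (Sum.inl i) t) (∑ q, ∑ l,
          (fun (_ : ι) p => ((p.2 q : ℝ) : ℂ)) *
          ((fun _ p => fderiv ℝ (fun z => (X.A z q l : ℂ)) p.1 (e i)) *
            (fun _ p => fderiv ℝ b (X.chart p).2 (e l)))) := by
        refine Cl.sum _ fun q _ => Cl.sum _ fun l _ => ?_
        refine ((cl_coord q).mul ((cl_fst ((X.cb_A q l).partial (e i))).mul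
          (X.cl_snd_chart (hb.partial (e l))))).mono zero_le_one fun _ t ht => ?_
        have := one_le_cost (Sum.inl i) ht
        have := norm_nonneg t
        nlinarith
      refine Est.add c0.1 c1.1 ((ih (hb.partial (e i))).mono zero_le_one fun _ t ht => ?_) (c1.2 w)
      have := one_le_cost (Sum.inl i) ht
      have := norm_nonneg t
      nlinarith
    · refine Est.congr ?_ key
      rw [X.der_snd_chart_inr hb, neg_neg]
      have h0 : der (Sum.inr j) (fun (_ : ι) p => b p.1) = fun _ p => 0 := by
        funext i' p
        have h := ((hb.1.differentiable (by simp) p.1).hasFDerivAt).comp p hasFDerivAt_fst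
        have h' : fderiv ℝ (fun p : RN d × RN d => b p.1) p = _ := h.fderiv
        simp only [der, along]
        rw [h']; simp [anyPartial, partialSnd]
      rw [h0]
      refine ((cl_zero _).add (Cl.sum _ fun l _ => ?_)).2 w
      refine ((cl_fst (X.cb_A j l)).mul (X.cl_snd_chart (hb.partial (e l)))).mono zero_le_one
        fun _ t ht => ?_
      simpa using one_le_norm_mul_cost j ht

end AdaptedFrame

/-! ### Weights with singularity and decay. -/

/-- The weight `|t|^{-a} (|t^N| + |t|²)^{-b} (1 + |t|)^{-M}`. -/
noncomputable def wt (a b : ℝ) (M : ℕ) (t : RN d) : ℝ :=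
  ‖t‖ ^ (-a) * aniso t ^ (-b) * ((1 + ‖t‖) ^ M)⁻¹

theorem wt_pos (a b : ℝ) (M : ℕ) {t : RN d} (ht : t ≠ 0) : 0 < wt a b M t := by
  have h0 : 0 < ‖t‖ := norm_pos_iff.2 ht
  have h2 := aniso_pos ht
  unfold wt; positivity

theorem wt_add_left (a b : ℝ) (M i : ℕ) {t : RN d} (ht : t ≠ 0) :
    wt (a + i) b M t = wt a b M t * (‖t‖ ^ i)⁻¹ := by
  have h0 : 0 < ‖t‖ := norm_pos_iff.2 ht
  rw [wt, neg_add, Real.rpow_add h0, Real.rpow_neg h0.le (i : ℝ), Real.rpow_natCast, wt]; ring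

theorem wt_add_right (a b : ℝ) (M i : ℕ) {t : RN d} (ht : t ≠ 0) :
    wt a (b + i) M t = wt a b M t * (aniso t ^ i)⁻¹ := by
  have h0 := aniso_pos ht
  rw [wt, neg_add, Real.rpow_add h0, Real.rpow_neg h0.le (i : ℝ), Real.rpow_natCast, wt]; ring

theorem wt_add_nat (a b : ℝ) (M i : ℕ) (t : RN d) :
    wt a b (M + i) t = wt a b M t * ((1 + ‖t‖) ^ i)⁻¹ := by
  rw [wt, wt, pow_add, mul_inv]; ring

theorem aniso_le_sq (t : RN d) : aniso t ≤ (1 + ‖t‖) ^ 2 := by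
  have := aniso_le t
  have := norm_nonneg t
  nlinarith

/-- Extra decay at infinity can be given up in exchange for a stronger singularity at 0. So fewer
derivatives than allowed still satisfy the estimate for the maximal number. -/
theorem wt_le (a b : ℝ) (M i j : ℕ) {t : RN d} (ht : t ≠ 0) :
    wt a b (M + i + 2 * j) t ≤ wt (a + i) (b + j) M t := by
  have h0 : 0 < ‖t‖ := norm_pos_iff.2 ht
  have h2 := aniso_pos ht
  have h3 := wt_pos a b M ht
  rw [wt_add_right _ _ _ _ ht, wt_add_left _ _ _ _ ht, add_assoc, wt_add_nat, mul_assoc,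
    ← mul_inv]
  refine mul_le_mul_of_nonneg_left (inv_anti₀ (by positivity) ?_) h3.le
  rw [pow_add, pow_mul]
  gcongr
  · linarith
  · exact aniso_le_sq t

/-- The number of `t`-derivatives in a word. -/
def tcount (w : List (Letter d)) : ℕ := w.countP Sum.isRight

theorem tcount_sublist (n : ℕ) : ∀ w ∈ {w : List (Letter d) | tcount w ≤ n},
    ∀ u : List (Letter d), u.Sublist w → u ∈ {w : List (Letter d) | tcount w ≤ n} :=
  fun _ hw _ hu => (hu.countP_le (p := Sum.isRight)).trans hw

/-! ### Kernel estimates in the chart. -/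

namespace AdaptedFrame

variable {H : RN d → Submodule ℝ (RN d)} (X : AdaptedFrame H)

/-- The module generated, over bounded smooth functions of `y`, by the derivatives of `k` in `y`
with at most `g` good and at most `h` arbitrary factors. -/
inductive KSpan (k : RN d × RN d → ℂ) : ℕ → ℕ → (RN d × RN d → ℂ) → Prop
  | base {g h : ℕ} (γ : List (Fin d)) (l : List (Fin (d + 1))) (hg : γ.length ≤ g)
      (hh : l.length ≤ h) :
      KSpan k g h (alongList (γ.map (fun i => X.goodX (Sum.inr i)) ++
        l.map (fun j => anyPartial (Sum.inr j))) k)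
  | add {g h : ℕ} {F G : RN d × RN d → ℂ} : KSpan k g h F → KSpan k g h G →
      KSpan k g h (F + G)
  | smul {g h : ℕ} {F : RN d × RN d → ℂ} {c : RN d → ℂ} (hc : Cb c) : KSpan k g h F →
      KSpan k g h ((fun p => c p.2) * F)
  | congr {g h : ℕ} {F G : RN d × RN d → ℂ} (hFG : Set.EqOn F G (offDiag d)) :
      KSpan k g h F → KSpan k g h G

theorem isOpen_offDiag : IsOpen (offDiag d) := isOpen_ne_fun continuous_fst continuous_snd

theorem contDiff_goodX (i : Fin d ⊕ Fin d) : ContDiff ℝ ∞ (X.goodX i) := by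
  have hv : ∀ i, ContDiff ℝ ∞ (X.vec i) := fun i =>
    (PiLp.continuousLinearEquiv 2 ℝ (fun _ : Fin (d + 1) => ℝ)).symm.contDiff.comp
      (contDiff_pi.2 fun j => X.smooth i j)
  rcases i with i | i
  · exact ((hv _).comp contDiff_fst).prodMk contDiff_const
  · exact contDiff_const.prodMk ((hv _).comp contDiff_snd)

theorem contDiff_DKer (i : Fin (d + 1)) : ContDiff ℝ ∞ (X.DKer i) := by
  have hc : ∀ k, ContDiff ℝ ∞ (fun p : RN d × RN d => p.1 k - p.2 k) := fun k =>
    ((EuclideanSpace.proj (𝕜 := ℝ) k).contDiff.comp contDiff_fst).sub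
      ((EuclideanSpace.proj (𝕜 := ℝ) k).contDiff.comp contDiff_snd)
  refine contDiff_const.prodMk (contDiff_const.add ?_)
  refine ContDiff.sum fun k _ => ContDiff.sum fun p _ => ContDiff.sum fun l _ =>
    ContDiff.fun_smul (ContDiff.mul (ContDiff.mul ?_ ?_) (hc k)) contDiff_const
  · exact ((((X.contDiff_B k p).fderiv_right (m := ∞) (by simp)).clm_apply contDiff_const).comp
      contDiff_fst)
  · exact (X.smooth p l).comp contDiff_fst

theorem alongList_contDiffOn {U : Set (RN d × RN d)} (hU : IsOpen U)
    {Vs : List (RN d × RN d → RN d × RN d)} (hV : ∀ V ∈ Vs, ContDiff ℝ ∞ V)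
    {F : RN d × RN d → ℂ} (hF : ContDiffOn ℝ ∞ F U) : ContDiffOn ℝ ∞ (alongList Vs F) U := by
  induction Vs with
  | nil => exact hF
  | cons V Vs ih =>
    exact along_contDiffOn hU (hV V (by simp)) (ih fun W hW => hV W (by simp [hW]))

variable {X} {k : RN d × RN d → ℂ}

theorem KSpan.contDiffOn (hk : ContDiffOn ℝ ∞ k (offDiag d)) {g h : ℕ} {F : RN d × RN d → ℂ}
    (hF : X.KSpan k g h F) : ContDiffOn ℝ ∞ F (offDiag d) := by
  induction hF with
  | base γ l _ _ =>
    refine alongList_contDiffOn isOpen_offDiag (fun V hV => ?_) hk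
    simp only [List.mem_append, List.mem_map] at hV
    rcases hV with ⟨i, _, rfl⟩ | ⟨j, _, rfl⟩
    · exact X.contDiff_goodX _
    · exact contDiff_anyPartial _
  | add _ _ h1 h2 => exact h1.add h2
  | smul hc _ h1 => exact (hc.1.comp contDiff_snd).contDiffOn.mul h1
  | congr hFG _ h1 => exact h1.congr fun p hp => (hFG hp).symm

theorem KSpan.mono {g h g' h' : ℕ} (hg : g ≤ g') (hh : h ≤ h') {F : RN d × RN d → ℂ}
    (hF : X.KSpan k g h F) : X.KSpan k g' h' F := by
  induction hF with
  | base γ l h1 h2 => exact .base γ l (h1.trans hg) (h2.trans hh)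
  | add _ _ h1 h2 => exact h1.add h2
  | smul hc _ h1 => exact h1.smul hc
  | congr hFG _ h1 => exact h1.congr hFG

theorem KSpan.sum {g h : ℕ} {κ : Type*} (s : Finset κ) {F : κ → RN d × RN d → ℂ}
    (hF : ∀ j ∈ s, X.KSpan k g h (F j)) : X.KSpan k g h (∑ j ∈ s, F j) := by
  classical
  induction s using Finset.induction_on with
  | empty =>
    exact (KSpan.smul (cb_const 0) (.base [] [] (by simp) (by simp))).congr
      (fun p _ => by simp)
  | insert a s ha ih =>
    rw [Finset.sum_insert ha]
    exact (hF a (by simp)).add (ih fun k hk => hF k (by simp [hk]))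

theorem along_snd_mul {c : RN d → ℂ} (hc : Cb c) {F : RN d × RN d → ℂ}
    (hF : ContDiffOn ℝ ∞ F (offDiag d)) (V : RN d × RN d → RN d × RN d) :
    Set.EqOn (along V ((fun p => c p.2) * F))
      ((fun p => fderiv ℝ c p.2 (V p).2) * F + (fun p => c p.2) * along V F) (offDiag d) := by
  intro p hp
  have h1 := ContDiffOn.diffAt isOpen_offDiag hF hp
  have h := ((hc.1.differentiable (by simp) p.2).hasFDerivAt).comp p hasFDerivAt_snd
  have h' : fderiv ℝ (fun p : RN d × RN d => c p.2) p = _ := h.fderiv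
  have h2 : DifferentiableAt ℝ (fun p : RN d × RN d => c p.2) p := h.differentiableAt
  rw [along_mul V h2 h1]
  simp only [along, h']
  rfl

theorem along_goodX_inr (i : Fin d) (F : RN d × RN d → ℂ) :
    along (X.goodX (Sum.inr i)) F =
      ∑ l, (fun p => (X.A p.2 i.castSucc l : ℂ)) * along (anyPartial (Sum.inr l)) F := by
  funext p
  have : X.goodX (Sum.inr i) p = ∑ l, X.A p.2 i.castSucc l • ((0, e l) : RN d × RN d) := by
    ext j
    · simp [goodX, Prod.fst_sum]
    · simp [goodX, vec, Prod.snd_sum, e, Finset.sum_apply, Pi.single_apply]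
  simp only [along, this, map_sum, map_smul, Complex.real_smul, Finset.sum_apply, Pi.mul_apply]
  rfl

theorem KSpan.good (hk : ContDiffOn ℝ ∞ k (offDiag d)) (i : Fin d) {g h : ℕ}
    {F : RN d × RN d → ℂ} (hF : X.KSpan k g h F) :
    X.KSpan k (g + 1) h (along (X.goodX (Sum.inr i)) F) := by
  induction hF with
  | base γ l h1 h2 => exact .base (i :: γ) l (by simpa using h1) h2
  | add h1 h2 i1 i2 =>
    exact (i1.add i2).congr fun p hp => (along_add _
      (ContDiffOn.diffAt isOpen_offDiag (h1.contDiffOn hk) hp)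
      (ContDiffOn.diffAt isOpen_offDiag (h2.contDiffOn hk) hp)).symm
  | @smul F c hc h1 i1 =>
    have hc' : Cb (fun y => fderiv ℝ c y (X.vec i.castSucc y)) := by
      have : (fun y => fderiv ℝ c y (X.vec i.castSucc y)) =
          fun y => ∑ l, (X.A y i.castSucc l : ℂ) * fderiv ℝ c y (e l) := by
        funext y
        have : X.vec i.castSucc y = ∑ l, X.A y i.castSucc l • (e l : RN d) := by
          ext j
          simp [vec, e, Finset.sum_apply, Pi.single_apply]
        simp only [this, map_sum, map_smul, Complex.real_smul]
      rw [this]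
      exact Cb.sum _ fun l _ => (X.cb_A _ _).mul (hc.partial _)
    refine KSpan.congr (along_snd_mul hc (h1.contDiffOn hk) _).symm ?_
    exact ((h1.smul hc').mono (Nat.le_succ _) le_rfl).add (i1.smul hc)
  | congr hFG _ i1 => exact i1.congr (along_eqOn isOpen_offDiag _ hFG)

theorem along_partial_comm {F : RN d × RN d → ℂ} (hF : ContDiffOn ℝ ∞ F (offDiag d))
    (u v : Letter d) : Set.EqOn (along (anyPartial u) (along (anyPartial v) F))
      (along (anyPartial v) (along (anyPartial u) F)) (offDiag d) := by
  intro p hp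
  have h2 : ContDiffAt ℝ 2 F p :=
    (hF.contDiffAt (isOpen_offDiag.mem_nhds hp)).of_le (by norm_cast)
  have hs : IsSymmSndFDerivAt ℝ F p := h2.isSymmSndFDerivAt (by simp)
  have hd : DifferentiableAt ℝ (fderiv ℝ F) p :=
    (h2.fderiv_right (m := 1) (by norm_num)).differentiableAt (by simp)
  have key : ∀ u v : Letter d, along (anyPartial u) (along (anyPartial v) F) p =
      fderiv ℝ (fderiv ℝ F) p (anyPartial u p) (anyPartial v p) := by
    intro u v
    have hc : ∃ c : RN d × RN d, anyPartial v = fun _ => c := by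
      rcases v with j | j <;> exact ⟨_, rfl⟩
    obtain ⟨c, hc⟩ := hc
    show fderiv ℝ (fun y => fderiv ℝ F y (anyPartial v y)) p (anyPartial u p) = _
    simp only [hc]
    rw [fderiv_clm_apply hd (differentiableAt_const c)]
    simp
  rw [key, key, hs.eq]

theorem along_sum {κ : Type*} (s : Finset κ) (V : RN d × RN d → RN d × RN d)
    {F : κ → RN d × RN d → ℂ} {p : RN d × RN d}
    (h : ∀ j ∈ s, DifferentiableAt ℝ (F j) p) :
    along V (∑ j ∈ s, F j) p = ∑ j ∈ s, along V (F j) p := by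
  simp only [along]
  rw [fderiv_sum h, sum_apply]

/-- The commutator of `∂/∂y^j` and `(X_i)_y`. -/
theorem along_partial_goodX {F : RN d × RN d → ℂ} (hF : ContDiffOn ℝ ∞ F (offDiag d))
    (j : Fin (d + 1)) (i : Fin d) :
    Set.EqOn (along (X.goodX (Sum.inr i)) (along (anyPartial (Sum.inr j)) F) +
        ∑ l, (fun p => fderiv ℝ (fun z => (X.A z i.castSucc l : ℂ)) p.2 (e j)) *
          along (anyPartial (Sum.inr l)) F)
      (along (anyPartial (Sum.inr j)) (along (X.goodX (Sum.inr i)) F)) (offDiag d) := by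
  intro p hp
  have hF' : ∀ l, ContDiffOn ℝ ∞ (along (anyPartial (Sum.inr l)) F) (offDiag d) :=
    fun l => along_contDiffOn isOpen_offDiag (contDiff_anyPartial _) hF
  have hd : ∀ l, DifferentiableAt ℝ ((fun p : RN d × RN d => (X.A p.2 i.castSucc l : ℂ)) *
      along (anyPartial (Sum.inr l)) F) p := fun l => ContDiffOn.diffAt isOpen_offDiag
      (((X.cb_A i.castSucc l).1.comp contDiff_snd).contDiffOn.mul (hF' l)) hp
  rw [along_goodX_inr, along_goodX_inr, along_sum _ _ fun l _ => hd l]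
  simp only [Pi.add_apply, Finset.sum_apply, Pi.mul_apply]
  rw [← Finset.sum_add_distrib]
  refine Finset.sum_congr rfl fun l _ => ?_
  have := along_snd_mul (X.cb_A i.castSucc l) (hF' l) (anyPartial (Sum.inr j)) hp
  rw [this]
  simp only [Pi.add_apply, Pi.mul_apply]
  rw [along_partial_comm hF (Sum.inr l) (Sum.inr j) hp, add_comm]
  rfl

/-- The hypothesis on the kernel lets the arbitrary derivatives act before the good ones, so ∂/∂y^j
must be moved past the good fields. Each commutator with some X_i is a combination of coordinate
derivatives, in which one good derivative has been lost. -/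
theorem KSpan.partial_base (hk : ContDiffOn ℝ ∞ k (offDiag d)) (γ : List (Fin d))
    (l : List (Fin (d + 1))) (j : Fin (d + 1)) {g h : ℕ} (hg : γ.length ≤ g) (hh : l.length ≤ h) :
    X.KSpan k g (h + 1) (along (anyPartial (Sum.inr j))
      (alongList (γ.map (fun i => X.goodX (Sum.inr i)) ++
        l.map (fun j => anyPartial (Sum.inr j))) k)) := by
  induction γ generalizing g j with
  | nil => exact .base [] (j :: l) (by simp) (by simpa using hh)
  | cons i γ ih =>
    obtain ⟨g, rfl⟩ : ∃ g', g = g' + 1 := ⟨g - 1, by simp at hg; omega⟩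
    have h1' : γ.length ≤ g := by simpa using hg
    have hb : X.KSpan k g h (alongList (γ.map (fun i => X.goodX (Sum.inr i)) ++
      l.map (fun j => anyPartial (Sum.inr j))) k) := .base γ l h1' hh
    refine KSpan.congr (along_partial_goodX (hb.contDiffOn hk) j i) ?_
    refine ((ih j h1').good hk i).add (KSpan.sum _ fun l' _ => ?_)
    exact ((ih l' h1').smul ((X.cb_A _ _).partial _)).mono (Nat.le_succ _) le_rfl

theorem KSpan.partial (hk : ContDiffOn ℝ ∞ k (offDiag d)) (j : Fin (d + 1)) {g h : ℕ}
    {F : RN d × RN d → ℂ} (hF : X.KSpan k g h F) :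
    X.KSpan k g (h + 1) (along (anyPartial (Sum.inr j)) F) := by
  induction hF with
  | base γ l h1 h2 => exact KSpan.partial_base hk γ l j h1 h2
  | add h1 h2 i1 i2 =>
    exact (i1.add i2).congr fun p hp => (along_add _
      (ContDiffOn.diffAt isOpen_offDiag (h1.contDiffOn hk) hp)
      (ContDiffOn.diffAt isOpen_offDiag (h2.contDiffOn hk) hp)).symm
  | @smul F c hc h1 i1 =>
    refine KSpan.congr (along_snd_mul hc (h1.contDiffOn hk) _).symm ?_
    exact ((h1.smul (hc.partial (e j))).mono le_rfl (Nat.le_succ _)).add (i1.smul hc)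
  | congr hFG _ i1 => exact i1.congr (along_eqOn isOpen_offDiag _ hFG)

variable (X)

/-- Estimates of `D_{x,y}^I F` are estimates of the `x`-derivatives of `F` in the chart. -/
theorem est_inl_comp_chart {ρ : RN d → ℝ} (hρ0 : ∀ t, t ≠ 0 → 0 ≤ ρ t) (w : List (Fin (d + 1)))
    {F : RN d × RN d → ℂ} (sF : ContDiffOn ℝ ∞ F (offDiag d))
    (hF : ∀ I : List (Fin (d + 1)), ∃ C : ℝ, 0 ≤ C ∧ ∀ x t, t ≠ 0 →
      ‖alongList (I.map X.DKer) F (X.chart (x, t))‖ ≤ C * ρ t) :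
    Est (w.map Sum.inl) (fun (_ : ι) t => ρ t) (fun _ => F ∘ X.chart) := by
  induction w generalizing F with
  | nil =>
    obtain ⟨C, h0, hC⟩ := hF []
    exact ⟨C, h0, fun i x t ht => hC x t ht⟩
  | cons i w ih =>
    have h1 := ih (F := along (X.DKer i) F)
      (along_contDiffOn isOpen_offDiag (X.contDiff_DKer i) sF) (fun I => by
        -- In `Est` the head of a word acts first, whereas in `alongList` the last entry does. So
        -- the new field is appended at the end.
        obtain ⟨C, h⟩ := hF (I ++ [i])
        refine ⟨C, ?_⟩
        simpa [alongList] using h)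
    show Est (w.map Sum.inl) _ (der (Sum.inl i) (fun _ => F ∘ X.chart))
    refine (h1.mono zero_le_one fun i' t ht => ?_).congr ?_
    · rw [one_mul]
      exact le_mul_of_one_le_right (hρ0 t ht) (one_le_cost _ ht)
    · intro i' p hp
      exact (X.along_inl_comp_chart i
        (ContDiffOn.diffAt isOpen_offDiag sF (X.chart_mem hp))).symm

/-- The bounds required of the kernel. -/
def KernelBounds (m n : ℝ) (k : RN d × RN d → ℂ) : Prop :=
  ∀ (I : List (Fin (d + 1))) (γ : List (Fin d ⊕ Fin d))
      (l : List (Fin (d + 1) ⊕ Fin (d + 1))) (M : ℝ), 0 ≤ M →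
      ∃ C : ℝ, ∀ x y : RN d, x ≠ y →
        ‖alongList (I.map X.DKer ++ γ.map X.goodX ++ l.map anyPartial) k (x, y)‖ ≤
          C / (‖x - y‖ ^ ((d : ℝ) + n + γ.length + M) *
            X.qdist x y ^ (2 * (1 + m + l.length)))

/-- The weight controlling an element of `KSpan k g h`. -/
theorem kernel_bound_chart {m n : ℝ} (hm : -1 < m) (hn : -(d : ℝ) < n)
    (hk : X.KernelBounds m n k) (I : List (Fin (d + 1))) (γ : List (Fin d))
    (l : List (Fin (d + 1))) {g h : ℕ} (hg : γ.length ≤ g) (hh : l.length ≤ h) (M : ℕ) :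
    ∃ C : ℝ, 0 ≤ C ∧ ∀ x t, t ≠ 0 →
      ‖alongList (I.map X.DKer) (alongList (γ.map (fun i => X.goodX (Sum.inr i)) ++
        l.map (fun j => anyPartial (Sum.inr j))) k) (X.chart (x, t))‖ ≤
        C * wt (d + n + g) (1 + m + h) M t := by
  obtain ⟨i, rfl⟩ := Nat.exists_eq_add_of_le hg
  obtain ⟨j, rfl⟩ := Nat.exists_eq_add_of_le hh
  obtain ⟨C₁, hC₁, hT⟩ := X.norm_theta_le
  set a : ℝ := d + n + γ.length with ha
  set b : ℝ := 1 + m + l.length with hb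
  have ha0 : 0 < a := by have : (0 : ℝ) ≤ γ.length := by positivity
                         linarith
  have hb0 : 0 < b := by have : (0 : ℝ) ≤ l.length := by positivity
                         linarith
  -- From |t| ≤ C₁|x-y| follow c|t| ≤ |x-y| and c²(|t^N|+|t|²) ≤ d(x,y)². The lower bounds on m and
  -- n make the exponents a and b positive, so these inequalities may be raised to the powers in the
  -- hypothesis.
  set c : ℝ := (1 + C₁)⁻¹ with hc
  have hc0 : 0 < c := by positivity
  have hc1 : c * (1 + C₁) = 1 := inv_mul_cancel₀ (by positivity)
  have hc2 : c ≤ 1 := by nlinarith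
  set P := M + i + 2 * j with hP
  have key : ∀ Q : ℕ, ∃ C : ℝ, 0 ≤ C ∧ ∀ x t, t ≠ 0 →
      ‖alongList (I.map X.DKer) (alongList (γ.map (fun i => X.goodX (Sum.inr i)) ++
        l.map (fun j => anyPartial (Sum.inr j))) k) (X.chart (x, t))‖ * ‖t‖ ^ Q ≤
        C * (‖t‖ ^ (-a) * aniso t ^ (-b)) := by
    intro Q
    obtain ⟨C, hC⟩ := hk I (γ.map Sum.inr) (l.map Sum.inr) Q (by positivity)
    refine ⟨|C| * ((c ^ (a + Q))⁻¹ * ((c ^ 2) ^ b)⁻¹), by positivity, fun x t ht => ?_⟩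
    have h0 : 0 < ‖t‖ := norm_pos_iff.2 ht
    have h2 := aniso_pos ht
    have hne : x ≠ (X.chart (x, t)).2 := X.chart_mem (p := (x, t)) ht
    have h3 := hC x (X.chart (x, t)).2 hne
    have hth : X.theta x (X.chart (x, t)).2 = t := X.theta_comb x t
    have h4 : c * ‖t‖ ≤ ‖x - (X.chart (x, t)).2‖ := by
      have h5 := hT x (X.chart (x, t)).2
      rw [hth] at h5
      have h6 := norm_nonneg (x - (X.chart (x, t)).2)
      calc c * ‖t‖ ≤ c * ((1 + C₁) * ‖x - (X.chart (x, t)).2‖) :=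
            mul_le_mul_of_nonneg_left (by linarith) hc0.le
        _ = _ := by rw [← mul_assoc, hc1, one_mul]
    have h5 : c ^ 2 * aniso t ≤ X.qdist x (X.chart (x, t)).2 ^ 2 := by
      have h6 : X.Theta x (X.chart (x, t)).2 (Fin.last d) = t (Fin.last d) := by
        rw [← congrArg (fun s : RN d => s (Fin.last d)) hth]; rfl
      have h7 := Real.sq_sqrt (abs_nonneg (t (Fin.last d)))
      have h8 := Real.sqrt_nonneg |t (Fin.last d)|
      rw [qdist, h6]
      have h9 : (c * ‖t‖) ^ 2 ≤ ‖x - (X.chart (x, t)).2‖ ^ 2 := by gcongr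
      have h10 := norm_nonneg (x - (X.chart (x, t)).2)
      have h11 : c ^ 2 * |t (Fin.last d)| ≤ |t (Fin.last d)| :=
        mul_le_of_le_one_left (abs_nonneg _) (by nlinarith)
      unfold aniso
      nlinarith [mul_nonneg h8 h10]
    have hq0 : 0 ≤ X.qdist x (X.chart (x, t)).2 := by unfold qdist; positivity
    have h6 : c ^ (a + Q) * (‖t‖ ^ a * ‖t‖ ^ Q) ≤ ‖x - (X.chart (x, t)).2‖ ^ (a + Q) := by
      rw [← Real.rpow_natCast ‖t‖, ← Real.rpow_add h0, ← Real.mul_rpow hc0.le h0.le]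
      exact Real.rpow_le_rpow (by positivity) h4 (by positivity)
    have h7 : (c ^ 2) ^ b * aniso t ^ b ≤ X.qdist x (X.chart (x, t)).2 ^ (2 * b) := by
      rw [Real.rpow_mul hq0, Real.rpow_two, ← Real.mul_rpow (by positivity) h2.le]
      exact Real.rpow_le_rpow (by positivity) h5 hb0.le
    have h8 : ‖alongList (I.map X.DKer) (alongList (γ.map (fun i => X.goodX (Sum.inr i)) ++
        l.map (fun j => anyPartial (Sum.inr j))) k) (X.chart (x, t))‖ ≤
        |C| / ((c ^ (a + Q) * (‖t‖ ^ a * ‖t‖ ^ Q)) * ((c ^ 2) ^ b * aniso t ^ b)) := by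
      have h9 : alongList (I.map X.DKer) (alongList (γ.map (fun i => X.goodX (Sum.inr i)) ++
          l.map (fun j => anyPartial (Sum.inr j))) k) (X.chart (x, t)) =
          alongList (I.map X.DKer ++ (γ.map Sum.inr).map X.goodX ++
            (l.map Sum.inr).map anyPartial) k (x, (X.chart (x, t)).2) := by
        simp [alongList, List.foldr_append, List.map_map, Function.comp_def, chart]
      rw [h9]
      refine h3.trans ?_
      simp only [List.length_map]
      refine div_le_div₀ (abs_nonneg _) (le_abs_self _) (by positivity) ?_
      exact mul_le_mul h6 h7 (by positivity) (by positivity)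
    refine (mul_le_mul_of_nonneg_right h8 (by positivity)).trans (le_of_eq ?_)
    rw [Real.rpow_neg h0.le, Real.rpow_neg h2.le]
    field_simp
  -- The case M = 0 is effective near t = 0 and the case M = P at infinity. As (1+|t|)^P ≤ 2^P
  -- (1+|t|^P), their sum yields the factor (1+|t|)^{-P}.
  obtain ⟨D₀, hD₀, h₀⟩ := key 0
  obtain ⟨D₁, hD₁, h₁⟩ := key P
  refine ⟨2 ^ P * (D₀ + D₁), by positivity, fun x t ht => ?_⟩
  have h0 : 0 < ‖t‖ := norm_pos_iff.2 ht
  have hw := wt_le a b M i j ht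
  have e1 : (d : ℝ) + n + ((γ.length + i : ℕ) : ℝ) = a + i := by push_cast; rw [ha]; ring
  have e2 : 1 + m + ((l.length + j : ℕ) : ℝ) = b + j := by push_cast; rw [hb]; ring
  rw [e1, e2]
  refine le_trans ?_ (mul_le_mul_of_nonneg_left hw (by positivity))
  have hpos : 0 < (1 + ‖t‖) ^ P := by positivity
  rw [← hP, wt, ← mul_assoc, ← div_eq_mul_inv, le_div_iff₀ hpos]
  have h3 : (1 + ‖t‖) ^ P ≤ 2 ^ P * (‖t‖ ^ 0 + ‖t‖ ^ P) := by
    rw [pow_zero]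
    have : (1 + ‖t‖) ^ P ≤ 2 ^ (P - 1) * (1 ^ P + ‖t‖ ^ P) :=
      add_pow_le zero_le_one h0.le P
    rw [one_pow] at this
    refine this.trans (mul_le_mul_of_nonneg_right ?_ (by positivity))
    exact pow_le_pow_right₀ (by norm_num) (Nat.sub_le _ _)
  refine (mul_le_mul_of_nonneg_left h3 (norm_nonneg _)).trans ?_
  have := h₀ x t ht
  have := h₁ x t ht
  rw [mul_left_comm, mul_add, mul_assoc (2 ^ P : ℝ), add_mul]
  exact mul_le_mul_of_nonneg_left (by linarith) (by positivity)

theorem KSpan.est_zero {m n : ℝ} (hm : -1 < m) (hn : -(d : ℝ) < n)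
    (sk : ContDiffOn ℝ ∞ k (offDiag d)) (hk : X.KernelBounds m n k) {g h : ℕ}
    {F : RN d × RN d → ℂ} (hF : X.KSpan k g h F) (M : ℕ) :
    ClOn {w | tcount w ≤ 0} (fun (_ : ι) t => wt (d + n + g) (1 + m + h) M t)
      (fun _ => F ∘ X.chart) := by
  have sm : ∀ {F : RN d × RN d → ℂ}, X.KSpan k g h F → Sm (fun (_ : ι) => F ∘ X.chart) :=
    fun hF _ => (hF.contDiffOn sk).comp X.contDiff_chart.contDiffOn fun p hp => X.chart_mem hp
  induction hF with
  | base γ l h1 h2 =>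
    refine ⟨sm (.base γ l h1 h2), fun w hw => ?_⟩
    obtain ⟨I, rfl⟩ : ∃ I : List (Fin (d + 1)), w = I.map Sum.inl := by
      clear sm
      induction w with
      | nil => exact ⟨[], rfl⟩
      | cons v w ih =>
        rcases v with i | j
        · obtain ⟨I, hI⟩ := ih (by simpa [tcount] using hw)
          exact ⟨i :: I, by simp [hI]⟩
        · have h3 : tcount (Sum.inr j :: w) = tcount w + 1 := List.countP_cons_of_pos rfl
          have h4 : tcount (Sum.inr j :: w) ≤ 0 := hw
          omega
    exact X.est_inl_comp_chart (fun t ht => (wt_pos _ _ M ht).le) I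
      ((KSpan.base γ l h1 h2).contDiffOn sk)
      fun I => X.kernel_bound_chart hm hn hk I γ l h1 h2 M
  | add _ _ i1 i2 => exact i1.add i2
  | smul hc _ i1 =>
    exact (ClOn.mul (tcount_sublist 0) (X.cl_snd_chart hc).clOn i1).mono zero_le_one
      fun _ t _ => by simp
  | congr hFG _ i1 => exact i1.congr fun _ p hp => hFG (X.chart_mem hp)

theorem wt_last (a b : ℝ) (M : ℕ) {t : RN d} (ht : t ≠ 0) :
    wt a (b + 1) M t ≤ wt a b M t * cost (Sum.inr (Fin.last d)) t := by
  have h1 := wt_add_right a b M 1 ht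
  rw [Nat.cast_one] at h1
  have h2 := aniso_pos ht
  have h0 := norm_nonneg t
  rw [h1, pow_one]
  refine mul_le_mul_of_nonneg_left ?_ (wt_pos _ _ _ ht).le
  simp only [cost, if_true]
  rw [inv_eq_one_div]
  exact div_le_div_of_nonneg_right (by nlinarith) h2.le

theorem wt_castSucc (a b : ℝ) (M : ℕ) (i : Fin d) {t : RN d} (ht : t ≠ 0) :
    wt (a + 1) b M t ≤ wt a b M t * cost (Sum.inr i.castSucc) t := by
  have h1 := wt_add_left a b M 1 ht
  rw [Nat.cast_one] at h1
  have h0 : 0 < ‖t‖ := norm_pos_iff.2 ht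
  rw [h1, pow_one]
  refine mul_le_mul_of_nonneg_left ?_ (wt_pos _ _ _ ht).le
  simp only [cost, (Fin.castSucc_lt_last i).ne, if_false]
  rw [inv_eq_one_div]
  exact div_le_div_of_nonneg_right (by nlinarith) h0.le

/-- This is why the anisotropic structure survives freezing the coefficients: since |t|² ≤
|t^N|+|t|², an arbitrary derivative with coefficient O(|t|) costs at most as much as a good one. -/
theorem norm_mul_wt (a b : ℝ) (M : ℕ) (i : Fin d) {t : RN d} (ht : t ≠ 0) :
    ‖t‖ * wt a (b + 1) M t ≤ wt a b M t * cost (Sum.inr i.castSucc) t := by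
  have h1 := wt_add_right a b M 1 ht
  rw [Nat.cast_one] at h1
  have h0 : 0 < ‖t‖ := norm_pos_iff.2 ht
  have h2 := aniso_pos ht
  rw [h1, pow_one, mul_left_comm]
  refine mul_le_mul_of_nonneg_left ?_ (wt_pos _ _ _ ht).le
  simp only [cost, (Fin.castSucc_lt_last i).ne, if_false]
  rw [← div_eq_mul_inv, div_le_div_iff₀ h2 h0]
  have : ‖t‖ ^ 2 ≤ aniso t := by unfold aniso; linarith [abs_nonneg (t (Fin.last d))]
  nlinarith

theorem KSpan.clOn {m n : ℝ} (hm : -1 < m) (hn : -(d : ℝ) < n)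
    (sk : ContDiffOn ℝ ∞ k (offDiag d)) (hk : X.KernelBounds m n k) (N : ℕ) {g h : ℕ}
    {F : RN d × RN d → ℂ} (hF : X.KSpan k g h F) (M : ℕ) :
    ClOn {w | tcount w ≤ N} (fun (_ : ι) t => wt (d + n + g) (1 + m + h) M t)
      (fun _ => F ∘ X.chart) := by
  induction N generalizing g h F with
  | zero => exact hF.est_zero X hm hn sk hk M
  | succ N ih =>
    have h0 := hF.est_zero (ι := ι) X hm hn sk hk M
    refine ⟨h0.1, fun w hw => ?_⟩
    by_cases hw0 : tcount w = 0
    · exact h0.2 w hw0.le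
    -- Some t-derivative is moved to the head of the word, so that it acts first and turns into
    -- y-derivatives of the kernel. The words left when no t-derivative remains are pure
    -- x-derivatives, which are the outermost fields D_{x,y} of the hypothesis.
    obtain ⟨v, hv, hvr⟩ := List.countP_pos_iff.1 (Nat.pos_of_ne_zero hw0)
    obtain ⟨j, rfl⟩ := Sum.isRight_iff.1 hvr
    obtain ⟨u, u', rfl⟩ := List.append_of_mem hv
    have hp : (u ++ Sum.inr j :: u').Perm (Sum.inr j :: (u ++ u')) := List.perm_middle
    refine Est.perm hp.symm h0.1 ?_
    have hcount : (u ++ u') ∈ {w : List (Letter d) | tcount w ≤ N} := by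
      have h1 : tcount (u ++ Sum.inr j :: u') = _ := hp.countP_eq Sum.isRight
      rw [List.countP_cons_of_pos (by rfl)] at h1
      have h2 : tcount (u ++ Sum.inr j :: u') ≤ N + 1 := hw
      show List.countP _ _ ≤ N
      omega
    show Est (u ++ u') _ (der _ _)
    have ag : Agree (der (Sum.inr j) (fun (_ : ι) => F ∘ X.chart))
        (∑ l, (-fun (_ : ι) p => (X.A p.1 j l : ℂ)) *
          fun _ => along (anyPartial (Sum.inr l)) F ∘ X.chart) := by
      intro i p hp
      have := X.along_inr_comp_chart j
        (ContDiffOn.diffAt isOpen_offDiag (hF.contDiffOn sk) (X.chart_mem hp))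
      simp only [der, this, Finset.sum_apply, Pi.mul_apply, Pi.neg_apply, neg_mul,
        Finset.sum_neg_distrib]
      rfl
    suffices hs : ClOn {w | tcount w ≤ N} _ _ from hs.2 _ hcount
    have h1 : ∀ l, ClOn {w | tcount w ≤ N} (fun (_ : ι) t => wt (d + n + g) (1 + m + h + 1) M t)
        (fun _ => along (anyPartial (Sum.inr l)) F ∘ X.chart) := fun l =>
      (ih (hF.partial sk l)).mono zero_le_one fun _ t ht => by
        push_cast; rw [one_mul, add_assoc (1 + m)]
    induction j using Fin.lastCases with
    | last =>
      refine ClOn.congr (ClOn.sum _ fun l _ => ?_) ag.symm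
      refine (ClOn.mul (tcount_sublist N) (cl_fst (X.cb_A _ l)).neg.clOn (h1 l)).mono
        zero_le_one fun _ t ht => ?_
      rw [one_mul, one_mul]
      exact wt_last _ _ _ ht
    | cast i =>
      have h2 : ClOn {w | tcount w ≤ N} (fun (_ : ι) t => wt (d + n + g + 1) (1 + m + h) M t)
          (fun _ => along (X.goodX (Sum.inr i)) F ∘ X.chart) :=
        (ih (hF.good sk i)).mono zero_le_one fun _ t ht => by
          push_cast; rw [one_mul, add_assoc (d + n : ℝ)]
      -- The field X_i with coefficients frozen at x is split into X_i at y plus Σ (A_i^l(x) -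
      -- A_i^l(y)) ∂/∂y^l.
      have ag' : Agree (((fun _ _ => -1) * (fun (_ : ι) => along (X.goodX (Sum.inr i)) F ∘ X.chart)) +
          ∑ l, (-((fun (_ : ι) p => (X.A p.1 i.castSucc l : ℂ)) +
            -(fun _ p => (X.A (X.chart p).2 i.castSucc l : ℂ)))) *
            fun _ => along (anyPartial (Sum.inr l)) F ∘ X.chart)
          (der (Sum.inr i.castSucc) (fun (_ : ι) => F ∘ X.chart)) := by
        intro i' p hp
        rw [ag i' hp]
        simp only [along_goodX_inr, Finset.sum_apply, Pi.mul_apply, Pi.neg_apply, Pi.add_apply,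
          Function.comp_apply, neg_mul, one_mul, Finset.sum_neg_distrib]
        rw [← neg_add, ← Finset.sum_add_distrib]
        congr 1
        exact Finset.sum_congr rfl fun l _ => by ring
      refine ClOn.congr (ClOn.add ?_ (ClOn.sum _ fun l _ => ?_)) ag'
      · refine (ClOn.mul (tcount_sublist N) (cl_const fun _ => -1).clOn h2).mono zero_le_one
          fun _ t ht => ?_
        rw [norm_neg, norm_one, one_mul, one_mul]
        exact wt_castSucc _ _ _ _ ht
      · refine (ClOn.mul (tcount_sublist N) (X.cl_sub_chart (X.cb_A i.castSucc l)).neg.clOn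
          (h1 l)).mono zero_le_one fun _ t ht => ?_
        rw [one_mul]
        exact norm_mul_wt _ _ _ _ ht

/-- The kernel in the chart satisfies product-type estimates of every order. -/
theorem cl_kernel {m n : ℝ} (hm : -1 < m) (hn : -(d : ℝ) < n)
    (sk : ContDiffOn ℝ ∞ k (offDiag d)) (hk : X.KernelBounds m n k) (M : ℕ) :
    Cl (fun (_ : ι) t => wt (d + n) (1 + m) M t) (fun _ => k ∘ X.chart) := by
  have h : ∀ N, ClOn {w | tcount w ≤ N} (fun (_ : ι) t => wt (d + n) (1 + m) M t)
      (fun _ => k ∘ X.chart) := fun N =>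
    (KSpan.clOn X hm hn sk hk N (.base [] [] le_rfl le_rfl) M).mono zero_le_one
      fun _ t _ => by simp
  exact ⟨(h 0).1, fun w => (h (tcount w)).2 w (le_refl (tcount w))⟩

end AdaptedFrame

/-! ### Integration by parts across the singularity at t = 0. -/

/-- The derivative of an integrable function with a point singularity has integral zero. -/
theorem integral_deriv_eq_zero {E : Type*} [NormedAddCommGroup E] [NormedSpace ℝ E]
    [FiniteDimensional ℝ E] [MeasurableSpace E] [BorelSpace E] {μ : Measure E}
    [μ.IsAddHaarMeasure] (hE : 2 ≤ Module.finrank ℝ E) {f f' : E → ℂ} (v : E)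
    (hf : Integrable f μ) (hf' : Integrable f' μ) (hc : ContinuousOn f' {0}ᶜ)
    (hd : ∀ t : E, t ≠ 0 → HasDerivAt (fun s : ℝ => f (t + s • v)) (f' t) 0) :
    ∫ t, f' t ∂μ = 0 := by
  have hmeas : Measurable f' := measurable_of_continuousOn_compl_singleton 0 hc
  have hspan : Submodule.span ℝ {v} ≠ ⊤ := by
    intro h
    have h1 := finrank_span_le_card (R := ℝ) ({v} : Set E)
    simp only [Set.toFinset_singleton, Finset.card_singleton] at h1
    rw [h, finrank_top] at h1
    omega
  -- Only the lines in direction v through the origin itself are bad. They fill the line spanned by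
  -- v, which is null in dimension at least 2.
  have hnull : μ (Submodule.span ℝ {v} : Set E) = 0 := Measure.addHaar_submodule μ _ hspan
  have hae : ∀ᵐ t ∂μ, f (t + v) - f t = ∫ s in (0 : ℝ)..1, f' (t + s • v) := by
    have : ∀ᵐ t ∂μ, t ∉ (Submodule.span ℝ {v} : Set E) := measure_eq_zero_iff_ae_notMem.1 hnull
    filter_upwards [this] with t ht
    have hne : ∀ s : ℝ, t + s • v ≠ 0 := by
      intro s hs
      apply ht
      rw [add_eq_zero_iff_eq_neg] at hs
      rw [hs]
      exact Submodule.neg_mem _ (Submodule.smul_mem _ _ (Submodule.mem_span_singleton_self v))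
    have hder : ∀ s : ℝ, HasDerivAt (fun s : ℝ => f (t + s • v)) (f' (t + s • v)) s := by
      intro s
      have h1 := hd _ (hne s)
      have h2 : HasDerivAt (fun s' : ℝ => s' - s) 1 s := (hasDerivAt_id s).sub_const s
      have h1' : HasDerivAt (fun s' : ℝ => f (t + s • v + s' • v)) (f' (t + s • v)) (s - s) := by
        rw [sub_self]; exact h1
      have h3 := HasDerivAt.scomp (h := fun s' : ℝ => s' - s) s h1' h2
      rw [one_smul] at h3
      refine h3.congr_of_eventuallyEq (Filter.Eventually.of_forall fun s' => ?_)
      simp only [Function.comp_apply]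
      congr 1
      rw [add_assoc, ← add_smul]; congr 2; ring
    have hcont : Continuous (fun s : ℝ => f' (t + s • v)) :=
      hc.comp_continuous (by fun_prop) fun s => hne s
    rw [intervalIntegral.integral_eq_sub_of_hasDerivAt (fun s _ => hder s)
      (hcont.intervalIntegrable _ _)]
    simp
  have h0 : ∫ t, (f (t + v) - f t) ∂μ = 0 := by
    rw [integral_sub (hf.comp_add_right v) hf, integral_add_right_eq_self, sub_self]
  rw [integral_congr_ae hae] at h0
  simp only [intervalIntegral.integral_of_le zero_le_one] at h0
  -- After Fubini the inner integral of f'(t + s v) does not depend on s, by translation invariance.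
  rw [integral_integral_swap] at h0
  · simp only [integral_add_right_eq_self f'] at h0
    simpa using h0
  · have hm : Measurable (fun p : E × ℝ => f' (p.1 + p.2 • v)) := by
      apply hmeas.comp
      exact (measurable_fst.add (measurable_snd.smul_const v))
    rw [Function.uncurry_def]
    rw [integrable_prod_iff' hm.aestronglyMeasurable]
    refine ⟨Filter.Eventually.of_forall fun s => hf'.comp_add_right (s • v), ?_⟩
    simp only [integral_add_right_eq_self (fun t => ‖f' t‖)]
    exact integrable_const _

/-- The character `t ↦ e^{-2πi t·η}`. -/
noncomputable def ex (η t : RN d) : ℂ :=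
  Complex.exp (-(2 * Real.pi * Complex.I * (inner ℝ t η : ℝ)))

theorem norm_ex (η t : RN d) : ‖ex η t‖ = 1 := by
  rw [ex, Complex.norm_exp]; simp

theorem continuous_ex : Continuous (fun p : RN d × RN d => ex p.1 p.2) := by
  unfold ex
  exact Complex.continuous_exp.comp ((continuous_const.mul (Complex.continuous_ofReal.comp
    (continuous_snd.inner continuous_fst))).neg)

theorem inner_e (j : Fin (d + 1)) (η : RN d) : inner ℝ (e j) η = η j := by
  rw [e, EuclideanSpace.inner_single_left]; simp

theorem hasDerivAt_ex (η t : RN d) (j : Fin (d + 1)) :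
    HasDerivAt (fun s : ℝ => ex η (t + s • e j)) (-(2 * Real.pi * Complex.I * η j) * ex η t) 0 := by
  have h1 : ∀ s : ℝ, ex η (t + s • e j) =
      ex η t * Complex.exp ((s : ℂ) * (-(2 * Real.pi * Complex.I * η j))) := by
    intro s
    rw [ex, ex, ← Complex.exp_add, inner_add_left, inner_smul_left, inner_e]
    congr 1; simp; ring
  have h2 : HasDerivAt (fun s : ℝ => (s : ℂ) * (-(2 * Real.pi * Complex.I * η j)))
      (1 * (-(2 * Real.pi * Complex.I * η j))) 0 :=
    (Complex.ofRealCLM.hasDerivAt (x := (0 : ℝ))).mul_const _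
  have h3 := (h2.cexp).const_mul (ex η t)
  rw [funext h1]
  refine h3.congr_deriv ?_
  simp; ring

/-- Partial derivatives in the second variable are derivatives along lines. -/
theorem hasDerivAt_line {F : RN d × RN d → ℂ} {x t : RN d} (hF : DifferentiableAt ℝ F (x, t))
    (j : Fin (d + 1)) :
    HasDerivAt (fun s : ℝ => F (x, t + s • e j)) (along (anyPartial (Sum.inr j)) F (x, t)) 0 := by
  have h1 : HasDerivAt (fun s : ℝ => ((x, t + s • e j) : RN d × RN d)) (0, e j) 0 := by
    have := ((hasDerivAt_id (0 : ℝ)).smul_const (e j : RN d)).const_add t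
    rw [one_smul] at this
    exact (hasDerivAt_const _ x).prodMk this
  have h2 : HasFDerivAt F (fderiv ℝ F (x, t)) (x, t + (0 : ℝ) • e j) := by
    simpa using hF.hasFDerivAt
  exact h2.comp_hasDerivAt 0 h1

theorem continuousOn_slice {F : RN d × RN d → ℂ} (hF : ContDiffOn ℝ ∞ F (punctured d)) (x : RN d) :
    ContinuousOn (fun t => F (x, t)) {0}ᶜ :=
  hF.continuousOn.comp (by fun_prop) fun _ ht => ht

theorem continuous_ex_right (η : RN d) : Continuous (ex η) :=
  continuous_ex.comp (by fun_prop : Continuous fun t : RN d => (η, t))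

theorem Integrable.mul_ex {f : RN d → ℂ} (hf : Integrable f) (η : RN d) :
    Integrable (fun t => f t * ex η t) :=
  hf.mul_bdd (c := 1) (continuous_ex_right η).aestronglyMeasurable
    (Filter.Eventually.of_forall fun t => (norm_ex η t).le)

/-- With c = -2πi η_j, the t^j-derivative of (c F - ∂_jF) e^{-2πi t·η} is (c² F - ∂_j²F) e^{-2πi
t·η}, because the mixed terms cancel. Thus one use of `integral_deriv_eq_zero` replaces two
integrations by parts. -/
theorem integral_second_deriv (hd : 1 ≤ d) {F : RN d × RN d → ℂ}
    (sF : ContDiffOn ℝ ∞ F (punctured d)) (x η : RN d) (j : Fin (d + 1))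
    (h0 : Integrable fun t => F (x, t))
    (h1 : Integrable fun t => along (anyPartial (Sum.inr j)) F (x, t))
    (h2 : Integrable fun t =>
      along (anyPartial (Sum.inr j)) (along (anyPartial (Sum.inr j)) F) (x, t)) :
    ∫ t, along (anyPartial (Sum.inr j)) (along (anyPartial (Sum.inr j)) F) (x, t) * ex η t =
      -(4 * Real.pi ^ 2 * (η j) ^ 2 * ∫ t, F (x, t) * ex η t) := by
  set V : RN d × RN d → RN d × RN d := anyPartial (Sum.inr j) with hV
  have s1 : ContDiffOn ℝ ∞ (along V F) (punctured d) :=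
    along_contDiffOn (isOpen_punctured d) (contDiff_anyPartial _) sF
  have s2 : ContDiffOn ℝ ∞ (along V (along V F)) (punctured d) :=
    along_contDiffOn (isOpen_punctured d) (contDiff_anyPartial _) s1
  set c : ℂ := -(2 * Real.pi * Complex.I * η j) with hc
  have hcc : c * c = -(4 * Real.pi ^ 2 * (η j) ^ 2) := by
    rw [hc]; ring_nf; rw [Complex.I_sq]; ring
  have key := integral_deriv_eq_zero (μ := (volume : Measure (RN d)))
    (by simp; omega : 2 ≤ Module.finrank ℝ (RN d))
    (f := fun t => c * (F (x, t) * ex η t) - along V F (x, t) * ex η t)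
    (f' := fun t => c * c * (F (x, t) * ex η t) - along V (along V F) (x, t) * ex η t) (e j)
    (((Integrable.mul_ex h0 η).const_mul c).sub (Integrable.mul_ex h1 η))
    (((Integrable.mul_ex h0 η).const_mul _).sub (Integrable.mul_ex h2 η))
    ((continuousOn_const.mul ((continuousOn_slice sF x).mul
      (continuous_ex_right η).continuousOn)).sub
      ((continuousOn_slice s2 x).mul (continuous_ex_right η).continuousOn))
    (fun t ht => by
      have d0 := hasDerivAt_line (ContDiffOn.diffAt (isOpen_punctured d) sF
        (show (x, t) ∈ punctured d from ht)) j
      have d1 := hasDerivAt_line (ContDiffOn.diffAt (isOpen_punctured d) s1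
        (show (x, t) ∈ punctured d from ht)) j
      have de := hasDerivAt_ex η t j
      have := ((d0.mul de).const_mul c).sub (d1.mul de)
      simp only [zero_smul, add_zero] at this
      refine HasDerivAt.congr_deriv this ?_
      rw [← hc, ← hV]; ring)
  rw [integral_sub ((Integrable.mul_ex h0 η).const_mul _) (Integrable.mul_ex h2 η),
    integral_const_mul, hcc, sub_eq_zero] at key
  rw [← key]; ring

/-! ### Integrable majorants and their scaling. -/

/-- A radial function on a space of dimension `D`, singular at the origin. -/
noncomputable def bump (a : ℝ) (D : ℕ) (R s : ℝ) : ℝ := s ^ (-a) * ((1 + R * s) ^ D)⁻¹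

/-- In polar coordinates the integrand behaves like s^{D-1-a} at 0, which needs a < D, and like
s^{-1-a} at infinity, which needs a > 0. -/
theorem integrable_bump {E : Type*} [NormedAddCommGroup E] [NormedSpace ℝ E]
    [FiniteDimensional ℝ E] [Nontrivial E] [MeasurableSpace E] [BorelSpace E] (μ : Measure E)
    [μ.IsAddHaarMeasure] {a : ℝ} (ha : 0 < a) (ha' : a < Module.finrank ℝ E) :
    Integrable (fun y : E => bump a (Module.finrank ℝ E) 1 ‖y‖) μ := by
  set D := Module.finrank ℝ E with hD
  have hD0 : 0 < D := Module.finrank_pos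
  rw [integrable_fun_norm_addHaar μ (f := fun s => bump a D 1 s), ← hD,
    ← Set.Ioc_union_Ioi_eq_Ioi zero_le_one]
  have hc : ContinuousOn (fun y : ℝ => y ^ (D - 1) • bump a D 1 y) (Set.Ioi 0) := by
    unfold bump
    refine ContinuousOn.smul (continuous_pow (D - 1)).continuousOn (ContinuousOn.mul ?_ ?_)
    · exact fun y hy => (Real.continuousAt_rpow_const y _ (Or.inl (ne_of_gt hy))).continuousWithinAt
    · refine ContinuousOn.inv₀ (by fun_prop) fun y hy => ?_
      have : (0 : ℝ) < y := hy
      positivity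
  have e1 : ∀ y : ℝ, 0 < y → y ^ (D - 1) • bump a D 1 y =
      y ^ ((D : ℝ) - 1 - a) * ((1 + y) ^ D)⁻¹ := by
    intro y hy
    rw [bump, smul_eq_mul, ← mul_assoc, ← Real.rpow_natCast y (D - 1), ← Real.rpow_add hy, one_mul]
    congr 2
    rw [Nat.cast_sub hD0]; simp; ring
  refine IntegrableOn.union ?_ ?_
  · have h1 : IntegrableOn (fun y : ℝ => y ^ ((D : ℝ) - 1 - a)) (Set.Ioc 0 1) := by
      rw [← intervalIntegrable_iff_integrableOn_Ioc_of_le zero_le_one]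
      exact intervalIntegral.intervalIntegrable_rpow' (by linarith)
    refine Integrable.mono' h1 ((hc.mono fun y hy => hy.1).aestronglyMeasurable measurableSet_Ioc) ?_
    refine (ae_restrict_iff' measurableSet_Ioc).2 (Filter.Eventually.of_forall fun y hy => ?_)
    have h0 : 0 < y := hy.1
    rw [e1 y h0, Real.norm_of_nonneg (by positivity)]
    refine mul_le_of_le_one_right (by positivity) (inv_le_one_of_one_le₀ ?_)
    exact one_le_pow₀ (by linarith)
  · have hlt : -1 - a < -1 := by linarith
    have h1 : IntegrableOn (fun y : ℝ => y ^ (-1 - a)) (Set.Ioi 1) :=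
      integrableOn_Ioi_rpow_of_lt hlt one_pos
    refine Integrable.mono' h1 ((hc.mono
      (Set.Ioi_subset_Ioi zero_le_one)).aestronglyMeasurable measurableSet_Ioi) ?_
    refine (ae_restrict_iff' measurableSet_Ioi).2 (Filter.Eventually.of_forall fun y hy => ?_)
    have h0 : 0 < y := lt_trans one_pos hy
    rw [e1 y h0, Real.norm_of_nonneg (by positivity)]
    have : (y : ℝ) ^ ((D : ℝ) - 1 - a) = y ^ (-1 - a) * y ^ D := by
      rw [← Real.rpow_natCast, ← Real.rpow_add h0]; congr 1; ring
    rw [this, mul_assoc]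
    refine mul_le_of_le_one_right (by positivity) ?_
    rw [← div_eq_mul_inv, div_le_one (by positivity)]
    gcongr; linarith

theorem bump_scale (a : ℝ) (D : ℕ) {R : ℝ} (hR : 0 < R) (s : ℝ) (hs : 0 ≤ s) :
    bump a D R s = R ^ a * bump a D 1 (R * s) := by
  rw [bump, bump, Real.mul_rpow hR.le hs, one_mul, ← mul_assoc, ← mul_assoc, ← Real.rpow_add hR]
  simp

theorem bump_scaled {E : Type*} [NormedAddCommGroup E] [NormedSpace ℝ E]
    [FiniteDimensional ℝ E] [Nontrivial E] [MeasurableSpace E] [BorelSpace E] (μ : Measure E)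
    [μ.IsAddHaarMeasure] {a : ℝ} (ha : 0 < a) (ha' : a < Module.finrank ℝ E) {R : ℝ} (hR : 0 < R) :
    Integrable (fun y : E => bump a (Module.finrank ℝ E) R ‖y‖) μ ∧
    ∫ y : E, bump a (Module.finrank ℝ E) R ‖y‖ ∂μ = R ^ (a - Module.finrank ℝ E) *
      ∫ y : E, bump a (Module.finrank ℝ E) 1 ‖y‖ ∂μ := by
  have e1 : (fun y : E => bump a (Module.finrank ℝ E) R ‖y‖) =
      fun y => R ^ a * bump a (Module.finrank ℝ E) 1 ‖R • y‖ := by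
    funext y
    rw [bump_scale _ _ hR _ (norm_nonneg y), norm_smul, Real.norm_of_nonneg hR.le]
  rw [e1]
  refine ⟨((integrable_bump μ ha ha').comp_smul hR.ne').const_mul _, ?_⟩
  rw [integral_const_mul, Measure.integral_comp_smul μ
    (fun y : E => bump a (Module.finrank ℝ E) 1 ‖y‖), smul_eq_mul, ← mul_assoc]
  congr 1
  rw [abs_of_pos (by positivity), Real.rpow_sub hR, Real.rpow_natCast]; rfl

/-- The splitting of `t` into its last coordinate and the others. -/
noncomputable def split (t : RN d) : ℝ × (Fin d → ℝ) := (t (Fin.last d), fun i => t i.castSucc)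

theorem measurePreserving_split : MeasurePreserving (split (d := d)) volume volume := by
  have h1 := volume_preserving_piFinSuccAbove (fun _ : Fin (d + 1) => ℝ) (Fin.last d)
  have h2 := PiLp.volume_preserving_ofLp (Fin (d + 1))
  have h3 : split (d := d) = MeasurableEquiv.piFinSuccAbove (fun _ : Fin (d + 1) => ℝ) (Fin.last d) ∘
      @WithLp.ofLp 2 (Fin (d + 1) → ℝ) := by
    funext t
    refine Prod.ext rfl (funext fun i => ?_)
    show t i.castSucc = t ((Fin.last d).succAbove i)
    rw [Fin.succAbove_last]
  rw [h3]
  exact h1.comp h2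

theorem measurableEmbedding_split : MeasurableEmbedding (split (d := d)) := by
  have h3 : split (d := d) = MeasurableEquiv.piFinSuccAbove (fun _ : Fin (d + 1) => ℝ) (Fin.last d) ∘
      (MeasurableEquiv.toLp 2 (Fin (d + 1) → ℝ)).symm := by
    funext t
    refine Prod.ext rfl (funext fun i => ?_)
    show t i.castSucc = t ((Fin.last d).succAbove i)
    rw [Fin.succAbove_last]
  rw [h3]
  exact (MeasurableEquiv.measurableEmbedding _).comp (MeasurableEquiv.measurableEmbedding _)

/-- A product of singular functions of `t^N` and of the other coordinates. -/
noncomputable def dom (a b R S : ℝ) (t : RN d) : ℝ :=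
  bump b 1 S ‖(split t).1‖ * bump a d R ‖(split t).2‖

/-- Fubini and dilation. The variable t' has dimension d and t^N has dimension 1, so the scales R⁻¹
and S⁻¹ produce R^{a-d} and S^{b-1}. These are the two factors of the symbol estimate. -/
theorem integral_dom (hd : 1 ≤ d) {a b : ℝ} (ha : 0 < a) (ha' : a < d) (hb : 0 < b) (hb' : b < 1) :
    ∃ C : ℝ, ∀ R S : ℝ, 0 < R → 0 < S → Integrable (dom (d := d) a b R S) ∧
      ∫ t, dom (d := d) a b R S t = C * (R ^ (a - d) * S ^ (b - 1)) := by
  have : Nonempty (Fin d) := ⟨⟨0, hd⟩⟩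
  have hf : Module.finrank ℝ (Fin d → ℝ) = d := by simp
  have hf1 : Module.finrank ℝ ℝ = 1 := by simp
  refine ⟨(∫ y : ℝ, bump b 1 1 ‖y‖) * ∫ y : Fin d → ℝ, bump a d 1 ‖y‖, fun R S hR hS => ?_⟩
  have h1 := bump_scaled (volume : Measure (Fin d → ℝ)) ha (by rw [hf]; exact ha') hR
  have h2 := bump_scaled (volume : Measure ℝ) hb (by rw [hf1]; simpa using hb') hS
  rw [hf] at h1
  rw [hf1, Nat.cast_one] at h2
  constructor
  · exact (measurePreserving_split.integrable_comp_emb measurableEmbedding_split).2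
      (h2.1.mul_prod h1.1)
  · have := measurePreserving_split.integral_comp measurableEmbedding_split
      (fun p : ℝ × (Fin d → ℝ) => bump b 1 S ‖p.1‖ * bump a d R ‖p.2‖)
    refine this.trans ?_
    rw [Measure.volume_eq_prod, integral_prod_mul (fun y : ℝ => bump b 1 S ‖y‖)
      (fun y : Fin d → ℝ => bump a d R ‖y‖), h1.2, h2.2]
    ring

/-- The exponent a may be zero or negative once derivatives of the symbol have been taken, and then
τ^{-a} is no longer a singular factor to which `integrable_bump` applies. Writing τ^{-a} = τ^{-a₀}
R^{a-a₀} (Rτ)^{a₀-a} raises it to a₀ > 0; part of the decay in 1+Rτ absorbs the last factor, and n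
powers remain. -/
theorem rpow_mul_inv_le_bump {a a₀ R τ r : ℝ} {n K : ℕ} (ha : a ≤ a₀) (ha₀ : 0 < a₀) (hR : 0 < R)
    (hr : 0 < r) (hrτ : r ≤ τ) (hK : a₀ - a + n ≤ K) :
    τ ^ (-a) * ((1 + R * τ) ^ K)⁻¹ ≤ R ^ (a - a₀) * bump a₀ n R r := by
  have hτ : 0 < τ := hr.trans_le hrτ
  have hV : 1 ≤ 1 + R * τ := by have := mul_pos hR hτ; linarith
  have hV0 : 0 < 1 + R * τ := by linarith
  have e1 : τ ^ (-a) = τ ^ (-a₀) * (R ^ (a - a₀) * (R * τ) ^ (a₀ - a)) := by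
    rw [Real.mul_rpow hR.le hτ.le, ← mul_assoc (R ^ (a - a₀)), ← Real.rpow_add hR]
    have : a - a₀ + (a₀ - a) = 0 := by ring
    rw [this, Real.rpow_zero, one_mul, ← Real.rpow_add hτ]; congr 1; ring
  have h2 : (R * τ) ^ (a₀ - a) * ((1 + R * τ) ^ K)⁻¹ ≤ ((1 + R * τ) ^ n)⁻¹ := by
    rw [← div_eq_mul_inv, div_le_iff₀ (by positivity), ← div_eq_inv_mul,
      le_div_iff₀ (by positivity)]
    rw [← Real.rpow_natCast _ n, ← Real.rpow_natCast _ K]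
    calc (R * τ) ^ (a₀ - a) * (1 + R * τ) ^ (n : ℝ) ≤ (1 + R * τ) ^ (a₀ - a) * (1 + R * τ) ^ (n : ℝ) := by
          gcongr; linarith
      _ = (1 + R * τ) ^ (a₀ - a + n) := (Real.rpow_add hV0 _ _).symm
      _ ≤ _ := Real.rpow_le_rpow_of_exponent_le hV hK
  have h3 : τ ^ (-a₀) ≤ r ^ (-a₀) := Real.rpow_le_rpow_of_nonpos hr hrτ (by linarith)
  have h4 : ((1 + R * τ) ^ n)⁻¹ ≤ ((1 + R * r) ^ n)⁻¹ := by
    apply inv_anti₀ (by positivity)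
    gcongr
  calc τ ^ (-a) * ((1 + R * τ) ^ K)⁻¹
      = R ^ (a - a₀) * (τ ^ (-a₀) * ((R * τ) ^ (a₀ - a) * ((1 + R * τ) ^ K)⁻¹)) := by rw [e1]; ring
    _ ≤ R ^ (a - a₀) * (r ^ (-a₀) * ((1 + R * r) ^ n)⁻¹) := by
        gcongr
        exact h2.trans h4

/-- `(t^N)² + |t|⁴`. -/
noncomputable def quart (t : RN d) : ℝ := t (Fin.last d) ^ 2 + (‖t‖ ^ 2) ^ 2

/-- `1 + 4π²s² ((t^N)² + |t|⁴)`. -/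
noncomputable def ell₁ (s : ℝ) (t : RN d) : ℝ := 1 + 4 * Real.pi ^ 2 * s ^ 2 * quart t

/-- `1 + 4π²r² |t|²`. -/
noncomputable def ell₂ (r : ℝ) (t : RN d) : ℝ := 1 + 4 * Real.pi ^ 2 * r ^ 2 * ‖t‖ ^ 2

theorem aniso_sq_le (t : RN d) : aniso t ^ 2 ≤ 2 * quart t := by
  unfold aniso quart
  nlinarith [sq_nonneg (|t (Fin.last d)| - ‖t‖ ^ 2), sq_abs (t (Fin.last d))]

theorem quart_le (t : RN d) : quart t ≤ aniso t ^ 2 := by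
  unfold aniso quart
  have : 0 ≤ |t (Fin.last d)| * ‖t‖ ^ 2 := by positivity
  nlinarith [sq_abs (t (Fin.last d))]

theorem one_le_two_pi_sq : 1 ≤ 2 * Real.pi ^ 2 := by nlinarith [Real.pi_gt_three]

/-- Here s = |η|, r = |η'|, τ = |t| and D = |t^N|+|t|². The multiplier P₁ controls sD directly, and
because τ² ≤ D it also controls (√s τ)²; P₂ controls rτ. The powers of T account for the 1 in 1+s
and in 1+r+√s. -/
theorem anisotropic_products {r s σ τ D T P₁ P₂ : ℝ} (hr : 0 ≤ r) (hs : 0 ≤ s) (hσ0 : 0 ≤ σ)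
    (hσs : σ ^ 2 = s) (hτ0 : 0 < τ) (hT : T = 1 + τ) (hD0 : 0 < D) (hDT : D ≤ T ^ 2)
    (hτD : τ ^ 2 ≤ D) (hP1 : 1 + s ^ 2 * D ^ 2 ≤ P₁) (hP2 : 1 + r ^ 2 * τ ^ 2 ≤ P₂) :
    (1 + (1 + s) * D) ^ 2 ≤ 8 * T ^ 4 * P₁ ∧
      (1 + (1 + r + σ) * τ) ^ 4 ≤ 32 * T ^ 4 * P₂ ^ 2 * P₁ := by
  have hT1 : 1 ≤ T := by linarith
  have hP10 : 0 < P₁ := lt_of_lt_of_le (by positivity) hP1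
  have hP20 : 0 < P₂ := lt_of_lt_of_le (by positivity) hP2
  have hsD : (1 + s * D) ^ 2 ≤ 2 * P₁ := by
    nlinarith [sq_nonneg (1 - s * D)]
  have hU : (1 + (1 + s) * D) ^ 2 ≤ 8 * T ^ 4 * P₁ := by
    have h1 : 1 + (1 + s) * D ≤ 2 * T ^ 2 * (1 + s * D) := by
      have h2 : 0 ≤ s * D := by positivity
      have h3 : 1 + D ≤ 2 * T ^ 2 := by nlinarith
      have h4 := mul_le_mul_of_nonneg_right h3 (by linarith : 0 ≤ 1 + s * D)
      have h5 := mul_nonneg hD0.le h2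
      linarith
    calc (1 + (1 + s) * D) ^ 2 ≤ (2 * T ^ 2 * (1 + s * D)) ^ 2 := by gcongr
      _ = 4 * T ^ 4 * (1 + s * D) ^ 2 := by ring
      _ ≤ 4 * T ^ 4 * (2 * P₁) := by gcongr
      _ = _ := by ring
  have hV : (1 + (1 + r + σ) * τ) ^ 4 ≤ 32 * T ^ 4 * P₂ ^ 2 * P₁ := by
    have h1 : 1 + (1 + r + σ) * τ ≤ T * (1 + r * τ) * (1 + σ * τ) := by
      have h2 : 0 ≤ r * τ := by positivity
      have h3 : 0 ≤ σ * τ := by positivity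
      have h4 : 0 ≤ (r * τ) * (σ * τ) := by positivity
      have : T * (1 + r * τ) * (1 + σ * τ) = (1 + τ) * (1 + r * τ + σ * τ + (r * τ) * (σ * τ)) := by
        rw [hT]; ring
      rw [this]; nlinarith
    have h2 : (1 + r * τ) ^ 2 ≤ 2 * P₂ := by nlinarith [sq_nonneg (1 - r * τ)]
    have h3 : (1 + σ * τ) ^ 2 ≤ 2 * (1 + s * D) := by
      have : σ ^ 2 * τ ^ 2 ≤ s * D := by rw [hσs]; gcongr
      nlinarith [sq_nonneg (1 - σ * τ)]
    calc (1 + (1 + r + σ) * τ) ^ 4 ≤ (T * (1 + r * τ) * (1 + σ * τ)) ^ 4 := by gcongr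
      _ = T ^ 4 * ((1 + r * τ) ^ 2) ^ 2 * ((1 + σ * τ) ^ 2) ^ 2 := by ring
      _ ≤ T ^ 4 * (2 * P₂) ^ 2 * (2 * (1 + s * D)) ^ 2 := by gcongr
      _ = T ^ 4 * (2 * P₂) ^ 2 * (4 * (1 + s * D) ^ 2) := by ring
      _ ≤ T ^ 4 * (2 * P₂) ^ 2 * (4 * (2 * P₁)) := by gcongr
      _ = _ := by ring
  exact ⟨hU, hV⟩

/-- The steps U ≤ U² and V ≤ V⁴ are wasteful but harmless, since the number of integrations by parts
is free. -/
theorem anisotropic_powers {U V T P₁ P₂ : ℝ} (hU1 : 1 ≤ U) (hV1 : 1 ≤ V) (hP10 : 0 < P₁)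
    (hP20 : 0 < P₂) (hT : 0 < T) (hU : U ^ 2 ≤ 8 * T ^ 4 * P₁) (hV : V ^ 4 ≤ 32 * T ^ 4 * P₂ ^ 2 * P₁)
    (κ κ' : ℕ) :
    (T ^ (4 * κ + 4 * κ'))⁻¹ * (P₁ ^ (κ + κ'))⁻¹ * (P₂ ^ (2 * κ'))⁻¹ ≤
      (8 ^ κ * 32 ^ κ') * ((U ^ κ)⁻¹ * (V ^ κ')⁻¹) := by
  have key : U ^ κ * V ^ κ' ≤ (8 ^ κ * 32 ^ κ') *
      (T ^ (4 * κ + 4 * κ') * P₁ ^ (κ + κ') * P₂ ^ (2 * κ')) := by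
    calc U ^ κ * V ^ κ' ≤ (U ^ 2) ^ κ * (V ^ 4) ^ κ' := by
          gcongr
          · exact le_self_pow₀ hU1 (by norm_num)
          · exact le_self_pow₀ hV1 (by norm_num)
      _ ≤ (8 * T ^ 4 * P₁) ^ κ * (32 * T ^ 4 * P₂ ^ 2 * P₁) ^ κ' := by gcongr
      _ = _ := by simp only [mul_pow, pow_add, pow_mul]; ring
  have hU0 : 0 < U := by linarith
  have hV0 : 0 < V := by linarith
  rw [← mul_inv, ← mul_inv, ← mul_inv, ← div_eq_mul_inv, le_div_iff₀ (by positivity),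
    inv_mul_le_iff₀ (by positivity), mul_comm]
  linarith

/-- The weight, improved by j and l integrations by parts, splits into a function of t^N at scale
(1+s)⁻¹ times one of t' at scale (1+r+√s)⁻¹. The two coordinates separate because |t'| ≤ |t| and
|t^N| ≤ |t^N|+|t|². -/
theorem wt_le_dom (hd : 1 ≤ d) {a b : ℝ} (ha : a < d) (hb : b < 1) :
    ∃ (M j l : ℕ) (C a₀ b₀ : ℝ), 0 ≤ C ∧ 0 < a₀ ∧ a₀ < d ∧ 0 < b₀ ∧ b₀ < 1 ∧
      ∀ r s : ℝ, 0 ≤ r → 0 ≤ s → ∀ t : RN d, (split t).1 ≠ 0 → (split t).2 ≠ 0 →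
        wt a b M t * (ell₁ s t ^ j)⁻¹ * (ell₂ r t ^ l)⁻¹ ≤
          C * ((1 + r + √s) ^ (a - a₀) * (1 + s) ^ (b - b₀) *
            dom a₀ b₀ (1 + r + √s) (1 + s) t) := by
  have hd0 : (0 : ℝ) < d := by exact_mod_cast hd
  -- The exponents are raised to a₀ = max(a, d/2) and b₀ = max(b, 1/2), which lie strictly between 0
  -- and the dimensions d and 1. Then κ and κ' are the numbers of powers of U and V needed to pay
  -- for this and to keep 1 and d powers of decay.
  obtain ⟨κ, hκ⟩ := exists_nat_ge (max b (1 / 2) - b + (1 : ℕ))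
  obtain ⟨κ', hκ'⟩ := exists_nat_ge (max a (d / 2) - a + d)
  refine ⟨4 * κ + 4 * κ', κ + κ', 2 * κ', 8 ^ κ * 32 ^ κ', max a (d / 2), max b (1 / 2),
    by positivity, lt_max_of_lt_right (by positivity), max_lt ha (by linarith),
    lt_max_of_lt_right (by norm_num), max_lt hb (by norm_num), fun r s hr hs t ht1 ht2 => ?_⟩
  have ht0 : t ≠ 0 := by
    rintro rfl; exact ht1 (by simp [split])
  set T := 1 + ‖t‖ with hT
  set τ := ‖t‖ with hτ
  set D := aniso t with hD
  have hτ0 : 0 < τ := norm_pos_iff.2 ht0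
  have hD0 : 0 < D := aniso_pos ht0
  set σ := √s with hσ
  have hσ0 : 0 ≤ σ := Real.sqrt_nonneg s
  have hσs : σ ^ 2 = s := Real.sq_sqrt hs
  have hQ := aniso_sq_le t
  have hpi := one_le_two_pi_sq
  have hP1 : 1 + s ^ 2 * D ^ 2 ≤ ell₁ s t := by
    unfold ell₁
    have h1 : 0 ≤ quart t := by unfold quart; positivity
    have h2 : s ^ 2 * D ^ 2 ≤ s ^ 2 * (2 * quart t) := by gcongr
    have h3 : 0 ≤ s ^ 2 * quart t := by positivity
    nlinarith
  have hP2 : 1 + r ^ 2 * τ ^ 2 ≤ ell₂ r t := by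
    unfold ell₂
    have h3 : 0 ≤ r ^ 2 * τ ^ 2 := by positivity
    nlinarith
  have hP10 : 0 < ell₁ s t := lt_of_lt_of_le (by positivity) hP1
  have hP20 : 0 < ell₂ r t := lt_of_lt_of_le (by positivity) hP2
  have hDT : D ≤ T ^ 2 := aniso_le_sq t
  have hτD : τ ^ 2 ≤ D := by
    rw [hD]; unfold aniso; linarith [abs_nonneg (t (Fin.last d))]
  have hT1 : 1 ≤ T := by linarith
  obtain ⟨hU, hV⟩ := anisotropic_products hr hs hσ0 hσs hτ0 hT hD0 hDT hτD hP1 hP2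
  set U := 1 + (1 + s) * D with hUdef
  set V := 1 + (1 + r + σ) * τ with hVdef
  have hU1 : 1 ≤ U := by rw [hUdef]; have : 0 ≤ (1 + s) * D := by positivity
                         linarith
  have hV1 : 1 ≤ V := by rw [hVdef]; have : 0 ≤ (1 + r + σ) * τ := by positivity
                         linarith
  have hU0 : 0 < U := by linarith
  have hV0 : 0 < V := by linarith
  have key' := anisotropic_powers hU1 hV1 hP10 hP20 (by linarith) hU hV κ κ'
  have b1 := rpow_mul_inv_le_bump (a := a) (a₀ := max a (d / 2)) (R := 1 + r + σ) (τ := τ)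
    (r := ‖(split t).2‖) (n := d) (K := κ') (le_max_left _ _)
    (lt_max_of_lt_right (by positivity)) (by positivity) (norm_pos_iff.2 ht2)
    ((pi_norm_le_iff_of_nonneg hτ0.le).2 fun i => abs_coord_le_norm t _) hκ'
  have b2 := rpow_mul_inv_le_bump (a := b) (a₀ := max b (1 / 2)) (R := 1 + s) (τ := D)
    (r := ‖(split t).1‖) (n := 1) (K := κ) (le_max_left _ _)
    (lt_max_of_lt_right (by positivity)) (by positivity) (norm_pos_iff.2 ht1)
    (by rw [hD]; unfold aniso split; rw [Real.norm_eq_abs]; nlinarith [sq_nonneg ‖t‖]) hκ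
  have hb0 : 0 ≤ (1 + r + σ) ^ (a - max a (d / 2)) *
      bump (max a (d / 2)) d (1 + r + σ) ‖(split t).2‖ := le_trans (by positivity) b1
  calc wt a b (4 * κ + 4 * κ') t * (ell₁ s t ^ (κ + κ'))⁻¹ * (ell₂ r t ^ (2 * κ'))⁻¹
      = (τ ^ (-a) * D ^ (-b)) * ((T ^ (4 * κ + 4 * κ'))⁻¹ * (ell₁ s t ^ (κ + κ'))⁻¹ *
        (ell₂ r t ^ (2 * κ'))⁻¹) := by rw [wt]; ring
    _ ≤ (τ ^ (-a) * D ^ (-b)) * ((8 ^ κ * 32 ^ κ') * ((U ^ κ)⁻¹ * (V ^ κ')⁻¹)) := by gcongr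
    _ = (8 ^ κ * 32 ^ κ') * ((τ ^ (-a) * (V ^ κ')⁻¹) * (D ^ (-b) * (U ^ κ)⁻¹)) := by ring
    _ ≤ (8 ^ κ * 32 ^ κ') * (((1 + r + σ) ^ (a - max a (d / 2)) *
          bump (max a (d / 2)) d (1 + r + σ) ‖(split t).2‖) *
          ((1 + s) ^ (b - max b (1 / 2)) * bump (max b (1 / 2)) 1 (1 + s) ‖(split t).1‖)) := by
        gcongr
    _ = _ := by rw [dom]; ring

theorem ae_split_ne (hd : 1 ≤ d) : ∀ᵐ t : RN d, (split t).1 ≠ 0 ∧ (split t).2 ≠ 0 := by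
  have : Nonempty (Fin d) := ⟨⟨0, hd⟩⟩
  have h : ∀ᵐ p : ℝ × (Fin d → ℝ), p.1 ≠ 0 ∧ p.2 ≠ 0 := by
    have h1 : ∀ᵐ y : ℝ, y ≠ 0 := Measure.ae_ne volume 0
    have h2 : ∀ᵐ y : Fin d → ℝ, y ≠ 0 := Measure.ae_ne volume 0
    rw [Measure.volume_eq_prod]
    exact (Measure.quasiMeasurePreserving_fst.ae h1).and (Measure.quasiMeasurePreserving_snd.ae h2)
  exact measurePreserving_split.quasiMeasurePreserving.ae h

/-- A weight is integrable if it decays fast enough at infinity. -/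
theorem exists_integrable_bound (hd : 1 ≤ d) {a b : ℝ} (ha : a < d) (hb : b < 1) :
    ∃ (M : ℕ) (g : RN d → ℝ), Integrable g ∧ ∀ᵐ t, wt a b M t ≤ g t := by
  obtain ⟨M, j, l, C, a₀, b₀, hC, ha₀, ha₀', hb₀, hb₀', h⟩ := wt_le_dom hd ha hb
  obtain ⟨C', hC'⟩ := integral_dom hd ha₀ ha₀' hb₀ hb₀'
  refine ⟨M, fun t => C * dom a₀ b₀ 1 1 t, (hC' 1 1 one_pos one_pos).1.const_mul C, ?_⟩
  filter_upwards [ae_split_ne hd] with t ht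
  have := h 0 0 le_rfl le_rfl t ht.1 ht.2
  simpa [ell₁, ell₂] using this

/-! ### Gaining decay in the frequency by integration by parts. -/

/-- Estimates with weight `ρ` and rapid decay at infinity. -/
def Rap (ρ : ι → RN d → ℝ) (G : ι → RN d × RN d → ℂ) : Prop :=
  ∀ M : ℕ, Cl (fun i t => ρ i t * ((1 + ‖t‖) ^ M)⁻¹) G

theorem Rap.mono {ρ ρ' : ι → RN d → ℝ} {G : ι → RN d × RN d → ℂ} (h : Rap ρ G) {c : ℝ} {P : ℕ}
    (hc : 0 ≤ c) (hρ : ∀ i t, t ≠ 0 → ρ i t ≤ c * (1 + ‖t‖) ^ P * ρ' i t) : Rap ρ' G := by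
  intro M
  refine (h (M + P)).mono hc fun i t ht => ?_
  have h0 : 0 < 1 + ‖t‖ := by positivity
  rw [pow_add, mul_inv]
  calc ρ i t * (((1 + ‖t‖) ^ M)⁻¹ * ((1 + ‖t‖) ^ P)⁻¹)
      ≤ (c * (1 + ‖t‖) ^ P * ρ' i t) * (((1 + ‖t‖) ^ M)⁻¹ * ((1 + ‖t‖) ^ P)⁻¹) :=
        mul_le_mul_of_nonneg_right (hρ i t ht) (by positivity)
    _ = c * (ρ' i t * ((1 + ‖t‖) ^ M)⁻¹) := by field_simp

protected theorem Rap.add {ρ : ι → RN d → ℝ} {F G : ι → RN d × RN d → ℂ} (hF : Rap ρ F)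
    (hG : Rap ρ G) : Rap ρ (F + G) := fun M => (hF M).add (hG M)

theorem Rap.neg {ρ : ι → RN d → ℝ} {F : ι → RN d × RN d → ℂ} (hF : Rap ρ F) : Rap ρ (-F) :=
  fun M => (hF M).neg

theorem Rap.sum {κ : Type*} (s : Finset κ) {ρ : ι → RN d → ℝ} {F : κ → ι → RN d × RN d → ℂ}
    (h : ∀ k ∈ s, Rap ρ (F k)) : Rap ρ (∑ k ∈ s, F k) := fun M => Cl.sum s fun k hk => h k hk M

protected theorem Rap.mul {ρ ρ' : ι → RN d → ℝ} {F G : ι → RN d × RN d → ℂ} (hF : Cl ρ F)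
    (hG : Rap ρ' G) : Rap (fun i t => ρ i t * ρ' i t) (F * G) := fun M =>
  (hF.mul (hG M)).mono zero_le_one fun i t _ => le_of_eq (by ring)

protected theorem Rap.der {ρ : ι → RN d → ℝ} {F : ι → RN d × RN d → ℂ} (hF : Rap ρ F)
    (v : Letter d) : Rap (fun i t => ρ i t * cost v t) (der v F) := fun M =>
  ((hF M).der v).mono zero_le_one fun i t _ => le_of_eq (by ring)

theorem Rap.sm {ρ : ι → RN d → ℝ} {F : ι → RN d × RN d → ℂ} (hF : Rap ρ F) : Sm F := (hF 0).1

theorem aestronglyMeasurable_slice {F : RN d × RN d → ℂ} (hF : ContDiffOn ℝ ∞ F (punctured d))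
    (x : RN d) : AEStronglyMeasurable fun t => F (x, t) :=
  (measurable_of_continuousOn_compl_singleton 0 (continuousOn_slice hF x)).aestronglyMeasurable

theorem Rap.integrable {ρ : ι → RN d → ℝ} {F : ι → RN d × RN d → ℂ} (hF : Rap ρ F) {M : ℕ}
    {g : RN d → ℝ} (hg : Integrable g)
    (hρ : ∀ i, ∀ᵐ t, ρ i t * ((1 + ‖t‖) ^ M)⁻¹ ≤ g t) (i : ι) (x : RN d) :
    Integrable fun t => F i (x, t) := by
  obtain ⟨C, h0, hC⟩ := (hF M).2 []
  refine Integrable.mono' (hg.const_mul C) (aestronglyMeasurable_slice (hF.sm i) x) ?_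
  filter_upwards [hρ i, Measure.ae_ne volume (0 : RN d)] with t h1 h2
  exact (hC i x t h2).trans (mul_le_mul_of_nonneg_left h1 h0)

/-- One integration by parts: the weight improves by the factor `(1 + 4π² s(η) q(t))⁻¹`. -/
theorem Rap.improve (hd : 1 ≤ d) {ρ : RN d → RN d → ℝ} (hρ0 : ∀ η t, t ≠ 0 → 0 ≤ ρ η t) {M₀ : ℕ}
    {g : RN d → ℝ} (hg : Integrable g)
    (hρ : ∀ η, ∀ᵐ t, ρ η t * ((1 + ‖t‖) ^ M₀)⁻¹ ≤ g t)
    {q : RN d → ℝ} (hq0 : ∀ t, 0 ≤ q t)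
    (hq : Cl (fun (_ : RN d) t => q t) (fun _ p => ((q p.2 : ℝ) : ℂ)))
    (J : Finset (Fin (d + 1))) {P : ℕ}
    (hJ : ∀ j ∈ J, ∀ t, t ≠ 0 →
      q t * cost (Sum.inr j) t * cost (Sum.inr j) t ≤ (1 + ‖t‖) ^ P)
    {s : RN d → ℝ} (hs : ∀ η, s η = ∑ j ∈ J, (η j) ^ 2)
    {G : RN d → RN d × RN d → ℂ} (hG : Rap ρ G) :
    ∃ G' : RN d → RN d × RN d → ℂ,
      Rap (fun η t => ρ η t * (1 + 4 * Real.pi ^ 2 * s η * q t)⁻¹) G' ∧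
      ∀ x η, ∫ t, G η (x, t) * ex η t = ∫ t, G' η (x, t) * ex η t := by
  have hs0 : ∀ η, 0 ≤ s η := fun η => by rw [hs]; positivity
  set p : RN d → RN d → ℝ := fun η t => 1 + 4 * Real.pi ^ 2 * s η * q t with hp
  have hp1 : ∀ η t, 1 ≤ p η t := fun η t => by
    have := hs0 η
    have := hq0 t
    rw [hp]; simp only [le_add_iff_nonneg_right]; positivity
  have hpc : Cl p (fun η r => ((p η r.2 : ℝ) : ℂ)) := by
    have c1 := (cl_const (d := d) (fun _ : RN d => (1 : ℂ))).mono (ρ' := p) zero_le_one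
      fun η t _ => by simpa using hp1 η t
    have c2 := ((cl_const (d := d)
      (fun η : RN d => ((4 * Real.pi ^ 2 * s η : ℝ) : ℂ))).mul hq).mono (ρ' := p) zero_le_one
      fun η t _ => by
        have := hs0 η
        rw [Complex.norm_real, Real.norm_of_nonneg (by positivity), hp]; simp
    exact (c1.add c2).congr fun η r _ => by simp [hp]
  set f : RN d → RN d × RN d → ℂ := fun η r => ((p η r.2 : ℝ) : ℂ)⁻¹ with hf
  have hfc : Cl (fun η t => (p η t)⁻¹) f := hpc.inv
    (fun η t _ => lt_of_lt_of_le one_pos (hp1 η t))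
    (fun η x t _ => by simp [abs_of_pos (lt_of_lt_of_le one_pos (hp1 η t))])
  set H : RN d → RN d × RN d → ℂ := (fun _ r => ((q r.2 : ℝ) : ℂ)) * (f * G) with hH
  set ρ' : RN d → RN d → ℝ := fun η t => ρ η t * (p η t)⁻¹ with hρ'
  have hρ'0 : ∀ η t, t ≠ 0 → 0 ≤ ρ' η t := fun η t ht =>
    mul_nonneg (hρ0 η t ht) (inv_nonneg.2 (zero_le_one.trans (hp1 η t)))
  have hle : ∀ η, ∀ᵐ t, ρ' η t * ((1 + ‖t‖) ^ M₀)⁻¹ ≤ g t := by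
    intro η
    filter_upwards [hρ η, Measure.ae_ne volume (0 : RN d)] with t h1 h2
    refine le_trans (mul_le_mul_of_nonneg_right ?_ (by positivity)) h1
    exact mul_le_of_le_one_right (hρ0 η t h2) (inv_le_one_of_one_le₀ (hp1 η t))
  have hfG : Rap ρ' (f * G) := (Rap.mul hfc hG).mono (P := 0) zero_le_one
    fun η t _ => le_of_eq (by simp [hρ', mul_comm])
  have hH0 : Rap (fun η t => q t * ρ' η t) H := Rap.mul hq hfG
  have hJ0 : ∀ j ∈ J, Rap ρ' H := fun j hj => hH0.mono zero_le_one fun η t ht => by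
    have h1 := one_le_cost (Sum.inr j) ht
    have h2 := hJ j hj t ht
    have h3 := hq0 t
    rw [one_mul]
    refine mul_le_mul_of_nonneg_right (le_trans ?_ h2) (hρ'0 η t ht)
    exact (le_mul_of_one_le_right h3 h1).trans (le_mul_of_one_le_right (by positivity) h1)
  have hJ1 : ∀ j ∈ J, Rap ρ' (der (Sum.inr j) H) := fun j hj =>
    (hH0.der (Sum.inr j)).mono zero_le_one fun η t ht => by
    have h1 := one_le_cost (Sum.inr j) ht
    have h2 := hJ j hj t ht
    have h3 := hq0 t
    rw [one_mul, mul_right_comm]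
    refine mul_le_mul_of_nonneg_right (le_trans ?_ h2) (hρ'0 η t ht)
    exact le_mul_of_one_le_right (by positivity) h1
  have hJ2 : ∀ j ∈ J, Rap ρ' (der (Sum.inr j) (der (Sum.inr j) H)) := fun j hj =>
    ((hH0.der (Sum.inr j)).der (Sum.inr j)).mono zero_le_one fun η t ht => by
    have h2 := hJ j hj t ht
    rw [one_mul, mul_right_comm (q t), mul_right_comm]
    exact mul_le_mul_of_nonneg_right h2 (hρ'0 η t ht)
  -- With p = 1 + 4π² s q and f = 1/p, one has G = fG + 4π² s H for H = q f G. Summing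
  -- `integral_second_deriv` over J turns 4π² s times the transform of H into minus the transform of
  -- Σ ∂_j² H. The factor q pays for the two derivatives, so the new amplitude has weight ρ/p up to
  -- powers of 1+|t|.
  refine ⟨f * G + -∑ j ∈ J, der (Sum.inr j) (der (Sum.inr j) H),
    hfG.add (Rap.sum J hJ2).neg, fun x η => ?_⟩
  have i0 := Integrable.mul_ex (hfG.integrable hg hle η x) η
  have i2 : ∀ j ∈ J, Integrable fun t =>
      der (Sum.inr j) (der (Sum.inr j) H) η (x, t) * ex η t := fun j hj =>
    Integrable.mul_ex ((hJ2 j hj).integrable hg hle η x) η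
  have hby : ∀ j ∈ J, ∫ t, der (Sum.inr j) (der (Sum.inr j) H) η (x, t) * ex η t =
      -(4 * Real.pi ^ 2 * (η j) ^ 2 * ∫ t, H η (x, t) * ex η t) := fun j hj =>
    integral_second_deriv hd (hH0.sm η) x η j ((hJ0 j hj).integrable hg hle η x)
      ((hJ1 j hj).integrable hg hle η x) ((hJ2 j hj).integrable hg hle η x)
  have hsum : ∫ t, (∑ j ∈ J, der (Sum.inr j) (der (Sum.inr j) H) η (x, t) * ex η t) =
      -(4 * Real.pi ^ 2 * s η * ∫ t, H η (x, t) * ex η t) := by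
    rw [integral_finsetSum J i2, Finset.sum_congr rfl hby, hs, Finset.sum_neg_distrib,
      Complex.ofReal_sum, Finset.mul_sum, Finset.sum_mul]
    simp
  have hG' : ∀ t, (f * G + -∑ j ∈ J, der (Sum.inr j) (der (Sum.inr j) H)) η (x, t) * ex η t =
      (f * G) η (x, t) * ex η t -
        ∑ j ∈ J, der (Sum.inr j) (der (Sum.inr j) H) η (x, t) * ex η t := by
    intro t
    simp only [Pi.add_apply, Pi.neg_apply, Finset.sum_apply, add_mul, neg_mul, Finset.sum_mul]
    ring
  simp only [hG']
  rw [integral_sub i0 (integrable_finsetSum J i2), hsum, sub_neg_eq_add, ← integral_const_mul]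
  have hGe : ∀ t, G η (x, t) * ex η t = (f * G) η (x, t) * ex η t +
      4 * Real.pi ^ 2 * s η * (H η (x, t) * ex η t) := by
    intro t
    have hne : ((p η t : ℝ) : ℂ) ≠ 0 := by
      exact_mod_cast (lt_of_lt_of_le one_pos (hp1 η t)).ne'
    have e1 : G η (x, t) = ((p η t : ℝ) : ℂ) * (f η (x, t) * G η (x, t)) := by
      rw [hf]; field_simp
    have e2 : ((p η t : ℝ) : ℂ) = 1 + 4 * Real.pi ^ 2 * s η * q t := by simp [hp]
    simp only [hH, Pi.mul_apply]
    conv_lhs => rw [e1, e2]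
    ring
  simp only [hGe]
  -- Integrability of H comes from some j in J; if J is empty, then s = 0 and the term vanishes.
  by_cases hJe : J.Nonempty
  · obtain ⟨j, hj⟩ := hJe
    rw [integral_add i0 ((Integrable.mul_ex ((hJ0 j hj).integrable hg hle η x) η).const_mul _)]
  · have : s η = 0 := by rw [hs, Finset.not_nonempty_iff_eq_empty.1 hJe]; simp
    simp [this]

theorem Rap.improve_iterate (hd : 1 ≤ d) {ρ : RN d → RN d → ℝ} (hρ0 : ∀ η t, t ≠ 0 → 0 ≤ ρ η t)
    {M₀ : ℕ} {g : RN d → ℝ} (hg : Integrable g)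
    (hρ : ∀ η, ∀ᵐ t, ρ η t * ((1 + ‖t‖) ^ M₀)⁻¹ ≤ g t)
    {q : RN d → ℝ} (hq0 : ∀ t, 0 ≤ q t)
    (hq : Cl (fun (_ : RN d) t => q t) (fun _ p => ((q p.2 : ℝ) : ℂ)))
    (J : Finset (Fin (d + 1))) {P : ℕ}
    (hJ : ∀ j ∈ J, ∀ t, t ≠ 0 →
      q t * cost (Sum.inr j) t * cost (Sum.inr j) t ≤ (1 + ‖t‖) ^ P)
    {s : RN d → ℝ} (hs : ∀ η, s η = ∑ j ∈ J, (η j) ^ 2)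
    {G : RN d → RN d × RN d → ℂ} (hG : Rap ρ G) (n : ℕ) :
    ∃ G' : RN d → RN d × RN d → ℂ,
      Rap (fun η t => ρ η t * ((1 + 4 * Real.pi ^ 2 * s η * q t) ^ n)⁻¹) G' ∧
      ∀ x η, ∫ t, G η (x, t) * ex η t = ∫ t, G' η (x, t) * ex η t := by
  have hs0 : ∀ η, 0 ≤ s η := fun η => by rw [hs]; positivity
  have hp1 : ∀ η t, 1 ≤ 1 + 4 * Real.pi ^ 2 * s η * q t := fun η t => by
    have := hs0 η
    have := hq0 t
    simp only [le_add_iff_nonneg_right]; positivity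
  induction n with
  | zero => exact ⟨G, hG.mono (P := 0) zero_le_one (by simp), fun _ _ => rfl⟩
  | succ n ih =>
    obtain ⟨G', h1, h2⟩ := ih
    have hn : ∀ η t, 0 < (1 + 4 * Real.pi ^ 2 * s η * q t) ^ n := fun η t =>
      pow_pos (lt_of_lt_of_le one_pos (hp1 η t)) n
    obtain ⟨G'', h3, h4⟩ := Rap.improve hd
      (fun η t ht => mul_nonneg (hρ0 η t ht) (inv_nonneg.2 (hn η t).le)) hg (M₀ := M₀) (fun η => by
        filter_upwards [hρ η, Measure.ae_ne volume (0 : RN d)] with t h1 h2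
        refine le_trans (mul_le_mul_of_nonneg_right ?_ (by positivity)) h1
        exact mul_le_of_le_one_right (hρ0 η t h2)
          (inv_le_one_of_one_le₀ (one_le_pow₀ (hp1 η t)))) hq0 hq J hJ hs h1
    refine ⟨G'', h3.mono (P := 0) zero_le_one fun η t _ => le_of_eq ?_,
      fun x η => (h2 x η).trans (h4 x η)⟩
    rw [pow_succ (_ + _) n, mul_inv]; simp [mul_assoc]

theorem cl_norm_sq : Cl (fun (_ : ι) (t : RN d) => ‖t‖ ^ 2) (fun _ p => ((‖p.2‖ ^ 2 : ℝ) : ℂ)) := by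
  refine (Cl.sum Finset.univ fun j _ => ((cl_coord j).mul (cl_coord j)).mono
    (ρ' := fun (_ : ι) (t : RN d) => ‖t‖ ^ 2) zero_le_one fun _ t _ => by
      rw [one_mul, sq]).congr fun i p _ => ?_
  rw [EuclideanSpace.real_norm_sq_eq]
  simp [Finset.sum_apply, sq]

theorem cl_quart : Cl (fun (_ : ι) (t : RN d) => quart t) (fun _ p => ((quart p.2 : ℝ) : ℂ)) := by
  have h1 := (cl_coord_last (d := d) (ι := ι)).mul cl_coord_last
  have h2 := (cl_norm_sq (d := d) (ι := ι)).mul cl_norm_sq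
  have h3 := h1.mono (ρ' := fun (_ : ι) (t : RN d) => quart t) zero_le_two fun _ t _ => by
    have := aniso_sq_le t
    rw [sq] at this; exact this
  have h4 := h2.mono (ρ' := fun (_ : ι) (t : RN d) => quart t) zero_le_one fun _ t _ => by
    unfold quart
    nlinarith [sq_nonneg (t (Fin.last d))]
  exact (h3.add h4).congr fun i p _ => by simp [quart, sq]

/-- The polynomial `quart` is comparable to the square of `aniso`, so it pays for two derivatives in
any direction. By contrast |t|² pays only for two derivatives in the first d directions, as in
`norm_sq_mul_cost_le`. -/
theorem quart_mul_cost_le (j : Fin (d + 1)) {t : RN d} (ht : t ≠ 0) :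
    quart t * cost (Sum.inr j) t * cost (Sum.inr j) t ≤ (1 + ‖t‖) ^ 6 := by
  have h0 : 0 < ‖t‖ := norm_pos_iff.2 ht
  have h2 := aniso_pos ht
  have h3 := cost_pos (Sum.inr j) ht
  have h4 : aniso t * cost (Sum.inr j) t ≤ (1 + ‖t‖) ^ 3 := by
    simp only [cost]; rw [← mul_div_assoc]; split_ifs
    · rw [div_le_iff₀ h2, mul_comm]
      exact mul_le_mul_of_nonneg_right (pow_le_pow_right₀ (by linarith) (by norm_num)) h2.le
    · rw [div_le_iff₀ h0]
      nlinarith [mul_le_mul_of_nonneg_right (aniso_le t) (by positivity : 0 ≤ (1 + ‖t‖) ^ 2)]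
  calc _ ≤ aniso t ^ 2 * cost (Sum.inr j) t * cost (Sum.inr j) t := by
        gcongr; exact quart_le t
    _ = (aniso t * cost (Sum.inr j) t) ^ 2 := by ring
    _ ≤ ((1 + ‖t‖) ^ 3) ^ 2 := by gcongr
    _ = _ := by ring

theorem norm_sq_mul_cost_le (i : Fin d) {t : RN d} (ht : t ≠ 0) :
    ‖t‖ ^ 2 * cost (Sum.inr i.castSucc) t * cost (Sum.inr i.castSucc) t ≤ (1 + ‖t‖) ^ 4 := by
  have h0 : 0 < ‖t‖ := norm_pos_iff.2 ht
  simp only [cost, (Fin.castSucc_lt_last i).ne, if_false]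
  apply le_of_eq
  field_simp

/-! ### The partial Fourier transform: size and derivatives. -/

/-- A function on the chart with the estimates of a kernel of order `(a, b)`. -/
def Rapid (a b : ℝ) (G : RN d × RN d → ℂ) : Prop :=
  ∀ M, Cl (fun (_ : RN d) t => wt a b M t) (fun _ => G)

theorem Rapid.rap {a b : ℝ} {G : RN d × RN d → ℂ} (hG : Rapid a b G) :
    Rap (fun (_ : RN d) t => wt a b 0 t) (fun _ => G) := fun M =>
  (hG M).mono zero_le_one fun _ t _ => by
    rw [← wt_add_nat, zero_add, one_mul]

/-- The norm of the first `d` coordinates. -/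
noncomputable def normInit (η : RN d) : ℝ := √(∑ i : Fin d, (η i.castSucc) ^ 2)

/-- The partial Fourier transform. -/
noncomputable def ft (G : RN d × RN d → ℂ) (q : RN d × RN d) : ℂ := ∫ t, G (q.1, t) * ex q.2 t

/-- The central estimate. The amplitude is first improved by integrations by parts, then bounded by
the product majorant, whose integral is computed by scaling. Only a < d and b < 1 are needed, so it
also applies to the lower exponents of derivatives. -/
theorem ft_bound (hd : 1 ≤ d) {a b : ℝ} (ha : a < d) (hb : b < 1) {G : RN d × RN d → ℂ}
    (hG : Rapid a b G) : ∃ C : ℝ, 0 ≤ C ∧ ∀ x η, ‖ft G (x, η)‖ ≤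
      C * ((1 + ‖η‖) ^ (b - 1) * (1 + normInit η + √‖η‖) ^ (a - d)) := by
  obtain ⟨M₀, g, hg, hwg⟩ := exists_integrable_bound hd ha hb
  have hw0 : ∀ t : RN d, wt a b 0 t * ((1 + ‖t‖) ^ M₀)⁻¹ = wt a b M₀ t := fun t => by
    rw [← wt_add_nat, zero_add]
  obtain ⟨M, j, l, C, a₀, b₀, hC, ha₀, ha₀', hb₀, hb₀', hdom⟩ := wt_le_dom hd ha hb
  obtain ⟨C', hC'⟩ := integral_dom hd ha₀ ha₀' hb₀ hb₀'
  -- All coordinate directions with the multiplier `quart`: decay in |η| at the anisotropic scale.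
  obtain ⟨G₁, h1, h1'⟩ := Rap.improve_iterate hd (ρ := fun _ t => wt a b 0 t)
    (fun _ t ht => (wt_pos a b 0 ht).le) hg (M₀ := M₀) (fun _ => by simpa only [hw0] using hwg)
    (q := quart) (fun t => by unfold quart; positivity) cl_quart Finset.univ
    (fun j _ t ht => quart_mul_cost_le j ht) (s := fun η => ‖η‖ ^ 2)
    (fun η => EuclideanSpace.real_norm_sq_eq η) hG.rap j
  have e1 : ∀ η t : RN d, 1 ≤ 1 + 4 * Real.pi ^ 2 * ‖η‖ ^ 2 * quart t := fun η t => by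
    have : 0 ≤ quart t := by unfold quart; positivity
    simp only [le_add_iff_nonneg_right]; positivity
  have hp : ∀ η t : RN d, 0 < (1 + 4 * Real.pi ^ 2 * ‖η‖ ^ 2 * quart t) ^ j := fun η t =>
    pow_pos (lt_of_lt_of_le one_pos (e1 η t)) j
  -- Only the first d directions, with multiplier |t|²: decay in |η'|. The amplitudes now depend on
  -- η, which is why the estimates are stated for families with uniform constants.
  obtain ⟨G₂, h2, h2'⟩ := Rap.improve_iterate hd
    (fun η t ht => mul_nonneg (wt_pos a b 0 ht).le (inv_nonneg.2 (hp η t).le)) hg (M₀ := M₀)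
    (fun η => by
      filter_upwards [hwg, Measure.ae_ne volume (0 : RN d)] with t h1 h2
      rw [← hw0] at h1
      refine le_trans (mul_le_mul_of_nonneg_right ?_ (by positivity)) h1
      exact mul_le_of_le_one_right (wt_pos a b 0 h2).le
        (inv_le_one_of_one_le₀ (one_le_pow₀ (e1 η t))))
    (q := fun t => ‖t‖ ^ 2) (fun t => by positivity) cl_norm_sq
    (Finset.univ.map Fin.castSuccEmb)
    (fun j hj t ht => by
      obtain ⟨i, _, rfl⟩ := Finset.mem_map.1 hj
      exact norm_sq_mul_cost_le i ht) (s := fun η => normInit η ^ 2)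
    (fun η => by
      rw [normInit, Real.sq_sqrt (by positivity), Finset.sum_map]; rfl) h1 l
  obtain ⟨C₂, hC₂, hb2⟩ := (h2 M).2 []
  refine ⟨C₂ * C * |C'|, by positivity, fun x η => ?_⟩
  set R := 1 + normInit η + √‖η‖ with hR
  set S := 1 + ‖η‖ with hS
  have hr0 : 0 ≤ normInit η := Real.sqrt_nonneg _
  have hR0 : 0 < R := by positivity
  have hS0 : 0 < S := by positivity
  obtain ⟨hint, hval⟩ := hC' R S hR0 hS0
  have hpt : ∀ᵐ t, ‖G₂ η (x, t) * ex η t‖ ≤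
      C₂ * (C * (R ^ (a - a₀) * S ^ (b - b₀) * dom a₀ b₀ R S t)) := by
    filter_upwards [ae_split_ne hd, Measure.ae_ne volume (0 : RN d)] with t ht ht0
    rw [norm_mul, norm_ex, mul_one]
    refine (hb2 η x t ht0).trans (mul_le_mul_of_nonneg_left ?_ hC₂)
    refine le_trans (le_of_eq ?_) (hdom _ _ hr0 (norm_nonneg η) t ht.1 ht.2)
    have : wt a b M t = wt a b 0 t * ((1 + ‖t‖) ^ M)⁻¹ := by rw [← wt_add_nat, zero_add]
    rw [this, ell₁, ell₂]; ring
  have hfin : ‖ft G (x, η)‖ ≤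
      ∫ t : RN d, C₂ * (C * (R ^ (a - a₀) * S ^ (b - b₀) * dom a₀ b₀ R S t)) := by
    have : ft G (x, η) = ∫ t, G₂ η (x, t) * ex η t := (h1' x η).trans (h2' x η)
    rw [this]
    exact norm_integral_le_of_norm_le (((hint.const_mul _).const_mul C).const_mul C₂) hpt
  refine hfin.trans ?_
  rw [integral_const_mul, integral_const_mul, integral_const_mul, hval]
  have e2 : R ^ (a - d) = R ^ (a - a₀) * R ^ (a₀ - d) := by
    rw [← Real.rpow_add hR0]; congr 1; ring
  have e3 : S ^ (b - 1) = S ^ (b - b₀) * S ^ (b₀ - 1) := by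
    rw [← Real.rpow_add hS0]; congr 1; ring
  rw [e2, e3]
  calc _ = C₂ * C * C' * ((S ^ (b - b₀) * S ^ (b₀ - 1)) * (R ^ (a - a₀) * R ^ (a₀ - d))) := by ring
    _ ≤ _ := by gcongr; exact le_abs_self C'

theorem Rapid.contDiffOn {a b : ℝ} {G : RN d × RN d → ℂ} (hG : Rapid a b G) :
    ContDiffOn ℝ ∞ G (punctured d) := (hG 0).1 0

theorem Rapid.partial_inl {a b : ℝ} {G : RN d × RN d → ℂ} (hG : Rapid a b G) (i : Fin (d + 1)) :
    Rapid a b (along (anyPartial (Sum.inl i)) G) := fun M =>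
  -- The two extra powers of decay pay exactly the cost (1+|t|)² of an x-derivative.
  ((hG (M + 2)).der (Sum.inl i)).mono zero_le_one fun _ t ht => by
    rw [wt_add_nat, cost, mul_assoc, inv_mul_cancel₀ (by positivity), one_mul, mul_one]

theorem Rapid.cb_mul {a b : ℝ} {G : RN d × RN d → ℂ} (hG : Rapid a b G) {c : RN d → ℂ}
    (hc : Cb c) : Rapid a b (fun p => c p.1 * G p) := fun M =>
  ((cl_fst hc).mul (hG M)).mono zero_le_one fun _ t _ => le_of_eq (by ring)

theorem Rapid.const_mul {a b : ℝ} {G : RN d × RN d → ℂ} (hG : Rapid a b G) (c : ℂ) :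
    Rapid a b (fun p => c * G p) := hG.cb_mul (cb_const c)

theorem Rapid.sum {κ : Type*} (s : Finset κ) {a b : ℝ} {G : κ → RN d × RN d → ℂ}
    (h : ∀ j ∈ s, Rapid a b (G j)) : Rapid a b (fun p => ∑ j ∈ s, G j p) := fun M =>
  (Cl.sum s fun j hj => h j hj M).congr fun i p _ => by simp [Finset.sum_apply]

theorem Rapid.coord_mul {a b : ℝ} {G : RN d × RN d → ℂ} (hG : Rapid a b G) (j : Fin (d + 1)) :
    Rapid (a - 1) b (fun p => ((p.2 j : ℝ) : ℂ) * G p) := fun M =>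
  ((cl_coord j).mul (hG M)).mono zero_le_one fun _ t ht => by
    have h0 : 0 < ‖t‖ := norm_pos_iff.2 ht
    have h := wt_add_left (a - 1) b M 1 ht
    rw [Nat.cast_one, sub_add_cancel, pow_one] at h
    rw [h, one_mul]; apply le_of_eq; field_simp

theorem Rapid.last_mul {a b : ℝ} {G : RN d × RN d → ℂ} (hG : Rapid a b G) :
    Rapid a (b - 1) (fun p => ((p.2 (Fin.last d) : ℝ) : ℂ) * G p) := fun M =>
  (cl_coord_last.mul (hG M)).mono zero_le_one fun _ t ht => by
    have h0 := aniso_pos ht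
    have h := wt_add_right a (b - 1) M 1 ht
    rw [Nat.cast_one, sub_add_cancel, pow_one] at h
    rw [h, one_mul]; apply le_of_eq; field_simp

theorem Rapid.exists_bound (hd : 1 ≤ d) {a b : ℝ} (ha : a < d) (hb : b < 1)
    {G : RN d × RN d → ℂ} (hG : Rapid a b G) :
    ∃ g : RN d → ℝ, Integrable g ∧ ∀ᵐ t, ∀ x, ‖G (x, t)‖ ≤ g t := by
  obtain ⟨M, g, hg, h⟩ := exists_integrable_bound hd ha hb
  obtain ⟨C, h0, hC⟩ := (hG M).2 []
  refine ⟨fun t => C * g t, hg.const_mul C, ?_⟩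
  filter_upwards [h, Measure.ae_ne volume (0 : RN d)] with t h1 h2 x
  exact (hC 0 x t h2).trans (mul_le_mul_of_nonneg_left h1 h0)

theorem Rapid.integrable (hd : 1 ≤ d) {a b : ℝ} (ha : a < d) (hb : b < 1)
    {G : RN d × RN d → ℂ} (hG : Rapid a b G) (x : RN d) : Integrable fun t => G (x, t) := by
  obtain ⟨g, hg, h⟩ := hG.exists_bound hd ha hb
  exact Integrable.mono' hg (aestronglyMeasurable_slice hG.contDiffOn x) (h.mono fun t ht => ht x)

/-- The coordinates of a pair as complex-valued functionals. -/
noncomputable def coordFst (i : Fin (d + 1)) : RN d × RN d →L[ℝ] ℂ :=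
  Complex.ofRealCLM.comp ((EuclideanSpace.proj (𝕜 := ℝ) i).comp (ContinuousLinearMap.fst ℝ _ _))

/-- The coordinates of a pair as complex-valued functionals. -/
noncomputable def coordSnd (i : Fin (d + 1)) : RN d × RN d →L[ℝ] ℂ :=
  Complex.ofRealCLM.comp ((EuclideanSpace.proj (𝕜 := ℝ) i).comp (ContinuousLinearMap.snd ℝ _ _))

theorem eq_sum_e (v : RN d) : v = ∑ j, v j • (e j : RN d) := by
  ext l; simp [e, Finset.sum_apply, Pi.single_apply]

theorem hasFDerivAt_slice {G : RN d × RN d → ℂ} {q : RN d × RN d} {t : RN d}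
    (hG : DifferentiableAt ℝ G (q.1, t)) :
    HasFDerivAt (fun q : RN d × RN d => G (q.1, t))
      (∑ i, along (anyPartial (Sum.inl i)) G (q.1, t) • coordFst i) q := by
  have h1 : HasFDerivAt (fun q : RN d × RN d => (q.1, t))
      ((ContinuousLinearMap.fst ℝ (RN d) (RN d)).prod (0 : RN d × RN d →L[ℝ] RN d)) q :=
    hasFDerivAt_fst.prodMk (hasFDerivAt_const _ _)
  refine (hG.hasFDerivAt.comp q h1).congr_fderiv ?_
  ext v
  · have : ((v, 0) : RN d × RN d) = ∑ j, v j • ((e j, 0) : RN d × RN d) := by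
      refine Prod.ext ?_ ?_
      · simp only [Prod.fst_sum, Prod.smul_fst]; exact eq_sum_e v
      · simp [Prod.snd_sum]
    have h2 : fderiv ℝ G (q.1, t) (v, 0) = ∑ j, v j • fderiv ℝ G (q.1, t) (e j, 0) := by
      rw [this, map_sum]; simp only [map_smul]
    simpa [coordFst, along, anyPartial, partialFst, mul_comm] using h2
  · simp only [coordFst, ContinuousLinearMap.comp_apply, ContinuousLinearMap.inr_apply,
      ContinuousLinearMap.prod_apply, sum_apply, smul_apply]
    simp
    exact map_zero _

theorem hasFDerivAt_ex (q : RN d × RN d) (t : RN d) :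
    HasFDerivAt (fun q : RN d × RN d => ex q.2 t)
      (∑ j, (-(2 * Real.pi * Complex.I) * t j * ex q.2 t) • coordSnd j) q := by
  have h1 : HasFDerivAt (fun q : RN d × RN d => ((inner ℝ t q.2 : ℝ) : ℂ))
      (Complex.ofRealCLM.comp ((innerSL ℝ t).comp (ContinuousLinearMap.snd ℝ (RN d) (RN d)))) q :=
    (Complex.ofRealCLM.comp
      ((innerSL ℝ t).comp (ContinuousLinearMap.snd ℝ (RN d) (RN d)))).hasFDerivAt
  have h2 := ((h1.const_mul (2 * Real.pi * Complex.I)).neg).cexp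
  refine HasFDerivAt.congr_fderiv h2 ?_
  ext v
  · simp [coordSnd]
  · have h3 : inner ℝ t v = ∑ j, t j * v j := by
      rw [PiLp.inner_apply]; simp [mul_comm]
    simp [coordSnd, h3, Finset.mul_sum, ex]
    exact Finset.sum_congr rfl fun j _ => by ring

/-- The derivative in `q` of the integrand `G(x,t) e^{-2πi t·η}`. -/
noncomputable def ftDeriv (G : RN d × RN d → ℂ) (q : RN d × RN d) (t : RN d) :
    RN d × RN d →L[ℝ] ℂ :=
  (∑ i, (along (anyPartial (Sum.inl i)) G (q.1, t) * ex q.2 t) • coordFst i) +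
    ∑ j, (-(2 * Real.pi * Complex.I) * (((t j : ℝ) : ℂ) * G (q.1, t)) * ex q.2 t) • coordSnd j

theorem hasFDerivAt_ft_integrand {G : RN d × RN d → ℂ} {q : RN d × RN d} {t : RN d}
    (hG : DifferentiableAt ℝ G (q.1, t)) :
    HasFDerivAt (fun q : RN d × RN d => G (q.1, t) * ex q.2 t) (ftDeriv G q t) q := by
  refine ((hasFDerivAt_slice hG).mul (hasFDerivAt_ex q t)).congr_fderiv ?_
  rw [ftDeriv, Finset.smul_sum, Finset.smul_sum]
  simp only [smul_smul]
  refine (add_comm _ _).trans (congrArg₂ _ ?_ ?_)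
  · exact Finset.sum_congr rfl fun i _ => by rw [mul_comm]
  · exact Finset.sum_congr rfl fun i _ => by congr 1; ring

theorem Rapid.twist {a b : ℝ} {G : RN d × RN d → ℂ} (hG : Rapid a b G) (j : Fin (d + 1)) :
    Rapid (a - 1) b (fun p => -(2 * Real.pi * Complex.I) * (((p.2 j : ℝ) : ℂ) * G p)) :=
  (hG.coord_mul j).const_mul _

theorem integral_sum_smul_const {κ E : Type*} [NormedAddCommGroup E] [NormedSpace ℂ E]
    [CompleteSpace E] (s : Finset κ) {f : κ → RN d → ℂ} (hf : ∀ k ∈ s, Integrable (f k))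
    (v : κ → E) :
    Integrable (fun t => ∑ k ∈ s, f k t • v k) ∧
      ∫ t, ∑ k ∈ s, f k t • v k = ∑ k ∈ s, (∫ t, f k t) • v k := by
  have h : ∀ k ∈ s, Integrable fun t => f k t • v k := fun k hk => (hf k hk).smul_const _
  refine ⟨integrable_finsetSum s h, ?_⟩
  rw [integral_finsetSum s h]
  exact Finset.sum_congr rfl fun k _ => integral_smul_const _ _

theorem integral_ftDeriv (hd : 1 ≤ d) {a b : ℝ} (ha : a < d) (hb : b < 1) {G : RN d × RN d → ℂ}
    (hG : Rapid a b G) (q : RN d × RN d) :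
    Integrable (ftDeriv G q) ∧ ∫ t, ftDeriv G q t =
      ∑ i, ft (along (anyPartial (Sum.inl i)) G) q • coordFst i +
      ∑ j, ft (fun p => -(2 * Real.pi * Complex.I) * (((p.2 j : ℝ) : ℂ) * G p)) q •
        coordSnd j := by
  have h1 := integral_sum_smul_const Finset.univ (fun i _ =>
    Integrable.mul_ex ((hG.partial_inl i).integrable hd ha hb q.1) q.2) (coordFst (d := d))
  have h2 := integral_sum_smul_const Finset.univ (fun j _ =>
    Integrable.mul_ex ((hG.twist j).integrable hd (by linarith) hb q.1) q.2) (coordSnd (d := d))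
  exact ⟨h1.1.add h2.1, (integral_add h1.1 h2.1).trans (congrArg₂ _ h1.2 h2.2)⟩

theorem norm_sum_smul_le {κ E : Type*} [NormedAddCommGroup E] [NormedSpace ℂ E] (s : Finset κ)
    {c : κ → ℂ} {g : κ → ℝ} (h : ∀ k, ‖c k‖ ≤ g k) (v : κ → E) :
    ‖∑ k ∈ s, c k • v k‖ ≤ ∑ k ∈ s, g k * ‖v k‖ := by
  refine (norm_sum_le _ _).trans (Finset.sum_le_sum fun i _ => ?_)
  rw [norm_smul]
  exact mul_le_mul_of_nonneg_right (h i) (norm_nonneg _)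

theorem exists_bound_ftDeriv (hd : 1 ≤ d) {a b : ℝ} (ha : a < d) (hb : b < 1)
    {G : RN d × RN d → ℂ} (hG : Rapid a b G) :
    ∃ g : RN d → ℝ, Integrable g ∧ ∀ᵐ t, ∀ q, ‖ftDeriv G q t‖ ≤ g t := by
  choose g hg hgb using fun i => (hG.partial_inl i).exists_bound hd ha hb
  choose h hh hhb using fun j => (hG.twist j).exists_bound hd (by linarith) hb
  refine ⟨fun t => ∑ i, g i t * ‖coordFst (d := d) i‖ + ∑ j, h j t * ‖coordSnd (d := d) j‖,
    (integrable_finsetSum _ fun i _ => (hg i).mul_const _).add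
      (integrable_finsetSum _ fun j _ => (hh j).mul_const _), ?_⟩
  filter_upwards [ae_all_iff.2 hgb, ae_all_iff.2 hhb] with t h1 h2 q
  refine (norm_add_le _ _).trans (add_le_add (norm_sum_smul_le _ (fun i => ?_) _)
    (norm_sum_smul_le _ (fun j => ?_) _))
  · rw [norm_mul, norm_ex, mul_one]; exact h1 i q.1
  · rw [norm_mul, norm_ex, mul_one]; exact h2 j q.1

/-- Differentiation of the partial Fourier transform. -/
theorem hasFDerivAt_ft (hd : 1 ≤ d) {a b : ℝ} (ha : a < d) (hb : b < 1) {G : RN d × RN d → ℂ}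
    (hG : Rapid a b G) (q : RN d × RN d) :
    HasFDerivAt (ft G) (∑ i, ft (along (anyPartial (Sum.inl i)) G) q • coordFst i +
      ∑ j, ft (fun p => -(2 * Real.pi * Complex.I) * (((p.2 j : ℝ) : ℂ) * G p)) q •
        coordSnd j) q := by
  obtain ⟨g, hg, hgb⟩ := exists_bound_ftDeriv hd ha hb hG
  rw [← (integral_ftDeriv hd ha hb hG q).2]
  refine hasFDerivAt_integral_of_dominated_of_fderiv_le (μ := (volume : Measure (RN d)))
    (F := fun (q : RN d × RN d) t => G (q.1, t) * ex q.2 t) (F' := ftDeriv G) (s := Set.univ)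
    (bound := g) Filter.univ_mem
    (Filter.Eventually.of_forall fun q => (aestronglyMeasurable_slice hG.contDiffOn q.1).mul
      (continuous_ex_right q.2).aestronglyMeasurable)
    (Integrable.mul_ex (hG.integrable hd ha hb q.1) q.2)
    (integral_ftDeriv hd ha hb hG q).1.aestronglyMeasurable (hgb.mono fun t ht q _ => ht q) hg ?_
  filter_upwards [Measure.ae_ne volume (0 : RN d)] with t ht q _
  exact hasFDerivAt_ft_integrand (ContDiffOn.diffAt (isOpen_punctured d) hG.contDiffOn
    (show (q.1, t) ∈ punctured d from ht))

/-- By `hasFDerivAt_ft` the derivative is again built from transforms of amplitudes of the same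
kind, those from η having a replaced by a - 1. Hence the induction runs over all a < d at once. -/
theorem contDiff_ft (hd : 1 ≤ d) {a b : ℝ} (ha : a < d) (hb : b < 1) {G : RN d × RN d → ℂ}
    (hG : Rapid a b G) : ContDiff ℝ ∞ (ft G) := by
  rw [contDiff_infty]
  intro n
  induction n generalizing a G with
  | zero =>
    exact contDiff_zero.2 (continuous_iff_continuousAt.2 fun q =>
      (hasFDerivAt_ft hd ha hb hG q).continuousAt)
  | succ n ih =>
    have := (contDiff_succ_iff_hasFDerivAt (𝕜 := ℝ) (n := n) (f := ft G)).2 ⟨_, ?_,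
      fun q => hasFDerivAt_ft hd ha hb hG q⟩
    · exact_mod_cast this
    · refine ContDiff.add (ContDiff.sum fun i _ => ?_) (ContDiff.sum fun j _ => ?_)
      · exact ContDiff.fun_smul (ih ha (hG.partial_inl i)) contDiff_const
      · exact ContDiff.fun_smul (ih (by linarith) ((hG.coord_mul j).const_mul _)) contDiff_const

/-! ### The symbol in the phase coordinates (x, M_x ξ). -/

namespace AdaptedFrame

variable {H : RN d → Submodule ℝ (RN d)} (X : AdaptedFrame H)

/-- The vector with coordinates `(M_x ξ)_i`. -/
noncomputable def mvec (x ξ : RN d) : RN d := ∑ i, ∑ j, (X.A x i j * ξ j) • e i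

theorem mvec_apply (x ξ : RN d) (i : Fin (d + 1)) : X.mvec x ξ i = X.M x ξ i := by
  simp [mvec, M, e, Finset.sum_apply, Pi.single_apply]

/-- The coordinates `(x, M_x ξ)` on phase space. -/
noncomputable def phase (p : RN d × RN d) : RN d × RN d := (p.1, X.mvec p.1 p.2)

theorem rho_eq (x ξ : RN d) : X.rho x ξ = normInit (X.phase (x, ξ)).2 := by
  simp only [rho, normInit, phase, mvec_apply]

theorem hasFDerivAt_phase (p : RN d × RN d) : ∃ L : RN d × RN d →L[ℝ] RN d × RN d,
    HasFDerivAt X.phase L p ∧ ∀ v, L v = (v.1, ∑ i, ∑ j, (X.A p.1 i j * v.2 j +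
      p.2 j * fderiv ℝ (fun z => X.A z i j) p.1 v.1) • e i) := by
  have hc : ∀ q, HasFDerivAt (fun p : RN d × RN d => p.2 q)
      ((EuclideanSpace.proj (𝕜 := ℝ) q).comp (ContinuousLinearMap.snd ℝ (RN d) (RN d))) p :=
    fun q => ((EuclideanSpace.proj (𝕜 := ℝ) q).comp
      (ContinuousLinearMap.snd ℝ (RN d) (RN d))).hasFDerivAt
  have hA : ∀ q l, HasFDerivAt (fun p : RN d × RN d => X.A p.1 q l)
      ((fderiv ℝ (fun z => X.A z q l) p.1).comp (ContinuousLinearMap.fst ℝ (RN d) (RN d))) p :=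
    fun q l => (((X.smooth q l).differentiable (by simp)) p.1).hasFDerivAt.comp p hasFDerivAt_fst
  have h2 := HasFDerivAt.fun_sum (u := Finset.univ) fun i (_ : i ∈ Finset.univ) =>
    HasFDerivAt.fun_sum (u := Finset.univ) fun j (_ : j ∈ Finset.univ) =>
      ((hA i j).mul (hc j)).smul_const (e i : RN d)
  refine ⟨_, (hasFDerivAt_fst (𝕜 := ℝ) (p := p)).prodMk h2, fun v => ?_⟩
  simp only [ContinuousLinearMap.prod_apply, sum_apply, ContinuousLinearMap.coe_fst']
  congr 1

theorem contDiff_phase : ContDiff ℝ ∞ X.phase := by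
  refine contDiff_fst.prodMk ?_
  unfold mvec
  refine ContDiff.sum fun q _ => ContDiff.sum fun l _ => ContDiff.fun_smul (ContDiff.mul ?_ ?_)
    contDiff_const
  · exact (X.smooth q l).comp contDiff_fst
  · exact (EuclideanSpace.proj (𝕜 := ℝ) l).contDiff.comp contDiff_snd

/-- The function with amplitude `G` in the coordinates of the frame. -/
noncomputable def symb (G : RN d × RN d → ℂ) (p : RN d × RN d) : ℂ := ft G (X.phase p)

theorem along_symb (hd : 1 ≤ d) {a b : ℝ} (ha : a < d) (hb : b < 1) {G : RN d × RN d → ℂ}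
    (hG : Rapid a b G) (V : RN d × RN d → RN d × RN d) (p : RN d × RN d) :
    along V (X.symb G) p =
      ∑ i, X.symb (along (anyPartial (Sum.inl i)) G) p * ((V p).1 i : ℝ) +
      ∑ i, X.symb (fun p => -(2 * Real.pi * Complex.I) * (((p.2 i : ℝ) : ℂ) * G p)) p *
        ((∑ j, (X.A p.1 i j * (V p).2 j +
          p.2 j * fderiv ℝ (fun z => X.A z i j) p.1 (V p).1) : ℝ) : ℂ) := by
  obtain ⟨L, hL, hLv⟩ := X.hasFDerivAt_phase p
  have h := ((hasFDerivAt_ft hd ha hb hG (X.phase p)).comp p hL).fderiv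
  have h' : along V (X.symb G) p = _ := congrArg (fun f => f (V p)) h
  rw [h', ContinuousLinearMap.comp_apply, hLv]
  simp [symb, coordFst, coordSnd, e]

/-- D_i is the lift of ∂/∂x^i along which M_x ξ is constant: the term A ∂B A ξ from its ξ-component
cancels ∂A ξ. So only the x-variable of the amplitude is differentiated. -/
theorem along_DSym_symb (hd : 1 ≤ d) {a b : ℝ} (ha : a < d) (hb : b < 1) {G : RN d × RN d → ℂ}
    (hG : Rapid a b G) (i : Fin (d + 1)) :
    along (X.DSym i) (X.symb G) = X.symb (along (anyPartial (Sum.inl i)) G) := by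
  funext p
  rw [X.along_symb hd ha hb hG]
  have h0 : ∀ r, ∑ j, (X.A p.1 r j * (X.DSym i p).2 j +
      p.2 j * fderiv ℝ (fun z => X.A z r j) p.1 (X.DSym i p).1) = 0 := by
    intro r
    have h1 : ∀ j, (X.DSym i p).2 j = ∑ q, ∑ l, X.dB i j q p.1 * X.A p.1 q l * p.2 l := by
      intro j
      simp [DSym, e, Finset.sum_apply, Pi.single_apply]
    have h2 : ∀ l, fderiv ℝ (fun z => X.A z r l) p.1 (X.DSym i p).1 =
        -∑ k, ∑ q, X.A p.1 r k * X.dB i k q p.1 * X.A p.1 q l := fun l => by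
      rw [X.A_mul_dB_mul_A, neg_neg]; rfl
    simp only [h1, h2, Finset.sum_add_distrib, mul_neg, Finset.sum_neg_distrib, Finset.mul_sum]
    rw [add_neg_eq_zero]
    calc _ = ∑ k, ∑ l, ∑ q, X.A p.1 r k * (X.dB i k q p.1 * X.A p.1 q l * p.2 l) :=
          Finset.sum_congr rfl fun k _ => Finset.sum_comm
      _ = ∑ l, ∑ k, ∑ q, X.A p.1 r k * (X.dB i k q p.1 * X.A p.1 q l * p.2 l) := Finset.sum_comm
      _ = _ := by
        refine Finset.sum_congr rfl fun k _ => Finset.sum_congr rfl fun q _ =>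
          Finset.sum_congr rfl fun l _ => ?_
        ring
  simp only [h0, Complex.ofReal_zero, mul_zero, Finset.sum_const_zero, add_zero]
  refine (Finset.sum_eq_single i (fun j _ hj => ?_) (by simp)).trans ?_
  · simp [DSym, e, hj]
  · simp [DSym, e]

/-- The direction (B_j^N)_j is mapped by M_x to the last unit vector, so only the last frequency is
differentiated. This gives the factor t^N and a gain in b. -/
theorem along_DXi_symb (hd : 1 ≤ d) {a b : ℝ} (ha : a < d) (hb : b < 1) {G : RN d × RN d → ℂ}
    (hG : Rapid a b G) :
    along X.DXi (X.symb G) = X.symb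
      (fun p => -(2 * Real.pi * Complex.I) * (((p.2 (Fin.last d) : ℝ) : ℂ) * G p)) := by
  funext p
  rw [X.along_symb hd ha hb hG]
  have h1 : ∀ j, (X.DXi p).2 j = X.B p.1 j (Fin.last d) := by
    intro j
    simp [DXi, e, Finset.sum_apply, Pi.single_apply]
  have h2 : (X.DXi p).1 = 0 := rfl
  have h3 : ∀ r, ∑ j, X.A p.1 r j * X.B p.1 j (Fin.last d) = if r = Fin.last d then 1 else 0 := by
    intro r
    rw [← Matrix.mul_apply, X.A_mul_B, Matrix.one_apply]
  simp only [h1, h2, map_zero, mul_zero, add_zero, h3, PiLp.zero_apply,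
    Complex.ofReal_zero, Finset.sum_const_zero, zero_add]
  refine (Finset.sum_eq_single (Fin.last d) (fun j _ hj => ?_) (by simp)).trans ?_
  · simp [hj]
  · simp

/-- A general ξ-derivative moves M_x ξ in all directions. It gives a combination of all the t^i, for
which only |t^i| ≤ |t| is available, hence a gain in a alone. -/
theorem along_partialSnd_symb (hd : 1 ≤ d) {a b : ℝ} (ha : a < d) (hb : b < 1)
    {G : RN d × RN d → ℂ} (hG : Rapid a b G) (j : Fin (d + 1)) :
    along (partialSnd j) (X.symb G) = X.symb (fun p => ∑ i, ((X.A p.1 i j : ℝ) : ℂ) *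
      (-(2 * Real.pi * Complex.I) * (((p.2 i : ℝ) : ℂ) * G p))) := by
  funext p
  rw [X.along_symb hd ha hb hG]
  have h1 : ∀ l, (partialSnd j p).2 l = if l = j then 1 else 0 := by
    intro l
    simp [partialSnd, e]
  have h2 : (partialSnd j p).1 = 0 := rfl
  simp only [h1, h2, map_zero, mul_zero, add_zero, mul_ite, mul_one, Finset.sum_ite_eq',
    Finset.mem_univ, if_true, PiLp.zero_apply, Complex.ofReal_zero, Finset.sum_const_zero, zero_add]
  simp only [symb, ft, Finset.sum_mul]
  rw [integral_finsetSum]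
  · refine Finset.sum_congr rfl fun i _ => ?_
    rw [← integral_mul_const]
    refine integral_congr_ae (Filter.Eventually.of_forall fun t => ?_)
    simp only [phase]
    ring
  · intro i _
    exact Integrable.mul_ex
      (((hG.twist i).cb_mul (X.cb_A i j)).integrable hd (by linarith) hb _) _

theorem exists_alongList_symb (hd : 1 ≤ d) {a b : ℝ} (ha : a < d) (hb : b < 1)
    {G : RN d × RN d → ℂ} (hG : Rapid a b G) (α : List (Fin (d + 1))) (β : ℕ)
    (I : List (Fin (d + 1))) : ∃ G', Rapid (a - α.length) (b - β) G' ∧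
      alongList (α.map partialSnd ++ List.replicate β X.DXi ++ I.map X.DSym) (X.symb G) =
        X.symb G' := by
  induction α with
  | cons j α ih =>
    obtain ⟨G', h1, h2⟩ := ih
    have hb' : b - β < 1 := by have := (Nat.cast_nonneg β : (0 : ℝ) ≤ β); linarith
    have ha' : a - α.length < d := by
      have := (Nat.cast_nonneg α.length : (0 : ℝ) ≤ α.length); linarith
    refine ⟨_, ?_, (congrArg (along (partialSnd j)) h2).trans
      (X.along_partialSnd_symb hd ha' hb' h1 j)⟩
    have h3 := Rapid.sum Finset.univ fun i _ => (h1.twist i).cb_mul (X.cb_A i j)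
    rwa [sub_sub, ← Nat.cast_succ] at h3
  | nil =>
    induction β with
    | succ β ih =>
      obtain ⟨G', h1, h2⟩ := ih
      have hb' : b - β < 1 := by have := (Nat.cast_nonneg β : (0 : ℝ) ≤ β); linarith
      refine ⟨_, ?_, (congrArg (along X.DXi) h2).trans
        (X.along_DXi_symb hd (by simpa using ha) hb' h1)⟩
      have h3 := h1.last_mul.const_mul (-(2 * Real.pi * Complex.I))
      rwa [sub_sub, ← Nat.cast_succ] at h3
    | zero =>
      induction I with
      | nil => exact ⟨G, by simpa using hG, rfl⟩
      | cons i I ih =>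
        obtain ⟨G', h1, h2⟩ := ih
        exact ⟨_, h1.partial_inl i, (congrArg (along (X.DSym i)) h2).trans
          (X.along_DSym_symb hd (by simpa using ha) (by simpa using hb) h1 i)⟩

theorem exists_norm_phase : ∃ c : ℝ, 1 ≤ c ∧ ∀ x ξ,
    ‖(X.phase (x, ξ)).2‖ ≤ c * ‖ξ‖ ∧ ‖ξ‖ ≤ c * ‖(X.phase (x, ξ)).2‖ := by
  obtain ⟨C, hC0, hC⟩ := X.A_bound
  obtain ⟨C', hC0', hC'⟩ := X.B_bound
  have key : ∀ (D : ℝ), 0 ≤ D → D ≤ C + C' → ∀ (P : Matrix (Fin (d + 1)) (Fin (d + 1)) ℝ)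
      (v w : RN d), (∀ i j, |P i j| ≤ D) → (∀ i, v i = ∑ j, P i j * w j) →
      ‖v‖ ≤ (1 + (d + 1) * ((d + 1) * (C + C'))) * ‖w‖ := by
    intro D h0 hD P v w hP hv
    have h1 : ∀ l, |v l| ≤ (d + 1) * ((C + C') * ‖w‖) := by
      intro l
      rw [hv]
      refine (Finset.abs_sum_le_sum_abs _ _).trans ?_
      refine (Finset.sum_le_card_nsmul _ _ ((C + C') * ‖w‖) fun q _ => ?_).trans (le_of_eq ?_)
      · rw [abs_mul]
        exact mul_le_mul ((hP l q).trans hD) (abs_coord_le_norm w q) (abs_nonneg _) (by positivity)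
      · simp
    refine (norm_le_sum_coord _).trans ?_
    refine (Finset.sum_le_card_nsmul _ _ _ fun q _ => h1 q).trans ?_
    have := norm_nonneg w
    simp; nlinarith
  refine ⟨1 + (d + 1) * ((d + 1) * (C + C')), le_add_of_nonneg_right (by positivity), fun x ξ => ⟨?_, ?_⟩⟩
  · exact key C hC0 (by linarith) (X.A x) _ _ (hC x) fun i => X.mvec_apply x ξ i
  · refine key C' hC0' (by linarith) (X.B x) _ _ (hC' x) fun i => ?_
    have h : ∀ l, ∑ j, X.B x i j * X.A x j l = if i = l then 1 else 0 := by
      intro l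
      rw [← Matrix.mul_apply, X.B_mul_A, Matrix.one_apply]
    simp only [phase, mvec_apply, M, Finset.mul_sum]
    rw [Finset.sum_comm]
    simp only [← mul_assoc, ← Finset.sum_mul, h]
    simp

end AdaptedFrame

theorem rpow_le_rpow_of_comparable {s t c : ℝ} (hs : 0 < s) (ht : 0 < t) (hc : 1 ≤ c)
    (h1 : s ≤ c * t) (h2 : t ≤ c * s) (r : ℝ) : s ^ r ≤ c ^ |r| * t ^ r := by
  have hc0 : 0 < c := by linarith
  rcases le_total 0 r with hr | hr
  · rw [abs_of_nonneg hr, ← Real.mul_rpow hc0.le ht.le]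
    exact Real.rpow_le_rpow hs.le h1 hr
  · rw [abs_of_nonpos hr, Real.rpow_neg hc0.le, ← Real.inv_rpow hc0.le,
      ← Real.mul_rpow (by positivity) ht.le]
    exact Real.rpow_le_rpow_of_nonpos (by positivity) (by rw [inv_mul_le_iff₀ hc0]; exact h2) hr

namespace AdaptedFrame

variable {H : RN d → Submodule ℝ (RN d)} (X : AdaptedFrame H)

/-- With a = d + n - |α| and b = 1 + m - β, the exponents a - d and b - 1 of `ft_bound` are those of
the symbol class. It remains to replace |M_x ξ| by the comparable |ξ|, while ρ_x(ξ) is exactly the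
norm of the first d coordinates of M_x ξ. -/
theorem isSymbol_symb (hd : 1 ≤ d) {m n : ℝ} (hm : m < 0) (hn : n < 0) {G : RN d × RN d → ℂ}
    (hG : Rapid (d + n) (1 + m) G) : X.IsSymbol m n (X.symb G) := by
  have ha : (d : ℝ) + n < d := by linarith
  have hb : 1 + m < 1 := by linarith
  refine ⟨(contDiff_ft hd ha hb hG).comp X.contDiff_phase, fun α β I => ?_⟩
  obtain ⟨G', h1, h2⟩ := X.exists_alongList_symb hd ha hb hG α β I
  have hβ := (Nat.cast_nonneg β : (0 : ℝ) ≤ β)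
  have hα := (Nat.cast_nonneg α.length : (0 : ℝ) ≤ α.length)
  obtain ⟨C, hC0, hC⟩ := ft_bound hd (by linarith) (by linarith) h1
  obtain ⟨c, hc, hcx⟩ := X.exists_norm_phase
  refine ⟨C * (c ^ |m - β| * c ^ |n - α.length|), fun x ξ => ?_⟩
  rw [h2]
  obtain ⟨h3, h4⟩ := hcx x ξ
  have h5 := hC x (X.phase (x, ξ)).2
  have e1 : 1 + m - β - 1 = m - β := by ring
  have e2 : (d : ℝ) + n - α.length - d = n - α.length := by ring
  rw [e1, e2, ← X.rho_eq] at h5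
  set η := (X.phase (x, ξ)).2
  have hρ : 0 ≤ X.rho x ξ := Real.sqrt_nonneg _
  have hη := norm_nonneg η
  have hξ := norm_nonneg ξ
  have hsq : ∀ {s t : ℝ}, s ≤ c * t → √s ≤ c * √t := fun {s t} h => by
    refine (Real.sqrt_le_sqrt h).trans ?_
    rw [Real.sqrt_mul (by linarith)]
    exact mul_le_mul_of_nonneg_right ((Real.sqrt_le_iff.2 ⟨by linarith, by nlinarith⟩)) (Real.sqrt_nonneg _)
  have h6 := rpow_le_rpow_of_comparable (s := 1 + ‖η‖) (t := 1 + ‖ξ‖) (by positivity)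
    (by positivity) hc (by nlinarith) (by nlinarith) (m - β)
  have h7 := rpow_le_rpow_of_comparable (s := 1 + X.rho x ξ + √‖η‖) (t := 1 + X.rho x ξ + √‖ξ‖)
    (by positivity) (by positivity) hc (by nlinarith [hsq h3]) (by nlinarith [hsq h4])
    (n - α.length)
  refine (show _ ≤ _ from h5).trans ((mul_le_mul_of_nonneg_left
    (mul_le_mul h6 h7 (by positivity) (by positivity)) hC0).trans (le_of_eq (by ring)))

/-- The determinant is continuous and never zero on a connected space, so its sign is constant and
its absolute value is as smooth as the determinant. -/
theorem cb_abs_det : Cb (fun x => ((|(X.A x).det| : ℝ) : ℂ)) := by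
  have h1 : Cb (fun x => (((X.A x).det : ℝ) : ℂ)) := by
    have : (fun x => (((X.A x).det : ℝ) : ℂ)) = fun x => ∑ σ : Equiv.Perm (Fin (d + 1)),
        ((((Equiv.Perm.sign σ : ℤ)) : ℂ) * ∏ i, ((X.A x (σ i) i : ℝ) : ℂ)) := by
      funext x
      rw [Matrix.det_apply']
      push_cast
      rfl
    rw [this]
    exact Cb.sum _ fun σ _ => (cb_const _).mul (Cb.prod _ fun i _ => X.cb_A _ _)
  have hcont : Continuous fun x => (X.A x).det := (contDiff_det X.smooth).continuous
  have hs : (∀ x, 0 < (X.A x).det) ∨ ∀ x, (X.A x).det < 0 := by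
    by_contra! h
    obtain ⟨⟨x, hx⟩, y, hy⟩ := h
    obtain ⟨z, hz⟩ := mem_range_of_exists_le_of_exists_ge hcont ⟨x, hx⟩ ⟨y, hy⟩
    exact X.det_ne_zero z hz
  rcases hs with hs | hs
  · simpa only [abs_of_pos (hs _)] using h1
  · have := (cb_const (d := d) (-1)).mul h1
    simpa only [abs_of_neg (hs _), Complex.ofReal_neg, neg_one_mul] using this

/-- The amplitude of a kernel in the coordinates of the frame. -/
noncomputable def ampl (k : RN d × RN d → ℂ) (p : RN d × RN d) : ℂ :=
  ((|(X.A p.1).det| : ℝ) : ℂ) * k (X.chart p)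

theorem rapid_ampl {m n : ℝ} (hm : -1 < m) (hn : -(d : ℝ) < n) {k : RN d × RN d → ℂ}
    (sk : ContDiffOn ℝ ∞ k (offDiag d)) (hk : X.KernelBounds m n k) :
    Rapid (d + n) (1 + m) (X.ampl k) :=
  Rapid.cb_mul (fun M => X.cl_kernel hm hn sk hk M) X.cb_abs_det

end AdaptedFrame

/-! ### From the kernel to the operator and the tempered distribution. -/

theorem ae_mem_offDiag (d : ℕ) : ∀ᵐ p : RN d × RN d, p ∈ offDiag d := by
  have hm : MeasurableSet (offDiag d) :=
    (isOpen_ne_fun continuous_fst continuous_snd).measurableSet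
  rw [Measure.volume_eq_prod, Measure.ae_prod_mem_iff_ae_ae_mem hm]
  exact Filter.Eventually.of_forall fun x => (Measure.ae_ne volume x).mono fun y hy => Ne.symm hy

namespace AdaptedFrame

variable {H : RN d → Submodule ℝ (RN d)} (X : AdaptedFrame H)

theorem hasFDerivAt_chart_snd (x : RN d) : ∃ L : RN d →L[ℝ] RN d,
    (∀ t, HasFDerivAt (fun t => (X.chart (x, t)).2) L t) ∧ |L.det| = |(X.A x).det| := by
  let L : RN d →ₗ[ℝ] RN d := Matrix.toLpLin 2 2 (X.A x)ᵀ
  have hL : ∀ t, X.comb x t = LinearMap.toContinuousLinearMap L t := by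
    intro t
    ext l
    rw [comb_apply]
    simp only [L, LinearMap.coe_toContinuousLinearMap', Matrix.toLpLin_apply, Matrix.mulVec,
      dotProduct, Matrix.transpose_apply]
    exact Finset.sum_congr rfl fun _ _ => mul_comm _ _
  refine ⟨-LinearMap.toContinuousLinearMap L, fun t => ?_, ?_⟩
  · simp only [chart, hL]
    exact (LinearMap.toContinuousLinearMap L).hasFDerivAt.const_sub x
  · have h1 : (-LinearMap.toContinuousLinearMap L).det = LinearMap.det (-L) := rfl
    have h2 : LinearMap.det L = (X.A x).det := by
      simp only [L]
      rw [Matrix.toLpLin_eq_toLin, LinearMap.det_toLin, Matrix.det_transpose]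
    rw [h1, ← neg_one_smul ℝ L, LinearMap.det_smul, h2, abs_mul, abs_pow]
    simp

theorem chart_snd_bijective (x : RN d) : Function.Bijective fun t => (X.chart (x, t)).2 := by
  refine Function.bijective_iff_has_inverse.2 ⟨X.theta x, fun t => X.theta_comb x t, fun y => ?_⟩
  simp only [chart, comb_theta, sub_sub_cancel]

theorem integral_chart {E : Type*} [NormedAddCommGroup E] [NormedSpace ℝ E] (x : RN d)
    (F : RN d → E) : ∫ y, F y = ∫ t, |(X.A x).det| • F (X.chart (x, t)).2 := by
  obtain ⟨L, hL, hdet⟩ := X.hasFDerivAt_chart_snd x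
  have := integral_image_eq_integral_abs_det_fderiv_smul volume MeasurableSet.univ
    (fun t _ => (hL t).hasFDerivWithinAt) (X.chart_snd_bijective x).injective.injOn F
  rwa [Set.image_univ, (X.chart_snd_bijective x).surjective.range_eq, setIntegral_univ,
    setIntegral_univ, hdet] at this

theorem integrable_chart {E : Type*} [NormedAddCommGroup E] [NormedSpace ℝ E] (x : RN d)
    (F : RN d → E) :
    Integrable F ↔ Integrable fun t => |(X.A x).det| • F (X.chart (x, t)).2 := by
  obtain ⟨L, hL, hdet⟩ := X.hasFDerivAt_chart_snd x
  have := integrableOn_image_iff_integrableOn_abs_det_fderiv_smul volume MeasurableSet.univ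
    (fun t _ => (hL t).hasFDerivWithinAt) (X.chart_snd_bijective x).injective.injOn F
  rwa [Set.image_univ, (X.chart_snd_bijective x).surjective.range_eq, integrableOn_univ,
    integrableOn_univ, hdet] at this

variable {k : RN d × RN d → ℂ}

theorem exists_integral_kernel_le (hd : 1 ≤ d) {a b : ℝ} (ha : a < d) (hb : b < 1)
    (hk : Rapid a b (X.ampl k)) :
    (∀ x, Integrable fun y => k (x, y)) ∧ ∃ C : ℝ, ∀ x, ∫ y, ‖k (x, y)‖ ≤ C := by
  obtain ⟨g, hg, hgb⟩ := hk.exists_bound hd ha hb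
  refine ⟨fun x => (X.integrable_chart x _).2 (hk.integrable hd ha hb x), ∫ t, g t, fun x => ?_⟩
  rw [X.integral_chart x]
  refine integral_mono_of_nonneg (Filter.Eventually.of_forall fun t => ?_) hg
    (hgb.mono fun t ht => ?_)
  · simp only [Pi.zero_apply]; positivity
  · refine le_of_eq_of_le ?_ (ht x)
    simp [ampl, chart]

/-- M_x is the transpose of t ↦ Σ t^q X_q(x), so t·M_x ξ = (x-y)·ξ in the chart. This identifies the
transform at M_x ξ with the oscillatory integral of k in y. -/
theorem inner_mvec (x ξ t : RN d) : inner ℝ t (X.mvec x ξ) = inner ℝ (X.comb x t) ξ := by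
  simp only [PiLp.inner_apply, RCLike.inner_apply, conj_trivial, mvec_apply, comb_apply, M,
    Finset.sum_mul, Finset.mul_sum]
  rw [Finset.sum_comm]
  exact Finset.sum_congr rfl fun i _ => Finset.sum_congr rfl fun j _ => by ring

theorem symb_ampl (x ξ : RN d) : X.symb (X.ampl k) (x, ξ) =
    ∫ y, k (x, y) * Complex.exp (2 * Real.pi * Complex.I * (inner ℝ (y - x) ξ : ℝ)) := by
  rw [X.integral_chart x, symb, ft]
  refine integral_congr_ae (Filter.Eventually.of_forall fun t => ?_)
  simp only [phase, ampl, ex, inner_mvec, chart, Complex.real_smul, mul_assoc, sub_sub_cancel_left,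
    inner_neg_left, Complex.ofReal_neg, mul_neg]

end AdaptedFrame

variable {k : RN d × RN d → ℂ}

theorem integral_exp_mul_fourier (f : 𝓢(RN d, ℂ)) (y : RN d) :
    ∫ ξ, Complex.exp (2 * Real.pi * Complex.I * (inner ℝ y ξ : ℝ)) * 𝓕 (f : RN d → ℂ) ξ = f y := by
  have h : 𝓕⁻ (𝓕 (f : RN d → ℂ)) = f := by
    rw [← SchwartzMap.fourier_coe, ← SchwartzMap.fourierInv_coe, FourierTransform.fourierInv_fourier_eq]
  rw [← congrFun h y, Real.fourierInv_eq']
  refine integral_congr_ae (Filter.Eventually.of_forall fun ξ => ?_)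
  simp only [smul_eq_mul, real_inner_comm y ξ]
  congr 2
  push_cast
  ring

/-- Fubini is justified because both k(x,·) and the Fourier transform of f are integrable; the
ξ-integral is then Fourier inversion at y. -/
theorem pseudo_eq_integral {a : RN d × RN d → ℂ}
    (hk : ∀ x, Integrable fun y => k (x, y))
    (ha : ∀ x ξ, a (x, ξ) =
      ∫ y, k (x, y) * Complex.exp (2 * Real.pi * Complex.I * (inner ℝ (y - x) ξ : ℝ)))
    (f : 𝓢(RN d, ℂ)) (x : RN d) : pseudo a f x = ∫ y, k (x, y) * f y := by
  have hf : Integrable (𝓕 (f : RN d → ℂ)) := by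
    rw [← SchwartzMap.fourier_coe]; exact (𝓕 f).integrable
  have hint : Integrable (Function.uncurry fun ξ y : RN d => k (x, y) * 𝓕 (f : RN d → ℂ) ξ *
      Complex.exp (2 * Real.pi * Complex.I * (inner ℝ y ξ : ℝ))) (volume.prod volume) := by
    refine Integrable.mul_bdd (c := 1) ?_ ?_ (Filter.Eventually.of_forall fun p => ?_)
    · exact (hf.mul_prod (hk x)).congr (Filter.Eventually.of_forall fun p => mul_comm _ _)
    · exact (by fun_prop : Continuous fun p : RN d × RN d =>
        Complex.exp (2 * Real.pi * Complex.I * (inner ℝ p.2 p.1 : ℝ))).aestronglyMeasurable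
    · rw [Complex.norm_exp]; simp
  calc pseudo a f x = ∫ ξ, ∫ y, k (x, y) * 𝓕 (f : RN d → ℂ) ξ *
        Complex.exp (2 * Real.pi * Complex.I * (inner ℝ y ξ : ℝ)) := by
        refine integral_congr_ae (Filter.Eventually.of_forall fun ξ => ?_)
        simp only [ha]
        rw [mul_assoc, ← integral_mul_const]
        refine integral_congr_ae (Filter.Eventually.of_forall fun y => ?_)
        simp only []
        have : Complex.exp (2 * Real.pi * Complex.I * (inner ℝ y ξ : ℝ)) =
            Complex.exp (2 * Real.pi * Complex.I * (inner ℝ (y - x) ξ : ℝ)) *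
            Complex.exp (2 * Real.pi * Complex.I * (inner ℝ x ξ : ℝ)) := by
          rw [← Complex.exp_add, inner_sub_left]
          congr 1; push_cast; ring
        rw [this]; ring
    _ = ∫ y, ∫ ξ, k (x, y) * 𝓕 (f : RN d → ℂ) ξ *
        Complex.exp (2 * Real.pi * Complex.I * (inner ℝ y ξ : ℝ)) := integral_integral_swap hint
    _ = _ := by
        refine integral_congr_ae (Filter.Eventually.of_forall fun y => ?_)
        simp only []
        rw [← integral_exp_mul_fourier f y, ← integral_const_mul]
        refine integral_congr_ae (Filter.Eventually.of_forall fun ξ => ?_)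
        simp only []; ring

theorem aestronglyMeasurable_kernel (sk : ContDiffOn ℝ ∞ k (offDiag d)) :
    AEStronglyMeasurable k := by
  have hU : IsOpen (offDiag d) := isOpen_ne_fun continuous_fst continuous_snd
  have h := sk.continuousOn.aestronglyMeasurable (μ := volume) hU.measurableSet
  rwa [Measure.restrict_eq_self_of_ae_mem (ae_mem_offDiag d)] at h

/-- The integral of |k(x,y)| in y is bounded uniformly in x, so decay in x alone suffices. The
exponent d + 2 exceeds the dimension d + 1. -/
theorem integrable_kernel_decay (sk : ContDiffOn ℝ ∞ k (offDiag d))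
    (hk : ∀ x, Integrable fun y => k (x, y)) (hC : ∃ C : ℝ, ∀ x, ∫ y, ‖k (x, y)‖ ≤ C) :
    Integrable fun p : RN d × RN d => ((((1 + ‖p.1‖) ^ (d + 2))⁻¹ : ℝ) : ℂ) * k p := by
  obtain ⟨C, hC⟩ := hC
  have hw : Integrable fun x : RN d => ((1 + ‖x‖) ^ (d + 2))⁻¹ := by
    have h := integrable_one_add_norm (E := RN d) (μ := volume) (r := (d + 2 : ℕ))
      (by simp)
    refine h.congr (Filter.Eventually.of_forall fun x => ?_)
    simp only []
    rw [Real.rpow_neg (by positivity), Real.rpow_natCast]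
  have hcont : Continuous fun x : RN d => ((1 + ‖x‖) ^ (d + 2))⁻¹ :=
    Continuous.inv₀ (by fun_prop) fun x => by positivity
  have hm : AEStronglyMeasurable
      (fun p : RN d × RN d => ((((1 + ‖p.1‖) ^ (d + 2))⁻¹ : ℝ) : ℂ) * k p) :=
    (Complex.continuous_ofReal.comp (hcont.comp continuous_fst)).aestronglyMeasurable.mul
      (aestronglyMeasurable_kernel sk)
  rw [Measure.volume_eq_prod] at hm ⊢
  rw [integrable_prod_iff hm]
  refine ⟨Filter.Eventually.of_forall fun x =>
    (hk x).const_mul ((((1 + ‖x‖) ^ (d + 2))⁻¹ : ℝ) : ℂ), ?_⟩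
  refine Integrable.mono' (hw.mul_const C) hm.norm.integral_prod_right'
    (Filter.Eventually.of_forall fun x => ?_)
  have h0 : 0 ≤ ((1 + ‖x‖) ^ (d + 2))⁻¹ := by positivity
  simp only [norm_mul, Complex.norm_real, integral_const_mul]
  rw [Real.norm_of_nonneg (integral_nonneg fun y => norm_nonneg _)]
  simp only [Real.norm_of_nonneg h0]
  exact mul_le_mul_of_nonneg_left (hC x) h0

theorem locallyIntegrable_kernel
    (hk : Integrable fun p : RN d × RN d => ((((1 + ‖p.1‖) ^ (d + 2))⁻¹ : ℝ) : ℂ) * k p) :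
    LocallyIntegrable k := by
  have hc : Continuous fun p : RN d × RN d => (((1 + ‖p.1‖) ^ (d + 2) : ℝ) : ℂ) := by fun_prop
  rw [locallyIntegrable_iff]
  intro s hs
  refine (hk.integrableOn.continuousOn_mul hc.continuousOn hs).congr
    (Filter.Eventually.of_forall fun p => ?_)
  have h0 : (((1 + ‖p.1‖) ^ (d + 2) : ℝ) : ℂ) ≠ 0 :=
    Complex.ofReal_ne_zero.2 (by positivity)
  simp only [Complex.ofReal_inv]
  rw [mul_inv_cancel_left₀ h0]

theorem norm_schwartz_mul_kernel_le (φ : 𝓢(RN d × RN d, ℂ)) (p : RN d × RN d) :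
    ‖φ p * k p‖ ≤ 2 ^ (d + 2) * (Finset.Iic (d + 2, 0)).sup
      (schwartzSeminormFamily ℂ (RN d × RN d) ℂ) φ *
      ‖((((1 + ‖p.1‖) ^ (d + 2))⁻¹ : ℝ) : ℂ) * k p‖ := by
  have h := SchwartzMap.one_add_le_sup_seminorm_apply (𝕜 := ℂ) (m := (d + 2, 0)) (k := d + 2)
    (n := 0) le_rfl le_rfl φ p
  rw [norm_iteratedFDeriv_zero] at h
  have h0 : 0 < (1 + ‖p.1‖) ^ (d + 2) := by positivity
  rw [norm_mul, norm_mul, Complex.norm_real, Real.norm_of_nonneg (by positivity), ← mul_assoc]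
  refine mul_le_mul_of_nonneg_right ?_ (norm_nonneg _)
  rw [← div_eq_mul_inv, le_div_iff₀ h0, mul_comm]
  refine le_trans ?_ h
  gcongr
  exact norm_fst_le p

theorem integrable_schwartz_mul_kernel (hm : AEStronglyMeasurable k)
    (hk : Integrable fun p : RN d × RN d => ((((1 + ‖p.1‖) ^ (d + 2))⁻¹ : ℝ) : ℂ) * k p)
    (φ : 𝓢(RN d × RN d, ℂ)) : Integrable fun p => φ p * k p :=
  Integrable.mono' (hk.norm.const_mul _) (φ.continuous.aestronglyMeasurable.mul hm)
    (Filter.Eventually.of_forall fun p => norm_schwartz_mul_kernel_le φ p)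

theorem exists_tempered (hm : AEStronglyMeasurable k)
    (hk : Integrable fun p : RN d × RN d => ((((1 + ‖p.1‖) ^ (d + 2))⁻¹ : ℝ) : ℂ) * k p) :
    ∃ T : 𝓢'(RN d × RN d, ℂ), ∀ φ, T φ = ∫ p, φ p * k p := by
  have hi := integrable_schwartz_mul_kernel hm hk
  let L : 𝓢(RN d × RN d, ℂ) →L[ℂ] ℂ := SchwartzMap.mkCLMtoNormedSpace (fun φ => ∫ p, φ p * k p)
    (fun f g => by
      simp only [add_apply, add_mul]
      exact integral_add (hi f) (hi g))
    (fun c f => by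
      simp only [smul_apply, smul_eq_mul, mul_assoc, RingHom.id_apply]
      exact integral_const_mul _ _)
    ⟨Finset.Iic (d + 2, 0), 2 ^ (d + 2) *
        ∫ p : RN d × RN d, ‖((((1 + ‖p.1‖) ^ (d + 2))⁻¹ : ℝ) : ℂ) * k p‖, by positivity,
      fun φ => by
        refine (norm_integral_le_of_norm_le (hk.norm.const_mul _)
          (Filter.Eventually.of_forall fun p => norm_schwartz_mul_kernel_le φ p)).trans ?_
        rw [integral_const_mul]
        exact le_of_eq (by ring)⟩
  exact ⟨ContinuousLinearMap.toPointwiseConvergenceCLM _ _ _ _ L, fun φ => rfl⟩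

/-- Off the diagonal both densities represent K, so they agree almost everywhere there; the diagonal
is a null set. This excludes any part of K concentrated on the diagonal. -/
theorem ae_eq_kernel {K : 𝓓'((⊤ : Opens (RN d × RN d)), ℂ)} {h : RN d × RN d → ℂ}
    (hh : LocallyIntegrable h) (hKh : ∀ φ : 𝓓((⊤ : Opens (RN d × RN d)), ℝ), K φ = ∫ p, φ p • h p)
    (hk : LocallyIntegrable k) (hKk : ∀ φ : 𝓓((⊤ : Opens (RN d × RN d)), ℝ),
      tsupport φ ⊆ offDiag d → K φ = ∫ p, φ p • k p) : h =ᵐ[volume] k := by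
  have hU : IsOpen (offDiag d) := isOpen_ne_fun continuous_fst continuous_snd
  have h1 := hU.ae_eq_zero_of_integral_contDiff_smul_eq_zero (μ := volume)
    ((hh.sub hk).locallyIntegrableOn _) fun g hg hc hs => by
      let φ : 𝓓((⊤ : Opens (RN d × RN d)), ℝ) := ⟨g, hg, hc, fun _ _ => trivial⟩
      have e1 : K φ = ∫ p, g p • h p := hKh φ
      have e2 : K φ = ∫ p, g p • k p := hKk φ hs
      simp only [Pi.sub_apply, smul_sub]
      rw [integral_sub (hh.integrable_smul_left_of_hasCompactSupport hg.continuous hc)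
        (hk.integrable_smul_left_of_hasCompactSupport hg.continuous hc), ← e1, ← e2, sub_self]
  filter_upwards [h1, ae_mem_offDiag d] with p hp hp'
  exact sub_eq_zero.1 (hp hp')

end MixedSymbol

/-! ### Conclusion. -/

theorem mainTheorem6 (d : ℕ) (H : MixedSymbol.RN d → Submodule ℝ (MixedSymbol.RN d))
    (X : MixedSymbol.AdaptedFrame H) (m n : ℝ) (hm : -1 < m) (hn : -(d : ℝ) < n)
    (hm0 : m < 0) (hn0 : n < 0)
    (K : 𝓓'((⊤ : Opens (MixedSymbol.RN d × MixedSymbol.RN d)), ℂ))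
    (hK : MixedSymbol.KernelEstimates X m n K)
    (hloc : MixedSymbol.IsLocallyIntegrableDistribution K) :
    ∃ a : MixedSymbol.RN d × MixedSymbol.RN d → ℂ,
      X.IsSymbol m n a ∧ MixedSymbol.IsKernelOf K a := by
  -- The range -d < n < 0 is empty for d = 0, so the dimension d + 1 is at least 2, as the
  -- integration by parts requires.
  have hd : 1 ≤ d := by
    have : (0 : ℝ) < d := by linarith
    exact_mod_cast this
  obtain ⟨k, sk, hKk, hk⟩ := hK
  obtain ⟨h, hh, hKh⟩ := hloc
  have hG := X.rapid_ampl hm hn sk hk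
  obtain ⟨hki, hkC⟩ := X.exists_integral_kernel_le hd (by linarith) (by linarith) hG
  have hmeas := MixedSymbol.aestronglyMeasurable_kernel sk
  have hdec := MixedSymbol.integrable_kernel_decay sk hki hkC
  have hae := MixedSymbol.ae_eq_kernel hh hKh (MixedSymbol.locallyIntegrable_kernel hdec) hKk
  obtain ⟨T, hT⟩ := MixedSymbol.exists_tempered hmeas hdec
  refine ⟨X.symb (X.ampl k), X.isSymbol_symb hd hm0 hn0 hG, T, fun φ => ?_, fun f g => ?_⟩
  · rw [hT, hKh]
    refine integral_congr_ae (hae.mono fun p hp => ?_)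
    simp only []
    rw [hp, Complex.real_smul]
    rfl
  · have hi := MixedSymbol.integrable_schwartz_mul_kernel hmeas hdec (MixedSymbol.tensor f g)
    rw [hT]
    rw [Measure.volume_eq_prod] at hi ⊢
    rw [integral_prod _ hi]
    refine integral_congr_ae (Filter.Eventually.of_forall fun x => ?_)
    simp only []
    rw [MixedSymbol.pseudo_eq_integral hki (X.symb_ampl) f x, ← integral_mul_const]
    refine integral_congr_ae (Filter.Eventually.of_forall fun y => ?_)
    change k (x, y) * f y * g x = f y * g x * k (x, y)
    ring
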